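/- Let $Q$ be a (Hausdorff, second countable) smooth manifold of dimension $n$, let $k\ge 1$, and let $\mathrm{T}^rQ$ denote the $r$-th order tangent bundle, i.e. the manifold of $r$-jets $j^r_0\phi$ at $0$ of smooth curves $\phi$ in $Q$, with natural coordinates $(q_0^A,\dots,q_r^A)$, $q_i^A(j^r_0\phi)=\frac{d^i\phi^A}{dt^i}(0)$, and projections $\rho^r_s\colon \mathrm{T}^rQ\to \mathrm{T}^sQ$, $j^r_0\phi\mapsto j^s_0\phi$ ($s\le r$). Let $d_T=\sum_i q^A_{i+1}\,\partial/\partial q_i^A$ be the total time derivative. Let $\mathcal L\in \mathrm C^\infty(\mathrm{T}^kQ)$ be a regular Lagrangian, i.e. the Hessian $\big(\partial^2\mathcal L/\partial q_k^A\partial q_k^B\big)$ is everywhere nondegenerate. Let $$\theta_{\mathcal L}=\sum_{r=1}^k\hat p^{\,r-1}_A\,dq^A_{r-1},\qquad \omega_{\mathcal L}=-d\theta_{\mathcal L},\qquad E_{\mathcal L}=\sum_{r=1}^k q_r^A\,\hat p^{\,r-1}_A-\mathcal L,\qquad \hat p^{\,r-1}_A=\sum_{i=0}^{k-r}(-1)^i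 d_T^i\Big(\frac{\partial\mathcal L}{\partial q^A_{r+i}}\Big),$$ be the Poincaré–Cartan forms and the energy on $\mathrm{T}^{2k-1}Q$, and let $X_{\mathcal L}$ be the unique vector field on $\mathrm{T}^{2k-1}Q$ with $i(X_{\mathcal L})\omega_{\mathcal L}=dE_{\mathcal L}$. Let $\rho=\rho^{2k-1}_{k-1}\colon \mathrm{T}^{2k-1}Q\to \mathrm{T}^{k-1}Q$, let $s$ be a smooth global section of $\rho$ with $s^*\omega_{\mathcal L}=0$, and let $X=\mathrm{T}\rho\circ X_{\mathcal L}\circ s$, a vector field on $\mathrm{T}^{k-1}Q$. Integral curves are defined on open intervals. The following assertions are equivalent. 1. $s$ is a solution to the $k$-th order Lagrangian Hamilton–Jacobi problem: $s^*\omega_{\mathcal L}=0$, and for every integral curve $\gamma$ of $X$ the curve $s\circ\gamma$ is an integral curve of $X_{\mathcal L}$. 2. $d(s^*E_{\mathcal L})=0$. 3. $\mathrm{Im}(s)$ is a Lagrangian submanifold of $(\mathrm{T}^{2k-1}Q,\omega_{\mathcal L})$, and it is invariant by $X_{\mathcal L}$, i.e. $X_{\mathcal L}$ is tangent to $\mathrm{Im}(s)$.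 4. For every integral curve $\psi$ of $X_{\mathcal L}$ with $\psi(0)\in\mathrm{Im}(s)$, the curve $\rho\circ\psi$ is an integral curve of $X$. 5. Assertion 4 holds, and moreover every integral curve of $X$ (on an open interval containing $0$) is of the form $\rho\circ\psi$ for such a curve $\psi$. -/

import Mathlib

open Set Filter Topology Manifold
open scoped ContDiff

noncomputable section

namespace HigherTangent

variable (E : Type*) [NormedAddCommGroup E] [NormedSpace ℝ E]
variable (Q : Type*) [TopologicalSpace Q] [ChartedSpace E Q]

/-- Curves in `Q`, defined on `ℝ` (with irrelevant values away from `0`), that are smooth on a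
neighbourhood of `0`. -/
abbrev Curve : Type _ :=
  {φ : ℝ → Q // ∀ᶠ t in 𝓝 (0 : ℝ), ContMDiffAt 𝓘(ℝ, ℝ) 𝓘(ℝ, E) ∞ φ t}

/-- The `r`-jet equivalence relation at `0`: equal value at `0`, and equal derivatives at `0` up to
order `r` in the chart at that value. -/
def jetSetoid (r : ℕ) : Setoid (Curve E Q) where
  r φ ψ := φ.1 0 = ψ.1 0 ∧ ∀ i ≤ r,
    iteratedDeriv i (chartAt E (φ.1 0) ∘ φ.1) 0 = iteratedDeriv i (chartAt E (φ.1 0) ∘ ψ.1) 0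
  iseqv :=
    { refl := fun _ => ⟨rfl, fun _ _ => rfl⟩
      symm := fun {φ ψ} h => ⟨h.1.symm, fun i hi => by
        have := h.2 i hi
        rw [h.1] at this
        exact this.symm⟩
      trans := fun {φ ψ χ} h h' => ⟨h.1.trans h'.1, fun i hi => by
        have h2 := h'.2 i hi
        rw [← h.1] at h2
        exact (h.2 i hi).trans h2⟩ }

end HigherTangent

open HigherTangent

/-- The `r`-th order tangent bundle `T^r Q`: the `r`-jets at `0` of smooth curves in `Q`. -/
def HigherTangent (E : Type*) [NormedAddCommGroup E] [NormedSpace ℝ E] (r : ℕ)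
    (Q : Type*) [TopologicalSpace Q] [ChartedSpace E Q] : Type _ :=
  Quotient (jetSetoid E Q r)

namespace HigherTangent

section Basic

variable {E : Type*} [NormedAddCommGroup E] [NormedSpace ℝ E]
variable {Q : Type*} [TopologicalSpace Q] [ChartedSpace E Q]

/-- The jet `j^r_0 φ`. -/
def jet (r : ℕ) (φ : Curve E Q) : HigherTangent E r Q := Quotient.mk (jetSetoid E Q r) φ

/-- The projection `β^r : T^r Q → Q`, `j^r_0 φ ↦ φ 0`. -/
def base {r : ℕ} (p : HigherTangent E r Q) : Q :=
  Quotient.lift (s := jetSetoid E Q r) (fun φ => φ.1 0) (fun _ _ h => h.1) p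

/-- The projection `ρ^r_s : T^r Q → T^s Q`, `j^r_0 φ ↦ j^s_0 φ`, for `s ≤ r`. -/
def proj {r s : ℕ} (h : s ≤ r) (p : HigherTangent E r Q) : HigherTangent E s Q :=
  Quotient.lift (s := jetSetoid E Q r) (fun φ => jet s φ)
    (fun _ _ hφ => Quotient.sound (s := jetSetoid E Q s)
      ⟨hφ.1, fun i hi => hφ.2 i (hi.trans h)⟩) p

/-- The natural coordinates `(q_0, …, q_r)` on `T^r Q` induced by a chart `c` of `Q`:
`q_i (j^r_0 φ) = (d/dt)^i (c ∘ φ) (0)`. They depend only on the jet when `φ 0` lies in the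
domain of `c` (see `coords_jet`), and are irrelevant elsewhere. -/
def coords (c : OpenPartialHomeomorph Q E) {r : ℕ} (p : HigherTangent E r Q) : Fin (r + 1) → E :=
  fun i => iteratedDeriv i (c ∘ (Quotient.out (s := jetSetoid E Q r) p).1) 0

/-- The curve `t ↦ ∑ q_j t^j / j!` in `E`, whose derivatives at `0` are `q_0, …, q_r`. -/
def taylorCurve {r : ℕ} (q : Fin (r + 1) → E) (t : ℝ) : E :=
  ∑ j : Fin (r + 1), (t ^ (j : ℕ) / ((j : ℕ).factorial : ℝ)) • q j

open Classical in
/-- The jet with natural coordinates `q` in the chart `c`. The second case, which does not occur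
when `q 0` lies in the target of `c`, is irrelevant. -/
def ofCoords (c : OpenPartialHomeomorph Q E) {r : ℕ} (q : Fin (r + 1) → E) :
    HigherTangent E r Q :=
  if h : ∀ᶠ t in 𝓝 (0 : ℝ), ContMDiffAt 𝓘(ℝ, ℝ) 𝓘(ℝ, E) ∞ (c.symm ∘ taylorCurve q) t then
    jet r ⟨c.symm ∘ taylorCurve q, h⟩
  else jet r ⟨fun _ => c.symm (q 0), Eventually.of_forall fun _ => contMDiffAt_const⟩

/-- The map induced on jet coordinates by a map `τ` (Faà di Bruno's formula). -/
def jetMap {F : Type*} [NormedAddCommGroup F] [NormedSpace ℝ F] (τ : E → F) {r : ℕ}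
    (q : Fin (r + 1) → E) : Fin (r + 1) → F :=
  fun i => ∑ p : OrderedFinpartition (i : ℕ), iteratedFDeriv ℝ p.length τ (q 0)
    fun m => q ⟨p.partSize m, Nat.lt_succ_of_le ((p.partSize_le m).trans (Nat.le_of_lt_succ i.2))⟩

theorem base_jet (r : ℕ) (φ : Curve E Q) : base (jet r φ) = φ.1 0 := rfl

theorem exists_rep {r : ℕ} (p : HigherTangent E r Q) : ∃ φ : Curve E Q, jet r φ = p :=
  Quotient.exists_rep p

theorem contDiff_taylorCurve {r : ℕ} (q : Fin (r + 1) → E) : ContDiff ℝ ∞ (taylorCurve q) := by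
  unfold taylorCurve
  fun_prop

theorem iteratedDeriv_taylorCurve {r : ℕ} (q : Fin (r + 1) → E) (i : Fin (r + 1)) :
    iteratedDeriv i (taylorCurve q) 0 = q i := by
  unfold taylorCurve
  rw [iteratedDeriv_fun_sum (fun j _ => by fun_prop)]
  have key : ∀ j : Fin (r + 1), iteratedDeriv (i : ℕ)
      (fun t : ℝ => (t ^ (j : ℕ) / ((j : ℕ).factorial : ℝ)) • q j) 0 =
      if j = i then q j else 0 := by
    intro j
    rw [iteratedDeriv_smul_const (by fun_prop)]
    have : (fun t : ℝ => t ^ (j : ℕ) / ((j : ℕ).factorial : ℝ)) =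
        fun t : ℝ => ((j : ℕ).factorial : ℝ)⁻¹ * t ^ (j : ℕ) := by
      funext t; rw [div_eq_inv_mul]
    rw [this, iteratedDeriv_const_mul _ (by fun_prop), iteratedDeriv_fun_pow_zero]
    by_cases h : j = i
    · subst h
      simp [Nat.factorial_ne_zero]
    · have h' : ¬ ((i : ℕ) = (j : ℕ)) := fun e => h (Fin.ext e.symm)
      simp [h, h']
  simp only [key]
  simp

theorem taylorCurve_zero {r : ℕ} (q : Fin (r + 1) → E) : taylorCurve q 0 = q 0 := by
  simpa using iteratedDeriv_taylorCurve q 0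

theorem jetMap_eq {F : Type*} [NormedAddCommGroup F] [NormedSpace ℝ F] {τ : E → F} {r : ℕ}
    {f : ℝ → E} (hf : ContDiffAt ℝ ∞ f 0) (hτ : ContDiffAt ℝ ∞ τ (f 0)) (i : Fin (r + 1)) :
    iteratedDeriv i (τ ∘ f) 0 =
      jetMap τ (fun j : Fin (r + 1) => iteratedDeriv (j : ℕ) f 0) i := by
  rw [iteratedDeriv_vcomp_eq_sum_orderedFinpartition hτ hf (by exact_mod_cast le_top)]
  simp [jetMap]

theorem contDiffOn_jetMap {F : Type*} [NormedAddCommGroup F] [NormedSpace ℝ F] {τ : E → F}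
    {r : ℕ} {U : Set E} (hU : IsOpen U) (hτ : ContDiffOn ℝ ∞ τ U) :
    ContDiffOn ℝ ∞ (jetMap τ : (Fin (r + 1) → E) → Fin (r + 1) → F) {q | q 0 ∈ U} := by
  intro q hq
  apply ContDiffAt.contDiffWithinAt
  rw [contDiffAt_pi]
  intro i
  refine ContDiffAt.sum fun p _ => ?_
  have h1 : ContDiffAt ℝ ∞ (fun q : Fin (r + 1) → E => iteratedFDeriv ℝ p.length τ (q 0)) q := by
    have : ContDiffAt ℝ ∞ (iteratedFDeriv ℝ p.length τ) (q 0) :=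
      ((hτ.contDiffAt (hU.mem_nhds hq)).iteratedFDeriv_right (m := ∞) (by norm_cast))
    exact this.comp q (contDiffAt_apply (𝕜 := ℝ) (E := E) (n := ∞) 0 q)
  have h2 : ContDiffAt ℝ ∞ (fun q : Fin (r + 1) → E => fun m : Fin p.length =>
      q ⟨p.partSize m, Nat.lt_succ_of_le ((p.partSize_le m).trans (Nat.le_of_lt_succ i.2))⟩) q :=
    contDiffAt_pi.2 fun m => contDiffAt_apply (𝕜 := ℝ) (E := E) (n := ∞) _ q
  have h3 := (ContinuousLinearMap.id ℝ (E [×p.length]→L[ℝ] F)).analyticOnNhd_uncurry_of_multilinear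
    (s := univ)
  exact (h3.contDiff (n := ∞)).contDiffAt.comp q (h1.prodMk h2)


theorem contDiffAt_chart_comp [IsManifold 𝓘(ℝ, E) ∞ Q] {c : OpenPartialHomeomorph Q E}
    (hc : c ∈ atlas E Q) (φ : Curve E Q) (h : φ.1 0 ∈ c.source) :
    ContDiffAt ℝ ∞ (c ∘ φ.1) 0 := by
  have h1 : ContMDiffAt 𝓘(ℝ, E) 𝓘(ℝ, E) ∞ c (φ.1 0) :=
    contMDiffAt_of_mem_maximalAtlas (IsManifold.subset_maximalAtlas hc) h
  exact (h1.comp 0 φ.2.self_of_nhds).contDiffAt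

theorem contDiffOn_transition [IsManifold 𝓘(ℝ, E) ∞ Q] {c c' : OpenPartialHomeomorph Q E}
    (hc : c ∈ atlas E Q) (hc' : c' ∈ atlas E Q) :
    ContDiffOn ℝ ∞ (c' ∘ c.symm) (c.symm.trans c').source := by
  have h1 := contMDiffOn_of_mem_maximalAtlas (I := 𝓘(ℝ, E)) (n := ∞)
    (IsManifold.subset_maximalAtlas hc')
  have h2 := contMDiffOn_symm_of_mem_maximalAtlas (I := 𝓘(ℝ, E)) (n := ∞)
    (IsManifold.subset_maximalAtlas hc)
  rw [← contMDiffOn_iff_contDiffOn]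
  refine h1.comp (h2.mono ?_) ?_
  · intro x hx; exact (by simpa using hx : x ∈ c.target ∧ _).1
  · intro x hx; exact (by simpa using hx : _ ∧ c.symm x ∈ c'.source).2

/-- Change of natural coordinates along a curve. -/
theorem iteratedDeriv_chart_comp [IsManifold 𝓘(ℝ, E) ∞ Q] {c c' : OpenPartialHomeomorph Q E}
    (hc : c ∈ atlas E Q) (hc' : c' ∈ atlas E Q) (φ : Curve E Q) (h : φ.1 0 ∈ c.source)
    (h' : φ.1 0 ∈ c'.source) {r : ℕ} (i : Fin (r + 1)) :
    iteratedDeriv i (c' ∘ φ.1) 0 =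
      jetMap (c' ∘ c.symm) (fun j : Fin (r + 1) => iteratedDeriv (j : ℕ) (c ∘ φ.1) 0) i := by
  have hcont : ContinuousAt φ.1 0 := φ.2.self_of_nhds.continuousAt
  have hev : (c' ∘ φ.1) =ᶠ[𝓝 0] ((c' ∘ c.symm) ∘ (c ∘ φ.1)) := by
    filter_upwards [hcont (c.open_source.mem_nhds h)] with t ht
    have ht' : φ.1 t ∈ c.source := ht
    simp [c.left_inv ht']
  rw [hev.iteratedDeriv_eq]
  refine jetMap_eq (contDiffAt_chart_comp hc φ h) ?_ i
  refine (contDiffOn_transition hc hc').contDiffAt ((c.symm.trans c').open_source.mem_nhds ?_)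
  simp [c.map_source h, c.left_inv h, h']

theorem jet_eq_of_chart [IsManifold 𝓘(ℝ, E) ∞ Q] {c : OpenPartialHomeomorph Q E}
    (hc : c ∈ atlas E Q) {r : ℕ} {φ ψ : Curve E Q} (h : φ.1 0 ∈ c.source) (h0 : φ.1 0 = ψ.1 0)
    (hi : ∀ i : Fin (r + 1), iteratedDeriv i (c ∘ φ.1) 0 = iteratedDeriv i (c ∘ ψ.1) 0) :
    jet r φ = jet r ψ := by
  refine Quotient.sound (s := jetSetoid E Q r) ⟨h0, fun i hir => ?_⟩
  have e1 := iteratedDeriv_chart_comp hc (chart_mem_atlas E (φ.1 0)) φ h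
    (mem_chart_source E (φ.1 0)) (r := r) ⟨i, Nat.lt_succ_of_le hir⟩
  have e2 := iteratedDeriv_chart_comp hc (chart_mem_atlas E (φ.1 0)) ψ (h0 ▸ h)
    (h0 ▸ mem_chart_source E (φ.1 0)) (r := r) ⟨i, Nat.lt_succ_of_le hir⟩
  have e3 : (fun j : Fin (r + 1) => iteratedDeriv (j : ℕ) (c ∘ φ.1) 0) =
      fun j : Fin (r + 1) => iteratedDeriv (j : ℕ) (c ∘ ψ.1) 0 := funext hi
  rw [e3] at e1
  exact e1.trans e2.symm

/-- Natural coordinates can be computed with any representative of a jet. -/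
theorem coords_jet [IsManifold 𝓘(ℝ, E) ∞ Q] {c : OpenPartialHomeomorph Q E} (hc : c ∈ atlas E Q)
    {r : ℕ} (φ : Curve E Q) (h : φ.1 0 ∈ c.source) (i : Fin (r + 1)) :
    coords c (jet r φ) i = iteratedDeriv i (c ∘ φ.1) 0 := by
  set ψ : Curve E Q := Quotient.out (s := jetSetoid E Q r) (jet r φ) with hψ
  have hrel : (jetSetoid E Q r).r ψ φ := Quotient.mk_out (s := jetSetoid E Q r) φ
  obtain ⟨h0, hi⟩ := hrel
  have hs : ψ.1 0 ∈ c.source := h0 ▸ h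
  have e1 := iteratedDeriv_chart_comp (chart_mem_atlas E (ψ.1 0)) hc ψ
    (mem_chart_source E (ψ.1 0)) hs i
  have e2 := iteratedDeriv_chart_comp (chart_mem_atlas E (ψ.1 0)) hc φ
    (h0 ▸ mem_chart_source E (ψ.1 0)) h i
  have e3 : (fun j : Fin (r + 1) => iteratedDeriv (j : ℕ) (chartAt E (ψ.1 0) ∘ ψ.1) 0) =
      fun j : Fin (r + 1) => iteratedDeriv (j : ℕ) (chartAt E (ψ.1 0) ∘ φ.1) 0 :=
    funext fun j => hi j (Nat.le_of_lt_succ j.2)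
  rw [e3] at e1
  exact e1.trans e2.symm

theorem coords_zero [IsManifold 𝓘(ℝ, E) ∞ Q] {c : OpenPartialHomeomorph Q E} (hc : c ∈ atlas E Q)
    {r : ℕ} (p : HigherTangent E r Q) (h : base p ∈ c.source) : coords c p 0 = c (base p) := by
  obtain ⟨φ, rfl⟩ := exists_rep p
  rw [coords_jet hc φ h]
  simp [base_jet]

theorem curve_of_coords [IsManifold 𝓘(ℝ, E) ∞ Q] {c : OpenPartialHomeomorph Q E}
    (hc : c ∈ atlas E Q) {r : ℕ} {q : Fin (r + 1) → E} (h : q 0 ∈ c.target) :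
    ∀ᶠ t in 𝓝 (0 : ℝ), ContMDiffAt 𝓘(ℝ, ℝ) 𝓘(ℝ, E) ∞ (c.symm ∘ taylorCurve q) t := by
  have hcont : Continuous (taylorCurve q) := (contDiff_taylorCurve q).continuous
  have : taylorCurve q ⁻¹' c.target ∈ 𝓝 (0 : ℝ) :=
    (c.open_target.preimage hcont).mem_nhds (by simpa [taylorCurve_zero] using h)
  filter_upwards [this] with t ht
  have h1 : ContMDiffAt 𝓘(ℝ, E) 𝓘(ℝ, E) ∞ c.symm (taylorCurve q t) :=
    contMDiffAt_symm_of_mem_maximalAtlas (IsManifold.subset_maximalAtlas hc) ht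
  exact h1.comp t (contDiff_taylorCurve q).contDiffAt.contMDiffAt

theorem ofCoords_eq [IsManifold 𝓘(ℝ, E) ∞ Q] {c : OpenPartialHomeomorph Q E}
    (hc : c ∈ atlas E Q) {r : ℕ} {q : Fin (r + 1) → E} (h : q 0 ∈ c.target) :
    ofCoords c q = jet r ⟨c.symm ∘ taylorCurve q, curve_of_coords hc h⟩ :=
  dif_pos (curve_of_coords hc h)

theorem base_ofCoords [IsManifold 𝓘(ℝ, E) ∞ Q] {c : OpenPartialHomeomorph Q E}
    (hc : c ∈ atlas E Q) {r : ℕ} {q : Fin (r + 1) → E} (h : q 0 ∈ c.target) :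
    base (ofCoords c q) = c.symm (q 0) := by
  rw [ofCoords_eq hc h, base_jet]
  simp [taylorCurve_zero]

theorem chart_comp_taylorCurve {M : Type*} [TopologicalSpace M] {c : OpenPartialHomeomorph M E}
    {r : ℕ} {q : Fin (r + 1) → E} (h : q 0 ∈ c.target) (i : Fin (r + 1)) :
    iteratedDeriv i (c ∘ (c.symm ∘ taylorCurve q)) 0 = q i := by
  have hcont : Continuous (taylorCurve q) := (contDiff_taylorCurve q).continuous
  have hmem : taylorCurve q ⁻¹' c.target ∈ 𝓝 (0 : ℝ) :=
    (c.open_target.preimage hcont).mem_nhds (by simpa [taylorCurve_zero] using h)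
  have hev : (c ∘ (c.symm ∘ taylorCurve q)) =ᶠ[𝓝 0] taylorCurve q := by
    filter_upwards [hmem] with t ht
    exact c.right_inv ht
  rw [hev.iteratedDeriv_eq, iteratedDeriv_taylorCurve]

theorem coords_ofCoords [IsManifold 𝓘(ℝ, E) ∞ Q] {c : OpenPartialHomeomorph Q E}
    (hc : c ∈ atlas E Q) {r : ℕ} {q : Fin (r + 1) → E} (h : q 0 ∈ c.target) :
    coords c (ofCoords c q) = q := by
  have hs : (c.symm ∘ taylorCurve q) 0 ∈ c.source := by
    simpa [taylorCurve_zero] using c.map_target h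
  funext i
  rw [ofCoords_eq hc h, coords_jet hc ⟨c.symm ∘ taylorCurve q, curve_of_coords hc h⟩ hs]
  exact chart_comp_taylorCurve h i

theorem ofCoords_coords [IsManifold 𝓘(ℝ, E) ∞ Q] {c : OpenPartialHomeomorph Q E}
    (hc : c ∈ atlas E Q) {r : ℕ} (p : HigherTangent E r Q) (h : base p ∈ c.source) :
    ofCoords c (coords c p) = p := by
  have h0 : coords c p 0 = c (base p) := coords_zero hc p h
  have ht : coords c p 0 ∈ c.target := h0 ▸ c.map_source h
  obtain ⟨φ, hφ⟩ := exists_rep p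
  have hb : φ.1 0 = base p := by rw [← hφ, base_jet]
  rw [ofCoords_eq hc ht]
  refine Eq.trans ?_ hφ
  have hv : (c.symm ∘ taylorCurve (coords c p)) 0 = φ.1 0 := by
    simp [taylorCurve_zero, h0, c.left_inv h, hb]
  refine jet_eq_of_chart hc ?_ hv ?_
  · change (c.symm ∘ taylorCurve (coords c p)) 0 ∈ c.source
    rw [hv, hb]; exact h
  · intro i
    refine (chart_comp_taylorCurve ht i).trans ?_
    rw [← hφ, coords_jet hc φ (hb ▸ h)]

/-- The natural chart of `T^r Q` induced by a chart `c` of `Q`. -/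
@[simps] def naturalChart [IsManifold 𝓘(ℝ, E) ∞ Q] (r : ℕ) (c : OpenPartialHomeomorph Q E)
    (hc : c ∈ atlas E Q) : PartialEquiv (HigherTangent E r Q) (Fin (r + 1) → E) where
  toFun := coords c
  invFun := ofCoords c
  source := {p | base p ∈ c.source}
  target := {q | q 0 ∈ c.target}
  map_source' p hp := by
    change coords c p 0 ∈ c.target
    rw [coords_zero hc p hp]; exact c.map_source hp
  map_target' q hq := by
    change base (ofCoords c q) ∈ c.source
    rw [base_ofCoords hc hq]; exact c.map_target hq
  left_inv' p hp := ofCoords_coords hc p hp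
  right_inv' q hq := coords_ofCoords hc hq

theorem naturalChart_trans_source [IsManifold 𝓘(ℝ, E) ∞ Q] (r : ℕ)
    {c c' : OpenPartialHomeomorph Q E} (hc : c ∈ atlas E Q) (hc' : c' ∈ atlas E Q) :
    ((naturalChart r c hc).symm.trans (naturalChart r c' hc')).source =
      {q | q 0 ∈ (c.symm.trans c').source} := by
  ext q
  simp only [PartialEquiv.trans_source, PartialEquiv.symm_source, naturalChart_target,
    naturalChart_source, mem_inter_iff, mem_ofPred_eq, mem_preimage, naturalChart_symm_apply,
    OpenPartialHomeomorph.trans_source, OpenPartialHomeomorph.symm_source]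
  refine and_congr_right fun h => ?_
  rw [base_ofCoords hc h]

theorem naturalChart_trans_eqOn [IsManifold 𝓘(ℝ, E) ∞ Q] (r : ℕ)
    {c c' : OpenPartialHomeomorph Q E} (hc : c ∈ atlas E Q) (hc' : c' ∈ atlas E Q) :
    EqOn ((naturalChart r c hc).symm.trans (naturalChart r c' hc')) (jetMap (c' ∘ c.symm))
      {q | q 0 ∈ (c.symm.trans c').source} := by
  intro q hq
  have hq' : q 0 ∈ c.target ∧ c.symm (q 0) ∈ c'.source := by simpa using hq
  obtain ⟨h, h'⟩ := hq'
  have hb : (c.symm ∘ taylorCurve q) 0 = c.symm (q 0) := by simp [taylorCurve_zero]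
  change coords c' (ofCoords c q) = _
  funext i
  rw [ofCoords_eq hc h, coords_jet hc' ⟨_, curve_of_coords hc h⟩ (hb.symm ▸ h' : (c.symm ∘ taylorCurve q) 0 ∈ c'.source),
    iteratedDeriv_chart_comp hc hc' ⟨_, curve_of_coords hc h⟩ (hb.symm ▸ c.map_target h : (c.symm ∘ taylorCurve q) 0 ∈ c.source)
      (hb.symm ▸ h' : (c.symm ∘ taylorCurve q) 0 ∈ c'.source) i]
  congr 1
  funext j
  exact chart_comp_taylorCurve h j

theorem contDiffOn_naturalChart_trans [IsManifold 𝓘(ℝ, E) ∞ Q] (r : ℕ)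
    {c c' : OpenPartialHomeomorph Q E} (hc : c ∈ atlas E Q) (hc' : c' ∈ atlas E Q) :
    ContDiffOn ℝ ∞ ((naturalChart r c hc).symm.trans (naturalChart r c' hc'))
      ((naturalChart r c hc).symm.trans (naturalChart r c' hc')).source := by
  rw [naturalChart_trans_source]
  exact (contDiffOn_jetMap (c.symm.trans c').open_source (contDiffOn_transition hc hc')).congr
    (naturalChart_trans_eqOn r hc hc')

variable (E Q) in
/-- The natural charts make `T^r Q` a manifold modelled on `E^{r+1}`. -/
def chartedSpaceCore [IsManifold 𝓘(ℝ, E) ∞ Q] (r : ℕ) :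
    ChartedSpaceCore (Fin (r + 1) → E) (HigherTangent E r Q) where
  atlas := {e | ∃ (c : OpenPartialHomeomorph Q E) (hc : c ∈ atlas E Q), e = naturalChart r c hc}
  chartAt p := naturalChart r (chartAt E (base p)) (chart_mem_atlas E (base p))
  mem_chart_source p := mem_chart_source E (base p)
  chart_mem_atlas p := ⟨_, _, rfl⟩
  open_source := by
    rintro _ _ ⟨c, hc, rfl⟩ ⟨c', hc', rfl⟩
    rw [naturalChart_trans_source]
    exact (c.symm.trans c').open_source.preimage (continuous_apply 0)
  continuousOn_toFun := by
    rintro _ _ ⟨c, hc, rfl⟩ ⟨c', hc', rfl⟩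
    exact (contDiffOn_naturalChart_trans r hc hc').continuousOn

instance instTopologicalSpace [IsManifold 𝓘(ℝ, E) ∞ Q] (r : ℕ) :
    TopologicalSpace (HigherTangent E r Q) :=
  (chartedSpaceCore E Q r).toTopologicalSpace

instance instChartedSpace [IsManifold 𝓘(ℝ, E) ∞ Q] (r : ℕ) :
    ChartedSpace (Fin (r + 1) → E) (HigherTangent E r Q) :=
  (chartedSpaceCore E Q r).toChartedSpace

instance instIsManifold [IsManifold 𝓘(ℝ, E) ∞ Q] (r : ℕ) :
    IsManifold 𝓘(ℝ, Fin (r + 1) → E) ∞ (HigherTangent E r Q) := by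
  refine isManifold_of_contDiffOn _ _ _ ?_
  intro e e' he he'
  obtain ⟨f, hf, he⟩ : ∃ f, ∃ hf : f ∈ (chartedSpaceCore E Q r).atlas,
      e = (chartedSpaceCore E Q r).openPartialHomeomorph f hf := by
    simpa [atlas, ChartedSpace.atlas, ChartedSpaceCore.toChartedSpace] using he
  obtain ⟨f', hf', he'⟩ : ∃ f, ∃ hf : f ∈ (chartedSpaceCore E Q r).atlas,
      e' = (chartedSpaceCore E Q r).openPartialHomeomorph f hf := by
    simpa [atlas, ChartedSpace.atlas, ChartedSpaceCore.toChartedSpace] using he'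
  subst he he'
  obtain ⟨c, hc, rfl⟩ := hf
  obtain ⟨c', hc', rfl⟩ := hf'
  have := contDiffOn_naturalChart_trans r hc hc'
  simp only [modelWithCornersSelf_coe, modelWithCornersSelf_coe_symm, Function.id_comp,
    Function.comp_id, range_id, inter_univ, preimage_id]
  exact this

end Basic

end HigherTangent

namespace HamiltonJacobi

section Forms

variable (F : Type*) [NormedAddCommGroup F] [NormedSpace ℝ F]
variable {M : Type*} [TopologicalSpace M] [ChartedSpace F M]

/-- The differential `df` of a real function on a manifold modelled on `F`. -/
def differential (f : M → ℝ) (p : M) : TangentSpace 𝓘(ℝ, F) p →L[ℝ] ℝ :=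
  mfderiv 𝓘(ℝ, F) 𝓘(ℝ, ℝ) f p

variable {F} in
/-- A `1`-form `θ` on a manifold, read in the preferred chart at `p`: the pull-back of `θ` by the
inverse of the chart. -/
def readInChart (θ : ∀ p : M, TangentSpace 𝓘(ℝ, F) p →L[ℝ] ℝ) (p : M) (x : F) : F →L[ℝ] ℝ :=
  (θ ((extChartAt 𝓘(ℝ, F) p).symm x)).comp
    (mfderiv 𝓘(ℝ, F) 𝓘(ℝ, F) (extChartAt 𝓘(ℝ, F) p).symm x)

variable {F} in
/-- The exterior derivative of a `1`-form on a manifold, with the convention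
`dθ(u, v) = D_u θ(v) - D_v θ(u)` in a chart. -/
def exteriorDeriv (θ : ∀ p : M, TangentSpace 𝓘(ℝ, F) p →L[ℝ] ℝ) (p : M) :
    LinearMap.BilinForm ℝ (TangentSpace 𝓘(ℝ, F) p) :=
  let D : F →L[ℝ] F →L[ℝ] ℝ := fderiv ℝ (readInChart θ p) (extChartAt 𝓘(ℝ, F) p p)
  let A : TangentSpace 𝓘(ℝ, F) p →L[ℝ] F :=
    mfderiv 𝓘(ℝ, F) 𝓘(ℝ, F) (extChartAt 𝓘(ℝ, F) p) p
  LinearMap.mk₂ ℝ (fun u v => D (A u) (A v) - D (A v) (A u))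
    (fun u u' v => by simp only [map_add, add_apply]; ring)
    (fun a u v => by simp only [map_smul, smul_apply, smul_eq_mul]; ring)
    (fun u v v' => by simp only [map_add, add_apply]; ring)
    (fun a u v => by simp only [map_smul, smul_apply, smul_eq_mul]; ring)

variable (G : Type*) [NormedAddCommGroup G] [NormedSpace ℝ G]
variable {N : Type*} [TopologicalSpace N] [ChartedSpace G N]

/-- The pull-back `f^* Ω` of a `2`-form (a field of bilinear forms) by a map `f : N → M`, where
`N`, `M` are modelled on `G`, `F`. -/
def pullback (f : N → M) (Ω : ∀ p : M, LinearMap.BilinForm ℝ (TangentSpace 𝓘(ℝ, F) p)) (y : N) :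
    LinearMap.BilinForm ℝ (TangentSpace 𝓘(ℝ, G) y) :=
  (Ω (f y)).comp (mfderiv 𝓘(ℝ, G) 𝓘(ℝ, F) f y).toLinearMap
    (mfderiv 𝓘(ℝ, G) 𝓘(ℝ, F) f y).toLinearMap

/-- The tangent space `T_{f y} Im(f)`, i.e. the image of the tangent map `T_y f`, for an
embedding `f : N → M`. -/
def imageTangentSpace (f : N → M) (y : N) : Submodule ℝ (TangentSpace 𝓘(ℝ, F) (f y)) :=
  LinearMap.range (mfderiv 𝓘(ℝ, G) 𝓘(ℝ, F) f y).toLinearMap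

/-- `Im(f)` is a Lagrangian submanifold of `(M, Ω)`: the map `f` is a smooth embedding, and each
tangent space of its image is its own orthogonal complement with respect to `Ω`. -/
structure HasLagrangianImage (f : N → M)
    (Ω : ∀ p : M, LinearMap.BilinForm ℝ (TangentSpace 𝓘(ℝ, F) p)) : Prop where
  smooth : ContMDiff 𝓘(ℝ, G) 𝓘(ℝ, F) ∞ f
  isEmbedding : IsEmbedding f
  immersion : ∀ y, Function.Injective (mfderiv 𝓘(ℝ, G) 𝓘(ℝ, F) f y)
  lagrangian : ∀ y, (Ω (f y)).orthogonal (imageTangentSpace F G f y) = imageTangentSpace F G f y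

/-- `Im(f)` is invariant by the vector field `Z`, i.e. `Z` is tangent to `Im(f)`. -/
def HasInvariantImage (f : N → M) (Z : ∀ p : M, TangentSpace 𝓘(ℝ, F) p) : Prop :=
  ∀ y : N, Z (f y) ∈ imageTangentSpace F G f y

end Forms

section Coordinates

variable {E : Type*} [NormedAddCommGroup E] [NormedSpace ℝ E]
variable {V : Type*} [NormedAddCommGroup V] [NormedSpace ℝ V]

/-- The partial derivative `∂f/∂q_j`, as a linear map on `E`, of a function of
`(q_0, …, q_m) ∈ E^{m+1}`. -/
def partialDeriv {m : ℕ} (f : (Fin (m + 1) → E) → V) (j : Fin (m + 1)) (q : Fin (m + 1) → E) :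
    E →L[ℝ] V :=
  (fderiv ℝ f q).comp (ContinuousLinearMap.single ℝ (fun _ : Fin (m + 1) => E) j)

/-- The total time derivative `d_T f (q_0, …, q_{m+1}) = ∑_{i ≤ m} q_{i+1} ∂f/∂q_i`. -/
def totalDeriv {m : ℕ} (f : (Fin (m + 1) → E) → V) (q : Fin (m + 1 + 1) → E) : V :=
  ∑ i : Fin (m + 1), partialDeriv f i (fun j => q j.castSucc) (q i.succ)

/-- The iterated total time derivative `d_T^i f`. -/
def totalDerivIter {m : ℕ} (f : (Fin (m + 1) → E) → V) : (i : ℕ) → (Fin (m + i + 1) → E) → V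
  | 0 => f
  | i + 1 => totalDeriv (totalDerivIter f i)

end Coordinates

section Lagrangian

variable {E : Type*} [NormedAddCommGroup E] [NormedSpace ℝ E]
variable {Q : Type*} [TopologicalSpace Q] [ChartedSpace E Q] {k : ℕ}

/-- The Lagrangian `L` in the natural coordinates of `T^k Q` induced by the chart `c` of `Q`. -/
def localLagrangian (L : HigherTangent E k Q → ℝ) (c : OpenPartialHomeomorph Q E)
    (q : Fin (k + 1) → E) : ℝ :=
  L (ofCoords c q)

/-- The function `p̂^r = ∑_{i=0}^{k-1-r} (-1)^i d_T^i (∂L/∂q_{r+1+i})`, for `0 ≤ r ≤ k-1`, of the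
natural coordinates `(q_0, …, q_{2k-1})` of `T^{2k-1} Q` induced by `c`. -/
def momentum (L : HigherTangent E k Q → ℝ) (c : OpenPartialHomeomorph Q E) (r : Fin k)
    (q : Fin (2 * k - 1 + 1) → E) : E →L[ℝ] ℝ :=
  ∑ i : Fin (k - r), (-1 : ℝ) ^ (i : ℕ) •
    totalDerivIter (partialDeriv (localLagrangian L c) ⟨r + 1 + i, by omega⟩) i
      (fun j : Fin (k + i + 1) => q (Fin.castLE (by omega) j))

/-- The `E`-valued differential `dq_j` at `p` of the natural coordinate `q_j` induced by `c`. -/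
def dq [IsManifold 𝓘(ℝ, E) ∞ Q] (c : OpenPartialHomeomorph Q E) {m : ℕ} (j : Fin (m + 1))
    (p : HigherTangent E m Q) : TangentSpace 𝓘(ℝ, Fin (m + 1) → E) p →L[ℝ] E :=
  mfderiv 𝓘(ℝ, Fin (m + 1) → E) 𝓘(ℝ, E) (fun p' : HigherTangent E m Q => coords c p' j) p

/-- The Poincaré–Cartan `1`-form `θ_L = ∑_{r=0}^{k-1} p̂^r dq_r` on `T^{2k-1} Q`, computed at `p`
in the natural coordinates induced by the preferred chart of `Q` at the base point of `p`. -/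
def poincareCartanOneForm [IsManifold 𝓘(ℝ, E) ∞ Q] (L : HigherTangent E k Q → ℝ)
    (p : HigherTangent E (2 * k - 1) Q) :
    TangentSpace 𝓘(ℝ, Fin (2 * k - 1 + 1) → E) p →L[ℝ] ℝ :=
  let c := chartAt E (base p)
  ∑ r : Fin k, (momentum L c r (coords c p)).comp (dq c (Fin.castLE (by omega) r) p)

/-- The Poincaré–Cartan `2`-form `ω_L = -dθ_L` on `T^{2k-1} Q`. -/
def poincareCartanTwoForm [IsManifold 𝓘(ℝ, E) ∞ Q] (L : HigherTangent E k Q → ℝ)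
    (p : HigherTangent E (2 * k - 1) Q) :
    LinearMap.BilinForm ℝ (TangentSpace 𝓘(ℝ, Fin (2 * k - 1 + 1) → E) p) :=
  -exteriorDeriv (poincareCartanOneForm L) p

/-- The Lagrangian energy `E_L = ∑_{r=0}^{k-1} p̂^r(q_{r+1}) - L` on `T^{2k-1} Q`, computed at `p`
in the natural coordinates induced by the preferred chart of `Q` at the base point of `p`. -/
def energy (hk : 1 ≤ k) (L : HigherTangent E k Q → ℝ) (p : HigherTangent E (2 * k - 1) Q) : ℝ :=
  let c := chartAt E (base p)
  ∑ r : Fin k, momentum L c r (coords c p) (coords c p ⟨r + 1, by omega⟩) -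
    L (proj (by omega) p)

/-- The Lagrangian is regular: the Hessian `∂²L/∂q_k∂q_k` with respect to the highest-order
velocities is nondegenerate at each point, in natural coordinates. -/
def IsRegular (L : HigherTangent E k Q → ℝ) : Prop :=
  ∀ p : HigherTangent E k Q, ∀ u : E,
    (∀ v : E, partialDeriv (partialDeriv (localLagrangian L (chartAt E (base p))) (Fin.last k))
      (Fin.last k) (coords (chartAt E (base p)) p) u v = 0) → u = 0

variable [IsManifold 𝓘(ℝ, E) ∞ Q]

/-- The Lagrangian vector field `X_L`: its value at `p` is the (for regular `L`, unique) solution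
`v` of `i(v) ω_L = dE_L` at `p`. -/
def lagrangianVectorField (hk : 1 ≤ k) (L : HigherTangent E k Q → ℝ)
    (p : HigherTangent E (2 * k - 1) Q) : TangentSpace 𝓘(ℝ, Fin (2 * k - 1 + 1) → E) p :=
  Classical.epsilon fun v => ∀ w, poincareCartanTwoForm L p v w = differential _ (energy hk L) p w

/-- The projection `ρ^{2k-1}_{k-1} : T^{2k-1} Q → T^{k-1} Q`. -/
def rho (p : HigherTangent E (2 * k - 1) Q) : HigherTangent E (k - 1) Q :=
  proj (by omega) p

/-- Smooth global sections of `ρ^{2k-1}_{k-1}`. -/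
structure IsSmoothSection (s : HigherTangent E (k - 1) Q → HigherTangent E (2 * k - 1) Q) :
    Prop where
  smooth : ContMDiff 𝓘(ℝ, Fin (k - 1 + 1) → E) 𝓘(ℝ, Fin (2 * k - 1 + 1) → E) ∞ s
  rho_comp : ∀ y, rho (s y) = y

/-- The vector field `X = Tρ ∘ X_L ∘ s` on `T^{k-1} Q` associated to `s`. The value of
`Tρ (X_L (s y))` lies in the tangent space at `ρ (s y)`, which is `y` for a section `s`. -/
def associatedVectorField (hk : 1 ≤ k) (L : HigherTangent E k Q → ℝ)
    (s : HigherTangent E (k - 1) Q → HigherTangent E (2 * k - 1) Q)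
    (y : HigherTangent E (k - 1) Q) : TangentSpace 𝓘(ℝ, Fin (k - 1 + 1) → E) y :=
  mfderiv 𝓘(ℝ, Fin (2 * k - 1 + 1) → E) 𝓘(ℝ, Fin (k - 1 + 1) → E)
    (rho : HigherTangent E (2 * k - 1) Q → HigherTangent E (k - 1) Q) (s y)
    (lagrangianVectorField hk L (s y))

/-- `γ` is an integral curve of `Z` on the open interval `I`. -/
def IsIntegralCurve {F : Type*} [NormedAddCommGroup F] [NormedSpace ℝ F] {M : Type*}
    [TopologicalSpace M] [ChartedSpace F M] (Z : ∀ p : M, TangentSpace 𝓘(ℝ, F) p) (γ : ℝ → M)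
    (I : Set ℝ) : Prop :=
  IsOpen I ∧ I.OrdConnected ∧ IsMIntegralCurveOn (I := 𝓘(ℝ, F)) γ Z I

/-- `s` is a solution to the generalized `k`-th order Lagrangian Hamilton–Jacobi problem: if `γ` is
an integral curve of the vector field associated to `s`, then `s ∘ γ` is an integral curve of
`X_L`. -/
def SolvesGeneralizedHJ (hk : 1 ≤ k) (L : HigherTangent E k Q → ℝ)
    (s : HigherTangent E (k - 1) Q → HigherTangent E (2 * k - 1) Q) : Prop :=
  ∀ (γ : ℝ → HigherTangent E (k - 1) Q) (I : Set ℝ),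
    IsIntegralCurve (associatedVectorField hk L s) γ I →
      IsIntegralCurve (lagrangianVectorField hk L) (s ∘ γ) I

/-- The condition `s^* ω_L = 0`. -/
def PullbackVanishes (L : HigherTangent E k Q → ℝ)
    (s : HigherTangent E (k - 1) Q → HigherTangent E (2 * k - 1) Q) : Prop :=
  ∀ y, pullback (Fin (2 * k - 1 + 1) → E) (Fin (k - 1 + 1) → E) s (poincareCartanTwoForm L) y = 0

/-- `s` is a solution to the `k`-th order Lagrangian Hamilton–Jacobi problem. -/
def SolvesHJ (hk : 1 ≤ k) (L : HigherTangent E k Q → ℝ)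
    (s : HigherTangent E (k - 1) Q → HigherTangent E (2 * k - 1) Q) : Prop :=
  SolvesGeneralizedHJ hk L s ∧ PullbackVanishes L s

/-- The integral curves of `X_L` with initial condition in `Im(s)` project by `ρ^{2k-1}_{k-1}` to
integral curves of `X = Tρ ∘ X_L ∘ s`. -/
def CurvesProject (hk : 1 ≤ k) (L : HigherTangent E k Q → ℝ)
    (s : HigherTangent E (k - 1) Q → HigherTangent E (2 * k - 1) Q) : Prop :=
  ∀ (ψ : ℝ → HigherTangent E (2 * k - 1) Q) (I : Set ℝ), 0 ∈ I → ψ 0 ∈ range s →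
    IsIntegralCurve (lagrangianVectorField hk L) ψ I →
      IsIntegralCurve (associatedVectorField hk L s) (fun t => rho (ψ t)) I

/-- Each integral curve of `X = Tρ ∘ X_L ∘ s` is the projection by `ρ^{2k-1}_{k-1}` of an integral
curve of `X_L` with initial condition in `Im(s)`. -/
def CurvesLift (hk : 1 ≤ k) (L : HigherTangent E k Q → ℝ)
    (s : HigherTangent E (k - 1) Q → HigherTangent E (2 * k - 1) Q) : Prop :=
  ∀ (γ : ℝ → HigherTangent E (k - 1) Q) (I : Set ℝ), 0 ∈ I →
    IsIntegralCurve (associatedVectorField hk L s) γ I →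
      ∃ ψ : ℝ → HigherTangent E (2 * k - 1) Q, ψ 0 ∈ range s ∧
        IsIntegralCurve (lagrangianVectorField hk L) ψ I ∧ EqOn (fun t => rho (ψ t)) γ I

end Lagrangian

end HamiltonJacobi

end

/-! Write ω for the Poincaré–Cartan form and E for the energy. All five assertions are equivalent to
one pointwise identity, `IsRelated`: Ts ∘ X = X_L ∘ s. Since Tρ ∘ Ts = id, it holds exactly when X_L
is tangent to Im(s), for then the only vector that Ts can send to X_L is X.

Relatedness gives assertion 1 by the chain rule; conversely X is C^1, so an integral curve passes
through each point, and differentiating its image under s gives relatedness there. For 2 and 3, the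
equation i(X_L)ω = dE gives d(s^*E)(w) = ω(X_L, Ts w), so d(s^*E) = 0 puts X_L in the ω-orthogonal
of T Im(s). Now s^*ω = 0 makes T Im(s) isotropic, its dimension is half that of T^{2k-1}Q, and ω is
nondegenerate: T Im(s) is its own orthogonal.

For 4, relatedness and uniqueness of integral curves keep a curve of X_L that starts in Im(s) inside
Im(s). The converse uses that X_L is a semispray: along its integral curves q_{j+1} is the
derivative of q_j. Induction on j then identifies the coordinates of ψ with those of s ∘ ρ ∘ ψ near
0 (`CurvesProject.eventually_coord_eq`), and differentiating at 0 gives relatedness. The curve that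
5 requires over γ is s ∘ γ.

The facts about ω and X_L come from coordinates. There ω = ∑ dq_r ∧ dp_r, where p_r depends on q_0,
…, q_{2k-1-r} and its derivative in the last of these is the Hessian up to sign
(`fderiv_mom_apply`); this triangular shape makes ω nondegenerate (`twoForm_nondegenerate`).
Moreover dE = i(Sx)ω - δ, with S the truncated shift and δ a form in dq_0 alone (`fderiv_en`), so
X_L differs from Sx only in the last coordinate.

The forms are defined at each point through the preferred chart there, so before anything is
differentiated they must be shown independent of the chart. This is `IsProlongation.mom_eq`, a
downward induction along p_r = ∂Λ/∂q_{r+1} - d_T p_{r+1}. To avoid jet spaces of varying order,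
every function is pulled back to E^{2k}, where d_T becomes the derivative along S. -/

namespace JetSpace

/-! ### Coordinates, inclusions and the truncated shift on E^{n+1}. -/

variable {E : Type*} [NormedAddCommGroup E] [NormedSpace ℝ E]
variable {V : Type*} [NormedAddCommGroup V] [NormedSpace ℝ V]
variable {n k : ℕ}

/-- The coordinate `q_j` on `E^{n+1}`, for a natural number `j`; it is zero if `j > n`. -/
noncomputable def coord (j : ℕ) : (Fin (n + 1) → E) →L[ℝ] E :=
  if h : j < n + 1 then ContinuousLinearMap.proj ⟨j, h⟩ else 0

/-- The inclusion of `E` in `E^{n+1}` as the `j`-th summand; it is zero if `j > n`. -/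
noncomputable def incl (j : ℕ) : E →L[ℝ] (Fin (n + 1) → E) :=
  if h : j < n + 1 then ContinuousLinearMap.single ℝ (fun _ : Fin (n + 1) => E) ⟨j, h⟩ else 0

/-- The truncated shift `(q_0, …, q_n) ↦ (q_1, …, q_n, 0)`. -/
noncomputable def shift : (Fin (n + 1) → E) →L[ℝ] (Fin (n + 1) → E) :=
  ContinuousLinearMap.pi fun i => coord (i + 1)

theorem coord_of_lt {j : ℕ} (h : j < n + 1) (x : Fin (n + 1) → E) : coord j x = x ⟨j, h⟩ := by
  simp [coord, h]

@[simp] theorem coord_fin (i : Fin (n + 1)) (x : Fin (n + 1) → E) : coord i x = x i :=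
  coord_of_lt i.2 x

theorem coord_of_gt {j : ℕ} (h : n < j) (x : Fin (n + 1) → E) : coord j x = 0 := by
  have : ¬ j < n + 1 := by omega
  simp [coord, this]

theorem ext_coord {x y : Fin (n + 1) → E} (h : ∀ j ≤ n, coord j x = coord j y) : x = y := by
  funext i
  simpa using h i (Nat.le_of_lt_succ i.2)

theorem shift_apply (x : Fin (n + 1) → E) (i : Fin (n + 1)) : shift x i = coord (i + 1) x := rfl

@[simp] theorem coord_shift (j : ℕ) (x : Fin (n + 1) → E) :
    coord j (shift x) = coord (j + 1) x := by
  by_cases h : j < n + 1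
  · rw [coord_of_lt h, shift_apply]
  · rw [coord_of_gt (by omega), coord_of_gt (by omega)]

theorem coord_incl {i j : ℕ} (hj : j ≤ n) (e : E) :
    coord i (incl j e : Fin (n + 1) → E) = if i = j then e else 0 := by
  have hj' : j < n + 1 := by omega
  by_cases h : i < n + 1
  · rw [coord_of_lt h]
    by_cases hij : i = j
    · subst hij
      simp [incl, h]
    · simp [incl, hj', hij]
  · rw [coord_of_gt (by omega), if_neg (by omega)]

theorem coord_incl_self {j : ℕ} (hj : j ≤ n) (e : E) :
    coord j (incl j e : Fin (n + 1) → E) = e := by simp [coord_incl hj]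

theorem coord_incl_ne {i j : ℕ} (hij : i ≠ j) (e : E) :
    coord i (incl j e : Fin (n + 1) → E) = 0 := by
  by_cases hj : j ≤ n
  · simp [coord_incl hj, hij]
  · have : ¬ j < n + 1 := by omega
    simp [incl, this]

theorem shift_incl_succ {j : ℕ} (hj : j + 1 ≤ n) (e : E) :
    shift (incl (j + 1) e : Fin (n + 1) → E) = incl j e := by
  refine ext_coord fun i _ => ?_
  rw [coord_shift, coord_incl hj, coord_incl (by omega)]
  simp

theorem sum_incl_coord (x : Fin (n + 1) → E) :
    ∑ j ∈ Finset.range (n + 1), incl j (coord j x) = x := by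
  refine ext_coord fun i hi => ?_
  rw [map_sum, Finset.sum_eq_single i]
  · exact coord_incl_self hi _
  · intro j _ hj; exact coord_incl_ne hj.symm _
  · intro h; simp at h; omega

theorem coord_iterate_shift (i j : ℕ) (x : Fin (n + 1) → E) :
    coord j (shift^[i] x) = coord (j + i) x := by
  induction i generalizing j with
  | zero => rfl
  | succ i ih =>
    rw [Function.iterate_succ_apply', coord_shift, ih]
    rw [show j + 1 + i = j + (i + 1) by omega]

/-- The function `h` depends only on `q_0, …, q_m` (infinitesimally, on `O`). -/
def DependsUpTo (O : Set (Fin (n + 1) → E)) (h : (Fin (n + 1) → E) → V) (m : ℕ) : Prop :=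
  ∀ x ∈ O, ∀ w : Fin (n + 1) → E, (∀ j ≤ m, coord j w = 0) → fderiv ℝ h x w = 0

/-- The derivative along the truncated shift; it agrees with the total time derivative on
functions of `q_0, …, q_{n-1}`. -/
noncomputable def shiftDeriv (h : (Fin (n + 1) → E) → V) (x : Fin (n + 1) → E) : V :=
  fderiv ℝ h x (shift x)

/-! ### Calculus on open sets of normed spaces. -/

section Calculus

variable {X : Type*} [NormedAddCommGroup X] [NormedSpace ℝ X]
variable {Y : Type*} [NormedAddCommGroup Y] [NormedSpace ℝ Y]

theorem contDiffOn_fderiv {O : Set X} (hO : IsOpen O) {f : X → Y} (hf : ContDiffOn ℝ ∞ f O) :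
    ContDiffOn ℝ ∞ (fderiv ℝ f) O := hf.fderiv_of_isOpen hO (by simp)

theorem differentiableAt_of_contDiffOn {O : Set X} (hO : IsOpen O) {f : X → Y}
    (hf : ContDiffOn ℝ ∞ f O) {x : X} (hx : x ∈ O) : DifferentiableAt ℝ f x :=
  (hf.contDiffAt (hO.mem_nhds hx)).differentiableAt (by simp)

theorem fderiv_fderiv_comm {O : Set X} (hO : IsOpen O) {f : X → Y} (hf : ContDiffOn ℝ ∞ f O)
    {x : X} (hx : x ∈ O) (u v : X) :
    fderiv ℝ (fderiv ℝ f) x u v = fderiv ℝ (fderiv ℝ f) x v u :=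
  ((hf.contDiffAt (hO.mem_nhds hx)).isSymmSndFDerivAt
    (by rw [minSmoothness_of_isRCLikeNormedField]; exact ENat.LEInfty.out)) u v

theorem contDiffOn_flip {Z W : Type*} [NormedAddCommGroup Z] [NormedSpace ℝ Z]
    [NormedAddCommGroup W] [NormedSpace ℝ W] {O : Set X} {f : X → Y →L[ℝ] Z →L[ℝ] W}
    (hf : ContDiffOn ℝ ∞ f O) : ContDiffOn ℝ ∞ (fun x => (f x).flip) O := by
  have h := (LinearIsometry.contDiff (n := ∞) (E := Y →L[ℝ] Z →L[ℝ] W)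
    (F := Z →L[ℝ] Y →L[ℝ] W)
    (ContinuousLinearMap.flipₗᵢ ℝ Y Z W).toLinearIsometry).comp_contDiffOn hf
  exact h

/-- The derivative of `y ↦ Df(y)(g(y))`. -/
theorem fderiv_fderiv_apply {O : Set X} (hO : IsOpen O) {f : X → Y} (hf : ContDiffOn ℝ ∞ f O)
    {x : X} (hx : x ∈ O) {g : X → X} (hg : DifferentiableAt ℝ g x) (w : X) :
    fderiv ℝ (fun y => fderiv ℝ f y (g y)) x w =
      fderiv ℝ (fderiv ℝ f) x w (g x) + fderiv ℝ f x (fderiv ℝ g x w) := by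
  have h1 := differentiableAt_of_contDiffOn hO (contDiffOn_fderiv hO hf) hx
  rw [fderiv_clm_apply h1 hg]
  simp [add_comm]

theorem fderiv_congr_of_eqOn {O : Set X} (hO : IsOpen O) {f g : X → Y} (h : EqOn f g O)
    {x : X} (hx : x ∈ O) : fderiv ℝ f x = fderiv ℝ g x :=
  (h.eventuallyEq_of_mem (hO.mem_nhds hx)).fderiv_eq

end Calculus

/-! ### Iterated total derivatives and the order of the coordinates they involve. -/

section ShiftDeriv

variable {O : Set (Fin (n + 1) → E)} {h : (Fin (n + 1) → E) → V} {m : ℕ}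

theorem contDiffOn_shiftDeriv (hO : IsOpen O) (hh : ContDiffOn ℝ ∞ h O) :
    ContDiffOn ℝ ∞ (shiftDeriv h) O :=
  (contDiffOn_fderiv hO hh).clm_apply (shift (E := E) (n := n)).contDiff.contDiffOn

theorem contDiffOn_iterate_shiftDeriv (hO : IsOpen O) (hh : ContDiffOn ℝ ∞ h O) (i : ℕ) :
    ContDiffOn ℝ ∞ (shiftDeriv^[i] h) O := by
  induction i with
  | zero => exact hh
  | succ i ih => rw [Function.iterate_succ_apply']; exact contDiffOn_shiftDeriv hO ih

theorem fderiv_shiftDeriv (hO : IsOpen O) (hh : ContDiffOn ℝ ∞ h O) {x : Fin (n + 1) → E}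
    (hx : x ∈ O) (w : Fin (n + 1) → E) :
    fderiv ℝ (shiftDeriv h) x w =
      fderiv ℝ (fderiv ℝ h) x w (shift x) + fderiv ℝ h x (shift w) := by
  have := fderiv_fderiv_apply hO hh hx (g := shift)
    (shift (E := E) (n := n)).differentiableAt w
  rwa [ContinuousLinearMap.fderiv] at this

/-- The map y ↦ Dh(y)w vanishes on the open set `O`, hence so does its derivative; by symmetry
D²h(w, Sx) = 0. What remains reflects the commutator [∂/∂q_{j+1}, d_T] = ∂/∂q_j. -/
theorem DependsUpTo.fderiv_shiftDeriv (hO : IsOpen O) (hh : ContDiffOn ℝ ∞ h O)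
    (hd : DependsUpTo O h m) {x : Fin (n + 1) → E} (hx : x ∈ O) {w : Fin (n + 1) → E}
    (hw : ∀ j ≤ m, coord j w = 0) :
    fderiv ℝ (shiftDeriv h) x w = fderiv ℝ h x (shift w) := by
  rw [JetSpace.fderiv_shiftDeriv hO hh hx, fderiv_fderiv_comm hO hh hx, add_eq_right]
  have h0 : fderiv ℝ (fun y => fderiv ℝ h y w) x = 0 := by
    rw [fderiv_congr_of_eqOn hO (g := fun _ => (0 : V)) (fun y hy => hd y hy w hw) hx]
    simp
  have := fderiv_fderiv_apply hO hh hx (g := fun _ => w) (differentiableAt_const w) (shift x)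
  rw [h0] at this
  simpa using this.symm

theorem DependsUpTo.shiftDeriv (hO : IsOpen O) (hh : ContDiffOn ℝ ∞ h O)
    (hd : DependsUpTo O h m) : DependsUpTo O (shiftDeriv h) (m + 1) := by
  intro x hx w hw
  rw [hd.fderiv_shiftDeriv hO hh hx fun j hj => hw j (by omega)]
  refine hd x hx _ fun j hj => ?_
  rw [coord_shift]
  exact hw _ (by omega)

theorem DependsUpTo.iterate_shiftDeriv (hO : IsOpen O) (hh : ContDiffOn ℝ ∞ h O)
    (hd : DependsUpTo O h m) (i : ℕ) : DependsUpTo O (JetSpace.shiftDeriv^[i] h) (m + i) := by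
  induction i with
  | zero => exact hd
  | succ i ih =>
    rw [Function.iterate_succ_apply']
    exact ih.shiftDeriv hO (contDiffOn_iterate_shiftDeriv hO hh i)

/-- Each total derivative raises the order by one and keeps the leading coefficient: ∂(d_T^i
h)/∂q_{m+i} = ∂h/∂q_m. -/
theorem DependsUpTo.fderiv_iterate_shiftDeriv (hO : IsOpen O) (hh : ContDiffOn ℝ ∞ h O)
    (hd : DependsUpTo O h m) (i : ℕ) {x : Fin (n + 1) → E} (hx : x ∈ O) {w : Fin (n + 1) → E}
    (hw : ∀ j < m + i, coord j w = 0) :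
    fderiv ℝ (JetSpace.shiftDeriv^[i] h) x w = fderiv ℝ h x (shift^[i] w) := by
  induction i generalizing w with
  | zero => rfl
  | succ i ih =>
    rw [Function.iterate_succ_apply', (hd.iterate_shiftDeriv hO hh i).fderiv_shiftDeriv hO
      (contDiffOn_iterate_shiftDeriv hO hh i) hx fun j hj => hw j (by omega),
      ih fun j hj => by rw [coord_shift]; exact hw _ (by omega), Function.iterate_succ_apply]

end ShiftDeriv

/-! ### Momenta, the Poincaré–Cartan forms and the energy on E^{n+1}. -/

section Momenta

variable (Λ : (Fin (n + 1) → E) → ℝ)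

/-- The partial derivative `∂Λ/∂q_j`. -/
noncomputable def slotDeriv (j : ℕ) (x : Fin (n + 1) → E) : E →L[ℝ] ℝ :=
  (fderiv ℝ Λ x).comp (incl j)

/-- The momentum `∑_{i < k - r} (-1)^i d_T^i (∂Λ/∂q_{r+1+i})`. -/
noncomputable def mom (k r : ℕ) (x : Fin (n + 1) → E) : E →L[ℝ] ℝ :=
  ∑ i ∈ Finset.range (k - r), (-1 : ℝ) ^ i • shiftDeriv^[i] (slotDeriv Λ (r + 1 + i)) x

/-- The Hessian `∂²Λ/∂q_k∂q_k`. -/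
noncomputable def hess (k : ℕ) (x : Fin (n + 1) → E) : E →L[ℝ] E →L[ℝ] ℝ :=
  (fderiv ℝ (slotDeriv Λ k) x).comp (incl k)

/-- The `1`-form `∑_{r < k} p_r dq_r`. -/
noncomputable def oneForm (k : ℕ) (x : Fin (n + 1) → E) : (Fin (n + 1) → E) →L[ℝ] ℝ :=
  ∑ r ∈ Finset.range k, (mom Λ k r x).comp (coord r)

/-- Minus the exterior derivative of `oneForm`. -/
noncomputable def twoForm (k : ℕ) (x : Fin (n + 1) → E) :
    (Fin (n + 1) → E) →L[ℝ] (Fin (n + 1) → E) →L[ℝ] ℝ :=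
  (fderiv ℝ (oneForm Λ k) x).flip - fderiv ℝ (oneForm Λ k) x

/-- The energy `∑_{r < k} p_r q_{r+1} - Λ`. -/
noncomputable def en (k : ℕ) (x : Fin (n + 1) → E) : ℝ := oneForm Λ k x (shift x) - Λ x

variable {Λ} {O : Set (Fin (n + 1) → E)}

theorem contDiffOn_slotDeriv (hO : IsOpen O) (hΛ : ContDiffOn ℝ ∞ Λ O) (j : ℕ) :
    ContDiffOn ℝ ∞ (slotDeriv Λ j) O :=
  (contDiffOn_fderiv hO hΛ).clm_comp contDiffOn_const

theorem contDiffOn_mom (hO : IsOpen O) (hΛ : ContDiffOn ℝ ∞ Λ O) (r : ℕ) :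
    ContDiffOn ℝ ∞ (mom Λ k r) O :=
  ContDiffOn.sum fun i _ =>
    (contDiffOn_iterate_shiftDeriv hO (contDiffOn_slotDeriv hO hΛ _) i).const_smul _

theorem contDiffOn_oneForm (hO : IsOpen O) (hΛ : ContDiffOn ℝ ∞ Λ O) :
    ContDiffOn ℝ ∞ (oneForm Λ k) O :=
  ContDiffOn.sum fun r _ => (contDiffOn_mom hO hΛ r).clm_comp contDiffOn_const

theorem contDiffOn_twoForm (hO : IsOpen O) (hΛ : ContDiffOn ℝ ∞ Λ O) :
    ContDiffOn ℝ ∞ (twoForm Λ k) O := by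
  have h := contDiffOn_fderiv hO (contDiffOn_oneForm (k := k) hO hΛ)
  exact (contDiffOn_flip h).sub h

theorem contDiffOn_en (hO : IsOpen O) (hΛ : ContDiffOn ℝ ∞ Λ O) : ContDiffOn ℝ ∞ (en Λ k) O :=
  ((contDiffOn_oneForm hO hΛ).clm_apply (shift (E := E) (n := n)).contDiff.contDiffOn).sub hΛ

theorem oneForm_apply (x w : Fin (n + 1) → E) :
    oneForm Λ k x w = ∑ r ∈ Finset.range k, mom Λ k r x (coord r w) := by
  simp [oneForm]

theorem mom_of_ge {r : ℕ} (h : k ≤ r) (x : Fin (n + 1) → E) : mom Λ k r x = 0 := by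
  simp [mom, Nat.sub_eq_zero_of_le h]

theorem fderiv_mom (hO : IsOpen O) (hΛ : ContDiffOn ℝ ∞ Λ O) (r : ℕ) {x : Fin (n + 1) → E}
    (hx : x ∈ O) (w : Fin (n + 1) → E) :
    fderiv ℝ (mom Λ k r) x w = ∑ i ∈ Finset.range (k - r),
      (-1 : ℝ) ^ i • fderiv ℝ (shiftDeriv^[i] (slotDeriv Λ (r + 1 + i))) x w := by
  have hd : ∀ i, DifferentiableAt ℝ (shiftDeriv^[i] (slotDeriv Λ (r + 1 + i))) x := fun i =>
    differentiableAt_of_contDiffOn hO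
      (contDiffOn_iterate_shiftDeriv hO (contDiffOn_slotDeriv hO hΛ _) i) hx
  have he : HasFDerivAt (mom Λ k r) (∑ i ∈ Finset.range (k - r),
      (-1 : ℝ) ^ i • fderiv ℝ (shiftDeriv^[i] (slotDeriv Λ (r + 1 + i))) x) x :=
    HasFDerivAt.fun_sum fun i _ => (hd i).hasFDerivAt.fun_const_smul _
  rw [he.fderiv]
  simp

/-- The recursion `p_r = ∂Λ/∂q_{r+1} - d_T p_{r+1}`. -/
theorem mom_eq (hO : IsOpen O) (hΛ : ContDiffOn ℝ ∞ Λ O) {r : ℕ} (hr : r < k)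
    {x : Fin (n + 1) → E} (hx : x ∈ O) :
    mom Λ k r x = slotDeriv Λ (r + 1) x - fderiv ℝ (mom Λ k (r + 1)) x (shift x) := by
  rw [fderiv_mom hO hΛ _ hx, mom, show k - r = k - (r + 1) + 1 by omega, Finset.sum_range_succ']
  rw [add_comm, sub_eq_add_neg, ← Finset.sum_neg_distrib]
  congr 1
  · simp
  · refine Finset.sum_congr rfl fun i _ => ?_
    rw [Function.iterate_succ_apply', show r + 1 + (i + 1) = r + 1 + 1 + i by omega, pow_succ]
    rw [mul_neg_one]
    exact neg_smul ((-1 : ℝ) ^ i) (shiftDeriv (shiftDeriv^[i] (slotDeriv Λ (r + 1 + 1 + i))) x)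

/-- Second derivatives commute, so differentiating ∂Λ/∂q_j along w amounts to differentiating DΛ(w),
which vanishes on `O`. -/
theorem DependsUpTo.slotDeriv (hO : IsOpen O) (hΛ : ContDiffOn ℝ ∞ Λ O) (hd : DependsUpTo O Λ k)
    (j : ℕ) : DependsUpTo O (slotDeriv Λ j) k := by
  intro x hx w hw
  have h0 : fderiv ℝ (fun y => fderiv ℝ Λ y w) x = 0 := by
    rw [fderiv_congr_of_eqOn hO (g := fun _ => (0 : ℝ)) (fun y hy => hd y hy w hw) hx]
    simp
  have hD : DifferentiableAt ℝ (fderiv ℝ Λ) x :=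
    differentiableAt_of_contDiffOn hO (contDiffOn_fderiv hO hΛ) hx
  ext e
  have h1 := fderiv_fderiv_apply hO hΛ hx (g := fun _ => w) (differentiableAt_const w) (incl j e)
  have h2 : fderiv ℝ (JetSpace.slotDeriv Λ j) x w e = fderiv ℝ (fderiv ℝ Λ) x w (incl j e) := by
    have : JetSpace.slotDeriv Λ j = fun x => (fderiv ℝ Λ x).comp (incl j) := rfl
    rw [this, fderiv_clm_comp hD (differentiableAt_const _)]
    simp
  rw [h2, fderiv_fderiv_comm hO hΛ hx]
  rw [h0] at h1
  simpa using h1.symm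

theorem hess_symm (hO : IsOpen O) (hΛ : ContDiffOn ℝ ∞ Λ O) {x : Fin (n + 1) → E} (hx : x ∈ O)
    (u v : E) : hess Λ k x u v = hess Λ k x v u := by
  have hD : DifferentiableAt ℝ (fderiv ℝ Λ) x :=
    differentiableAt_of_contDiffOn hO (contDiffOn_fderiv hO hΛ) hx
  have h2 : ∀ u v, hess Λ k x u v = fderiv ℝ (fderiv ℝ Λ) x (incl k u) (incl k v) := by
    intro u v
    have : JetSpace.slotDeriv Λ k = fun x => (fderiv ℝ Λ x).comp (incl k) := rfl
    rw [hess, this, fderiv_clm_comp hD (differentiableAt_const _)]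
    simp
  rw [h2, h2, fderiv_fderiv_comm hO hΛ hx]

/-- The momentum `p_r` depends only on `q_0, …, q_{2k-1-r}`, and its derivative with respect to
`q_{2k-1-r}` is the Hessian, up to sign. -/
theorem fderiv_mom_apply (hO : IsOpen O) (hΛ : ContDiffOn ℝ ∞ Λ O) (hd : DependsUpTo O Λ k)
    {r : ℕ} (hr : r < k) {x : Fin (n + 1) → E} (hx : x ∈ O) {w : Fin (n + 1) → E}
    (hw : ∀ j < 2 * k - 1 - r, coord j w = 0) :
    fderiv ℝ (mom Λ k r) x w =
      (-1 : ℝ) ^ (k - 1 - r) • hess Λ k x (coord (2 * k - 1 - r) w) := by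
  have hG := fun j => contDiffOn_slotDeriv hO hΛ j
  have hGd := fun j => DependsUpTo.slotDeriv hO hΛ hd j
  have key : ∀ i < k - r, fderiv ℝ (shiftDeriv^[i] (slotDeriv Λ (r + 1 + i))) x w =
      fderiv ℝ (slotDeriv Λ (r + 1 + i)) x (shift^[i] w) := fun i hi =>
    (hGd _).fderiv_iterate_shiftDeriv hO (hG _) i hx fun j hj => hw j (by omega)
  -- The `i`-th summand involves coordinates up to q_{k+i}, and w has none below 2k-1-r. Hence only
  -- the last index i = k-1-r contributes; there r+1+i = k, and the leading coefficient is the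
  -- Hessian.
  rw [fderiv_mom hO hΛ r hx, Finset.sum_eq_single (k - 1 - r)]
  · congr 1
    rw [key _ (by omega), show r + 1 + (k - 1 - r) = k by omega, hess]
    rw [ContinuousLinearMap.comp_apply, ← sub_eq_zero, ← map_sub]
    refine hGd _ x hx _ fun j hj => ?_
    rw [map_sub, coord_iterate_shift]
    rcases hj.lt_or_eq with hj | rfl
    · rw [hw _ (by omega), coord_incl_ne hj.ne, sub_zero]
    · rw [show j + (j - 1 - r) = 2 * j - 1 - r by omega]
      -- Here `j` is the order of the Lagrangian, and n is not yet tied to it: if j > n, both terms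
      -- vanish by the zero conventions of `coord` and `incl`.
      by_cases hn : j ≤ n
      · rw [coord_incl_self hn, sub_self]
      · rw [coord_of_gt (by omega), map_zero, map_zero, sub_zero]
  · intro i hi hne
    have hi' : i < k - r := Finset.mem_range.1 hi
    rw [key i hi', hGd _ x hx _ fun j hj => ?_, smul_zero]
    rw [coord_iterate_shift]
    exact hw _ (by omega)
  · intro h
    simp at h
    omega

/-- Indices r ≥ k, where p_r = 0, are admitted so that the lemma applies to p_{j+1} for every j < k.
-/
theorem fderiv_mom_eq_zero (hO : IsOpen O) (hΛ : ContDiffOn ℝ ∞ Λ O) (hd : DependsUpTo O Λ k)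
    {r : ℕ} {x : Fin (n + 1) → E} (hx : x ∈ O) {w : Fin (n + 1) → E}
    (hw : ∀ j ≤ 2 * k - 1 - r, coord j w = 0) : fderiv ℝ (mom Λ k r) x w = 0 := by
  by_cases hr : r < k
  · rw [fderiv_mom_apply hO hΛ hd hr hx fun j hj => hw j hj.le, hw _ le_rfl]
    simp
  · have : mom Λ k r = fun _ => 0 := funext fun y => mom_of_ge (by omega) y
    rw [this]; simp

end Momenta

end JetSpace

/-! ### Nondegeneracy of the 2-form and the semispray property. -/

namespace JetSpace

variable {E : Type*} [NormedAddCommGroup E] [NormedSpace ℝ E]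
variable {n k : ℕ}

theorem hasFDerivAt_clm_comp {X Y Z : Type*} [NormedAddCommGroup X] [NormedSpace ℝ X]
    [NormedAddCommGroup Y] [NormedSpace ℝ Y] [NormedAddCommGroup Z] [NormedSpace ℝ Z]
    (c : Y →L[ℝ] Z) {f : X → Y} {f' : X →L[ℝ] Y} {x : X} (hf : HasFDerivAt f f' x) :
    HasFDerivAt (fun y => c (f y)) (c.comp f') x :=
  c.hasFDerivAt.comp x hf

/-- On a finite-dimensional space, a linear map to the dual which is injective is bijective. -/
theorem bijective_of_injective_dual {X : Type*} [NormedAddCommGroup X] [NormedSpace ℝ X]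
    [FiniteDimensional ℝ X] {B : X →L[ℝ] X →L[ℝ] ℝ} (hB : ∀ v, (∀ w, B v w = 0) → v = 0) :
    Function.Bijective B := by
  have hinj : Function.Injective B := (injective_iff_map_eq_zero B).2 fun v hv =>
    hB v fun w => by rw [hv, zero_apply]
  have hfin : Module.finrank ℝ X = Module.finrank ℝ (X →L[ℝ] ℝ) := by
    rw [(LinearMap.toContinuousLinearMap (𝕜 := ℝ) (E := X) (F' := ℝ)).symm.finrank_eq]
    exact (Subspace.dual_finrank_eq (K := ℝ) (V := X)).symm
  exact ⟨hinj, (LinearMap.injective_iff_surjective_of_finrank_eq_finrank hfin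
    (f := B.toLinearMap)).1 hinj⟩

section Symplectic

variable {Λ : (Fin (n + 1) → E) → ℝ} {O : Set (Fin (n + 1) → E)} {x : Fin (n + 1) → E}

theorem fderiv_oneForm (hO : IsOpen O) (hΛ : ContDiffOn ℝ ∞ Λ O) (hx : x ∈ O)
    (u w : Fin (n + 1) → E) :
    fderiv ℝ (oneForm Λ k) x u w =
      ∑ r ∈ Finset.range k, fderiv ℝ (mom Λ k r) x u (coord r w) := by
  have hd : ∀ r, DifferentiableAt ℝ (mom Λ k r) x := fun r =>
    differentiableAt_of_contDiffOn hO (contDiffOn_mom hO hΛ r) hx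
  have he : HasFDerivAt (fun y => oneForm Λ k y w) (∑ r ∈ Finset.range k,
      (ContinuousLinearMap.apply ℝ ℝ (coord r w)).comp (fderiv ℝ (mom Λ k r) x)) x := by
    simp only [oneForm_apply]
    exact HasFDerivAt.fun_sum fun r _ =>
      (ContinuousLinearMap.apply ℝ ℝ (coord r w)).hasFDerivAt.comp x (hd r).hasFDerivAt
  have h1 : DifferentiableAt ℝ (oneForm Λ k) x :=
    differentiableAt_of_contDiffOn hO (contDiffOn_oneForm hO hΛ) hx
  have h2 : HasFDerivAt (fun y => oneForm Λ k y w)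
      ((ContinuousLinearMap.apply ℝ ℝ w).comp (fderiv ℝ (oneForm Λ k) x)) x :=
    (ContinuousLinearMap.apply ℝ ℝ w).hasFDerivAt.comp x h1.hasFDerivAt
  have := DFunLike.congr_fun (h2.unique he) u
  simpa using this

theorem twoForm_apply' (v w : Fin (n + 1) → E) :
    twoForm Λ k x v w = fderiv ℝ (oneForm Λ k) x w v - fderiv ℝ (oneForm Λ k) x v w := rfl

theorem twoForm_apply (hO : IsOpen O) (hΛ : ContDiffOn ℝ ∞ Λ O) (hx : x ∈ O)
    (v w : Fin (n + 1) → E) :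
    twoForm Λ k x v w = ∑ r ∈ Finset.range k, fderiv ℝ (mom Λ k r) x w (coord r v) -
      ∑ r ∈ Finset.range k, fderiv ℝ (mom Λ k r) x v (coord r w) := by
  rw [twoForm_apply', fderiv_oneForm hO hΛ hx, fderiv_oneForm hO hΛ hx]

/-- For a regular Lagrangian the `2`-form is nondegenerate. -/
theorem twoForm_nondegenerate (hn : n + 1 = 2 * k) (hO : IsOpen O) (hΛ : ContDiffOn ℝ ∞ Λ O)
    (hd : DependsUpTo O Λ k) (hx : x ∈ O)
    (hW : ∀ u, (∀ v, hess Λ k x u v = 0) → u = 0) {v : Fin (n + 1) → E}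
    (hv : ∀ w, twoForm Λ k x v w = 0) : v = 0 := by
  simp only [twoForm_apply hO hΛ hx] at hv
  have low : ∀ r < k, coord r v = 0 := by
    intro r
    induction r using Nat.strong_induction_on with
    | _ r ih =>
      intro hr
      refine hW _ fun e => ?_
      rw [hess_symm hO hΛ hx]
      -- Test direction q_{2k-1-r}: it has no component below k, so the second sum vanishes. In the
      -- first, p_{r'} with r' > r does not involve this coordinate, and v_{r'} = 0 for r' < r by
      -- induction. The term r' = r is the Hessian on e and v_r, up to sign.
      have h := hv (incl (2 * k - 1 - r) e)
      have h2 : ∑ r' ∈ Finset.range k, fderiv ℝ (mom Λ k r') x v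
          (coord r' (incl (2 * k - 1 - r) e : Fin (n + 1) → E)) = 0 :=
        Finset.sum_eq_zero fun r' hr' => by
          have := Finset.mem_range.1 hr'
          rw [coord_incl_ne (by omega), map_zero]
      rw [h2, sub_zero, Finset.sum_eq_single r] at h
      · rw [fderiv_mom_apply hO hΛ hd hr hx fun j hj => coord_incl_ne hj.ne _,
          coord_incl_self (by omega)] at h
        simpa using h
      · intro r' hr' hne
        have hr'k := Finset.mem_range.1 hr'
        rcases hne.lt_or_gt with hlt | hgt
        · rw [ih r' hlt hr'k, map_zero]
        · rw [fderiv_mom_eq_zero hO hΛ hd hx fun j hj => coord_incl_ne (by omega) _]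
          simp
      · intro h; exact absurd (Finset.mem_range.2 hr) h
  have high : ∀ m < k, coord (k + m) v = 0 := by
    intro m
    induction m using Nat.strong_induction_on with
    | _ m ih =>
      intro hm
      refine hW _ fun e => ?_
      -- With v_0, …, v_{k-1} already zero, only the second sum is left, and this direction selects
      -- p_{k-1-m}. Its derivative along v sees just v_{k+m}, through the Hessian.
      have h := hv (incl (k - 1 - m) e)
      have h1 : ∑ r ∈ Finset.range k, fderiv ℝ (mom Λ k r) x (incl (k - 1 - m) e)
          (coord r v) = 0 :=
        Finset.sum_eq_zero fun r hr => by rw [low r (Finset.mem_range.1 hr), map_zero]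
      rw [h1, zero_sub, neg_eq_zero, Finset.sum_eq_single (k - 1 - m)] at h
      · rw [coord_incl_self (by omega), fderiv_mom_apply hO hΛ hd (by omega) hx,
          show 2 * k - 1 - (k - 1 - m) = k + m by omega] at h
        · simpa using h
        · intro j hj
          by_cases hjk : j < k
          · exact low j hjk
          · have := ih (j - k) (by omega) (by omega)
            rwa [show k + (j - k) = j by omega] at this
      · intro r _ hne
        rw [coord_incl_ne hne, map_zero]
      · intro h; exact absurd (Finset.mem_range.2 (by omega)) h
  refine ext_coord fun j hj => ?_
  rw [map_zero]
  by_cases hjk : j < k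
  · exact low j hjk
  · have := high (j - k) (by omega)
    rwa [show k + (j - k) = j by omega] at this

/-- The top coordinate q_{2k-1} enters p_0 alone, with the Hessian as coefficient up to sign, and no
dq_r with r < k sees this direction. -/
theorem twoForm_incl_last (hn : n + 1 = 2 * k) (hO : IsOpen O) (hΛ : ContDiffOn ℝ ∞ Λ O)
    (hd : DependsUpTo O Λ k) (hx : x ∈ O) (b : E) (w : Fin (n + 1) → E) :
    twoForm Λ k x (incl n b) w = -((-1 : ℝ) ^ (k - 1) * hess Λ k x b (coord 0 w)) := by
  rw [twoForm_apply hO hΛ hx, Finset.sum_eq_zero, zero_sub, Finset.sum_eq_single 0]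
  · rw [fderiv_mom_apply hO hΛ hd (by omega) hx fun j hj => coord_incl_ne (by omega) _,
      show 2 * k - 1 - 0 = n by omega, coord_incl_self le_rfl]
    simp
  · intro r hr hne
    rw [fderiv_mom_eq_zero hO hΛ hd hx fun j hj => coord_incl_ne (by omega) _]
    simp
  · intro h; exact absurd (Finset.mem_range.2 (by omega)) h
  · intro r hr
    have := Finset.mem_range.1 hr
    rw [coord_incl_ne (by omega), map_zero]

theorem fderiv_eq_sum_slotDeriv (hkn : k ≤ n) (hd : DependsUpTo O Λ k) (hx : x ∈ O)
    (w : Fin (n + 1) → E) :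
    fderiv ℝ Λ x w = ∑ j ∈ Finset.range (k + 1), slotDeriv Λ j x (coord j w) := by
  have h : fderiv ℝ Λ x (w - ∑ j ∈ Finset.range (k + 1), incl j (coord j w)) = 0 := by
    refine hd x hx _ fun j hj => ?_
    rw [map_sub, map_sum, Finset.sum_eq_single j, coord_incl_self (by omega), sub_self]
    · intro i _ hi; exact coord_incl_ne hi.symm _
    · intro h; exact absurd (Finset.mem_range.2 (by omega)) h
  rw [map_sub, sub_eq_zero, map_sum] at h
  exact h

/-- The index can be shifted because p_k = 0. This pairs the derivative of p_{r+1} with the slot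
r+1, as in the recursion `mom_eq`. -/
theorem sum_fderiv_mom (x u : Fin (n + 1) → E) (a : ℕ → E) :
    ∑ r ∈ Finset.range k, fderiv ℝ (mom Λ k r) x u (a r) =
      ∑ r ∈ Finset.range k, fderiv ℝ (mom Λ k (r + 1)) x u (a (r + 1)) +
        fderiv ℝ (mom Λ k 0) x u (a 0) := by
  rw [← Finset.sum_range_succ' (fun r => fderiv ℝ (mom Λ k r) x u (a r)), Finset.sum_range_succ]
  have : mom Λ k k = fun _ => 0 := funext fun y => mom_of_ge le_rfl y
  simp [this]

/-- `dE = i(Sx) ω - δ`, where `δ` is the (truncated) Euler–Lagrange form. -/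
theorem fderiv_en (hkn : k ≤ n) (hO : IsOpen O) (hΛ : ContDiffOn ℝ ∞ Λ O)
    (hd : DependsUpTo O Λ k) (hx : x ∈ O) (w : Fin (n + 1) → E) :
    fderiv ℝ (en Λ k) x w = twoForm Λ k x (shift x) w -
      (slotDeriv Λ 0 x - fderiv ℝ (mom Λ k 0) x (shift x)) (coord 0 w) := by
  have h1 : DifferentiableAt ℝ (oneForm Λ k) x :=
    differentiableAt_of_contDiffOn hO (contDiffOn_oneForm hO hΛ) hx
  have h2 : DifferentiableAt ℝ Λ x := differentiableAt_of_contDiffOn hO hΛ hx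
  have h3 : HasFDerivAt (en Λ k) _ x :=
    (h1.hasFDerivAt.clm_apply (shift (E := E) (n := n)).hasFDerivAt).fun_sub h2.hasFDerivAt
  rw [h3.fderiv, twoForm_apply', fderiv_oneForm hO hΛ hx (shift x), sum_fderiv_mom x (shift x)
    fun r => coord r w]
  have h4 := fderiv_eq_sum_slotDeriv hkn hd hx w
  rw [Finset.sum_range_succ'] at h4
  -- By the recursion, θ(Sw) consists of terms ∂Λ/∂q_{r+1} and d_T p_{r+1}. They cancel against
  -- dΛ(w) and Dθ(Sx)(w) in every slot except q_0, which leaves the Euler–Lagrange term.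
  have h5 : oneForm Λ k x (shift w) = ∑ r ∈ Finset.range k, slotDeriv Λ (r + 1) x (coord (r + 1) w) -
      ∑ r ∈ Finset.range k, fderiv ℝ (mom Λ k (r + 1)) x (shift x) (coord (r + 1) w) := by
    rw [oneForm_apply, ← Finset.sum_sub_distrib]
    refine Finset.sum_congr rfl fun r hr => ?_
    rw [mom_eq hO hΛ (Finset.mem_range.1 hr) hx, coord_shift]
    rfl
  simp only [add_apply, sub_apply,
    ContinuousLinearMap.comp_apply, ContinuousLinearMap.flip_apply, h4, h5]
  ring

/-- A kernel vector of the Hessian, placed in the last slot, lies in the kernel of ω by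
`twoForm_incl_last`. This recovers regularity in an arbitrary chart from the intrinsic nondegeneracy
of ω. -/
theorem hess_nondegenerate (hn : n + 1 = 2 * k) (hO : IsOpen O)
    (hΛ : ContDiffOn ℝ ∞ Λ O) (hd : DependsUpTo O Λ k) (hx : x ∈ O)
    (hnd : ∀ v, (∀ w, twoForm Λ k x v w = 0) → v = 0) {b : E}
    (hb : ∀ e, hess Λ k x b e = 0) : b = 0 := by
  have := hnd (incl n b) fun w => by rw [twoForm_incl_last hn hO hΛ hd hx, hb]; simp
  rw [← coord_incl_self (n := n) le_rfl b, this, map_zero]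

/-- A solution of `i(v) ω = dE` is a semispray: `v_j = q_{j+1}` for `j < n`. -/
theorem coord_of_twoForm_eq [FiniteDimensional ℝ E] (hn : n + 1 = 2 * k) (hO : IsOpen O)
    (hΛ : ContDiffOn ℝ ∞ Λ O) (hd : DependsUpTo O Λ k) (hx : x ∈ O)
    (hnd : ∀ v, (∀ w, twoForm Λ k x v w = 0) → v = 0) {v : Fin (n + 1) → E}
    (hv : ∀ w, twoForm Λ k x v w = fderiv ℝ (en Λ k) x w) {j : ℕ} (hj : j < n) :
    coord j v = coord (j + 1) x := by
  -- The vector b is chosen so that i(`incl n b`)ω = -δ. Then v and Sx + `incl n b` both solve i(·)ω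
  -- = dE and agree by nondegeneracy; the correction touches only the last coordinate.
  obtain ⟨b, hb⟩ := (bijective_of_injective_dual fun b hb =>
    hess_nondegenerate hn hO hΛ hd hx hnd (b := b) hb).2
    ((-1 : ℝ) ^ (k - 1) • (slotDeriv Λ 0 x - fderiv ℝ (mom Λ k 0) x (shift x)))
  have h0 : v - shift x - incl n b = 0 := by
    refine hnd _ fun w => ?_
    have h1 := hv w
    rw [fderiv_en (by omega) hO hΛ hd hx] at h1
    have h2 := twoForm_incl_last hn hO hΛ hd hx b w
    rw [hb, smul_apply, smul_eq_mul, ← mul_assoc, ← pow_add,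
      Even.neg_one_pow ⟨_, rfl⟩, one_mul] at h2
    rw [map_sub, map_sub, sub_apply, sub_apply, h1, h2]
    ring
  have := congrArg (coord j) h0
  rw [map_sub, map_sub, coord_incl_ne hj.ne, coord_shift, map_zero, sub_zero, sub_eq_zero] at this
  exact this

end Symplectic

/-- `T` satisfies the identities of the prolongation to jets of a map of `E`: it is smooth,
`T_j` depends only on `q_0, …, q_j`, and `d_T T_j = T_{j+1}`. -/
structure IsProlongation (O : Set (Fin (n + 1) → E)) (T : (Fin (n + 1) → E) → Fin (n + 1) → E) :
    Prop where
  isOpen : IsOpen O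
  smooth : ContDiffOn ℝ ∞ T O
  fderiv_shift : ∀ x ∈ O, ∀ j < n, coord j (fderiv ℝ T x (shift x)) = coord (j + 1) (T x)
  fderiv_incl : ∀ x ∈ O, ∀ j r, j < r → ∀ e, coord j (fderiv ℝ T x (incl r e)) = 0

/-! ### Invariance of momenta, forms and energy under prolonged coordinate changes. -/

section Invariance

variable {O O' : Set (Fin (n + 1) → E)} {T : (Fin (n + 1) → E) → Fin (n + 1) → E}
variable {Λ Λ' : (Fin (n + 1) → E) → ℝ} {x : Fin (n + 1) → E}

theorem IsProlongation.differentiableAt (hT : IsProlongation O T) (hx : x ∈ O) :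
    DifferentiableAt ℝ T x := differentiableAt_of_contDiffOn hT.isOpen hT.smooth hx

/-- The commutator [∂/∂q_{r+1}, d_T] = ∂/∂q_r applied to T_j, together with d_T T_j = T_{j+1}. -/
theorem IsProlongation.coord_fderiv_fderiv (hT : IsProlongation O T) (hx : x ∈ O) {j r : ℕ}
    (hj : j < n) (hr : r + 1 ≤ n) (e : E) :
    coord j (fderiv ℝ (fderiv ℝ T) x (shift x) (incl (r + 1) e)) =
      coord (j + 1) (fderiv ℝ T x (incl (r + 1) e)) - coord j (fderiv ℝ T x (incl r e)) := by
  have h1 : HasFDerivAt (fun y => coord j (fderiv ℝ T y (shift y)))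
      ((coord j).comp (fderiv ℝ (fun y => fderiv ℝ T y (shift y)) x)) x :=
    hasFDerivAt_clm_comp (coord j) (DifferentiableAt.hasFDerivAt
      (differentiableAt_of_contDiffOn hT.isOpen (contDiffOn_shiftDeriv hT.isOpen hT.smooth) hx))
  have h2 : HasFDerivAt (fun y => coord (j + 1) (T y)) ((coord (j + 1)).comp (fderiv ℝ T x)) x :=
    hasFDerivAt_clm_comp (coord (j + 1)) (hT.differentiableAt hx).hasFDerivAt
  have h3 : (fun y => coord j (fderiv ℝ T y (shift y))) =ᶠ[𝓝 x] fun y => coord (j + 1) (T y) :=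
    eventually_of_mem (hT.isOpen.mem_nhds hx) fun y hy => hT.fderiv_shift y hy j hj
  have h4 := DFunLike.congr_fun ((h2.congr_of_eventuallyEq h3).unique h1) (incl (r + 1) e)
  rw [ContinuousLinearMap.comp_apply, ContinuousLinearMap.comp_apply,
    fderiv_fderiv_apply hT.isOpen hT.smooth hx (g := shift)
      (shift (E := E) (n := n)).differentiableAt, ContinuousLinearMap.fderiv,
    shift_incl_succ hr, fderiv_fderiv_comm hT.isOpen hT.smooth hx, map_add] at h4
  rw [h4, add_sub_cancel_right]

/-- The momenta transform under prolongations as the components of a `1`-form. -/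
theorem IsProlongation.mom_eq (hT : IsProlongation O T) (hO' : IsOpen O') (hTO : MapsTo T O O')
    (hn : n + 1 = 2 * k) (hΛ' : ContDiffOn ℝ ∞ Λ' O') (hd' : DependsUpTo O' Λ' k)
    (hΛ : EqOn Λ (Λ' ∘ T) O) {r : ℕ} (hr : r ≤ k) :
    ∀ x ∈ O, ∀ e, mom Λ k r x e =
      ∑ j ∈ Finset.range k, mom Λ' k j (T x) (coord j (fderiv ℝ T x (incl r e))) := by
  have hO := hT.isOpen
  have hΛs : ContDiffOn ℝ ∞ Λ O := (hΛ'.comp hT.smooth hTO).congr hΛ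
  refine Nat.decreasingInduction (motive := fun r _ => ∀ x ∈ O, ∀ e, mom Λ k r x e =
      ∑ j ∈ Finset.range k, mom Λ' k j (T x) (coord j (fderiv ℝ T x (incl r e)))) ?_ ?_ hr
  · intro r hrk ih x hx e
    have hy : T x ∈ O' := hTO hx
    have hTd := hT.differentiableAt hx
    set a : ℕ → E := fun j => coord j (fderiv ℝ T x (incl (r + 1) e)) with ha
    -- The component T_0 depends on q_0 only. This removes the slot-0 terms from both index-shifted
    -- sums below.
    have ha0 : a 0 = 0 := hT.fderiv_incl x hx 0 (r + 1) (by omega) e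
    have hslot : slotDeriv Λ (r + 1) x e =
        ∑ j ∈ Finset.range k, slotDeriv Λ' (j + 1) (T x) (a (j + 1)) := by
      have h1 : fderiv ℝ Λ x = (fderiv ℝ Λ' (T x)).comp (fderiv ℝ T x) := by
        rw [fderiv_congr_of_eqOn hO hΛ hx]
        exact fderiv_comp x (differentiableAt_of_contDiffOn hO' hΛ' hy) hTd
      have h2 := fderiv_eq_sum_slotDeriv (by omega) hd' hy (fderiv ℝ T x (incl (r + 1) e))
      rw [Finset.sum_range_succ'] at h2
      change _ = _ + slotDeriv Λ' 0 (T x) (a 0) at h2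
      rw [ha0, map_zero, add_zero] at h2
      rw [slotDeriv, h1]
      exact h2
    have hD2 : DifferentiableAt ℝ (fderiv ℝ T) x :=
      differentiableAt_of_contDiffOn hO (contDiffOn_fderiv hO hT.smooth) hx
    -- The induction hypothesis is differentiated along Sx. The derivative of ∂T_j/∂q_{r+1}
    -- contributes T_{j+1} and T_j terms by the commutator identity, and the T_j terms become the
    -- right-hand side for r.
    have hmom : fderiv ℝ (mom Λ k (r + 1)) x (shift x) e =
        ∑ j ∈ Finset.range k, (fderiv ℝ (mom Λ' k j) (T x) (fderiv ℝ T x (shift x)) (a j) +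
          mom Λ' k j (T x) (a (j + 1) - coord j (fderiv ℝ T x (incl r e)))) := by
      have h1 : HasFDerivAt (fun y => mom Λ k (r + 1) y e)
          ((ContinuousLinearMap.apply ℝ ℝ e).comp (fderiv ℝ (mom Λ k (r + 1)) x)) x :=
        (ContinuousLinearMap.apply ℝ ℝ e).hasFDerivAt.comp x (DifferentiableAt.hasFDerivAt
          (differentiableAt_of_contDiffOn hO (contDiffOn_mom hO hΛs _) hx))
      have h2 : ∀ j, HasFDerivAt (fun y => mom Λ' k j (T y))
          ((fderiv ℝ (mom Λ' k j) (T x)).comp (fderiv ℝ T x)) x := fun j =>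
        HasFDerivAt.comp x (differentiableAt_of_contDiffOn hO'
          (contDiffOn_mom hO' hΛ' j) hy).hasFDerivAt hTd.hasFDerivAt
      have h3 : ∀ j, HasFDerivAt (fun y => coord j (fderiv ℝ T y (incl (r + 1) e)))
          ((coord j).comp ((ContinuousLinearMap.apply ℝ _ (incl (r + 1) e)).comp
            (fderiv ℝ (fderiv ℝ T) x))) x := fun j =>
        hasFDerivAt_clm_comp (coord j) (hasFDerivAt_clm_comp
          (ContinuousLinearMap.apply ℝ (Fin (n + 1) → E) (incl (r + 1) e)) hD2.hasFDerivAt)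
      have h4 := HasFDerivAt.fun_sum (u := Finset.range k) fun j _ => (h2 j).clm_apply (h3 j)
      have h5 := h4.congr_of_eventuallyEq
        (eventually_of_mem (hO.mem_nhds hx) fun y hy => ih y hy e)
      have h6 := DFunLike.congr_fun (h1.unique h5) (shift x)
      simp only [ContinuousLinearMap.comp_apply, ContinuousLinearMap.apply_apply] at h6
      rw [h6, sum_apply]
      refine Finset.sum_congr rfl fun j hj => ?_
      have hjk := Finset.mem_range.1 hj
      rw [ha, ← hT.coord_fderiv_fderiv hx (by omega) (by omega)]
      simp [add_comm]
    rw [JetSpace.mom_eq hO hΛs hrk hx, sub_apply, hslot, hmom,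
      Finset.sum_add_distrib, sum_fderiv_mom, ha0, map_zero, add_zero, ← Finset.sum_add_distrib,
      ← Finset.sum_sub_distrib]
    refine Finset.sum_congr rfl fun j hj => ?_
    have hjk := Finset.mem_range.1 hj
    -- DT(Sx) and S(Tx) may differ in the last coordinate, where the shift is truncated; p'_{j+1}
    -- does not involve it.
    have h1 : fderiv ℝ (mom Λ' k (j + 1)) (T x) (fderiv ℝ T x (shift x)) =
        fderiv ℝ (mom Λ' k (j + 1)) (T x) (shift (T x)) := by
      rw [← sub_eq_zero, ← map_sub]
      refine fderiv_mom_eq_zero hO' hΛ' hd' hy fun i hi => ?_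
      rw [map_sub, hT.fderiv_shift x hx i (by omega), coord_shift, sub_self]
    rw [h1, JetSpace.mom_eq hO' hΛ' hjk hy, map_sub]
    simp only [sub_apply]
    ring
  · intro x hx e
    -- Start of the downward induction at r = k: p_k = 0, and T_j with j < k does not depend on q_k.
    rw [mom_of_ge le_rfl]
    symm
    refine Finset.sum_eq_zero fun j hj => ?_
    rw [hT.fderiv_incl x hx j k (Finset.mem_range.1 hj), map_zero]

theorem IsProlongation.oneForm_eq (hT : IsProlongation O T) (hO' : IsOpen O')
    (hTO : MapsTo T O O') (hn : n + 1 = 2 * k) (hΛ' : ContDiffOn ℝ ∞ Λ' O')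
    (hd' : DependsUpTo O' Λ' k) (hΛ : EqOn Λ (Λ' ∘ T) O) (hx : x ∈ O) (w : Fin (n + 1) → E) :
    oneForm Λ k x w = oneForm Λ' k (T x) (fderiv ℝ T x w) := by
  rw [oneForm_apply, oneForm_apply]
  rw [Finset.sum_congr rfl fun r hr => hT.mom_eq hO' hTO hn hΛ' hd' hΛ
    (Finset.mem_range.1 hr).le x hx (coord r w), Finset.sum_comm]
  refine Finset.sum_congr rfl fun j hj => ?_
  rw [← map_sum, ← map_sum, ← map_sum]
  have hjk := Finset.mem_range.1 hj
  congr 1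
  conv_rhs => rw [← sum_incl_coord w]
  rw [map_sum, map_sum, map_sum, map_sum]
  -- The slots i ≥ k add nothing to a component T_j with j < k.
  refine Finset.sum_subset (fun i hi => ?_) fun i hi hi' => ?_
  · simp at hi ⊢; omega
  · simp at hi'
    exact hT.fderiv_incl x hx j i (by omega) _

theorem IsProlongation.en_eq (hT : IsProlongation O T) (hO' : IsOpen O')
    (hTO : MapsTo T O O') (hn : n + 1 = 2 * k) (hΛ' : ContDiffOn ℝ ∞ Λ' O')
    (hd' : DependsUpTo O' Λ' k) (hΛ : EqOn Λ (Λ' ∘ T) O) (hx : x ∈ O) :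
    en Λ k x = en Λ' k (T x) := by
  rw [en, en, hT.oneForm_eq hO' hTO hn hΛ' hd' hΛ hx, hΛ hx, oneForm_apply, oneForm_apply]
  congr 1
  refine Finset.sum_congr rfl fun r hr => ?_
  have := Finset.mem_range.1 hr
  rw [hT.fderiv_shift x hx r (by omega), coord_shift]

/-- Differentiating θ = T^*θ' gives the pulled-back derivative plus θ'(D²T(u, w)). The latter is
symmetric in u and w, so it disappears on antisymmetrizing. -/
theorem IsProlongation.twoForm_eq (hT : IsProlongation O T) (hO' : IsOpen O')
    (hTO : MapsTo T O O') (hn : n + 1 = 2 * k) (hΛ' : ContDiffOn ℝ ∞ Λ' O')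
    (hd' : DependsUpTo O' Λ' k) (hΛ : EqOn Λ (Λ' ∘ T) O) (hx : x ∈ O) (v w : Fin (n + 1) → E) :
    twoForm Λ k x v w = twoForm Λ' k (T x) (fderiv ℝ T x v) (fderiv ℝ T x w) := by
  have hO := hT.isOpen
  have hΛs : ContDiffOn ℝ ∞ Λ O := (hΛ'.comp hT.smooth hTO).congr hΛ
  have hTd := hT.differentiableAt hx
  have hD2 : DifferentiableAt ℝ (fderiv ℝ T) x :=
    differentiableAt_of_contDiffOn hO (contDiffOn_fderiv hO hT.smooth) hx
  have key : ∀ u w, fderiv ℝ (oneForm Λ k) x u w =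
      fderiv ℝ (oneForm Λ' k) (T x) (fderiv ℝ T x u) (fderiv ℝ T x w) +
        oneForm Λ' k (T x) (fderiv ℝ (fderiv ℝ T) x u w) := by
    intro u w
    have h1 : HasFDerivAt (fun y => oneForm Λ k y w)
        ((ContinuousLinearMap.apply ℝ ℝ w).comp (fderiv ℝ (oneForm Λ k) x)) x :=
      (ContinuousLinearMap.apply ℝ ℝ w).hasFDerivAt.comp x (DifferentiableAt.hasFDerivAt
        (differentiableAt_of_contDiffOn hO (contDiffOn_oneForm hO hΛs) hx))
    have h2 : HasFDerivAt (fun y => oneForm Λ' k (T y))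
        ((fderiv ℝ (oneForm Λ' k) (T x)).comp (fderiv ℝ T x)) x :=
      HasFDerivAt.comp x (differentiableAt_of_contDiffOn hO'
        (contDiffOn_oneForm hO' hΛ') (hTO hx)).hasFDerivAt hTd.hasFDerivAt
    have h3 : HasFDerivAt (fun y => fderiv ℝ T y w)
        ((ContinuousLinearMap.apply ℝ _ w).comp (fderiv ℝ (fderiv ℝ T) x)) x :=
      hasFDerivAt_clm_comp (ContinuousLinearMap.apply ℝ _ w) hD2.hasFDerivAt
    have h5 := (h2.clm_apply h3).congr_of_eventuallyEq (eventually_of_mem (hO.mem_nhds hx)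
      fun y hy => hT.oneForm_eq hO' hTO hn hΛ' hd' hΛ hy w)
    have h6 := DFunLike.congr_fun (h1.unique h5) u
    simpa [add_comm] using h6
  rw [twoForm_apply', twoForm_apply', key, key, fderiv_fderiv_comm hO hT.smooth hx]
  ring

end Invariance

end JetSpace

namespace JetSpace

open HigherTangent HamiltonJacobi

variable {E : Type*} [NormedAddCommGroup E] [NormedSpace ℝ E]
variable {V : Type*} [NormedAddCommGroup V] [NormedSpace ℝ V]
variable {n k : ℕ}

/-! ### Jets of smooth maps as prolongations. -/

section Prolongation

variable {F : Type*} [NormedAddCommGroup F] [NormedSpace ℝ F]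

theorem iteratedDeriv_comp_eq_jetMap {τ : E → F} {r : ℕ} {f : ℝ → E} {t : ℝ}
    (hf : ContDiffAt ℝ ∞ f t) (hτ : ContDiffAt ℝ ∞ τ (f t)) (i : Fin (r + 1)) :
    iteratedDeriv i (τ ∘ f) t =
      jetMap τ (fun j : Fin (r + 1) => iteratedDeriv (j : ℕ) f t) i := by
  rw [iteratedDeriv_vcomp_eq_sum_orderedFinpartition hτ hf (by exact_mod_cast le_top)]
  simp [jetMap]

/-- In Faà di Bruno's formula the parts have size at most i. Allowing two jet orders serves both
triangularity (`fderiv_incl`) and compatibility with truncation (`jetMap_trunc`). -/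
theorem jetMap_congr {τ : E → F} {r s : ℕ} {x : Fin (r + 1) → E} {y : Fin (s + 1) → E}
    {i : Fin (r + 1)} {i' : Fin (s + 1)} (hi : (i : ℕ) = i')
    (h : ∀ j ≤ (i : ℕ), coord j x = coord j y) : jetMap τ x i = jetMap τ y i' := by
  obtain ⟨i, hir⟩ := i
  obtain ⟨i', his⟩ := i'
  obtain rfl : i = i' := hi
  have h' : ∀ (j : ℕ) (hj : j ≤ i), x ⟨j, by omega⟩ = y ⟨j, by omega⟩ := fun j hj => by
    have := h j hj
    rwa [coord_of_lt (by omega), coord_of_lt (by omega)] at this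
  unfold jetMap
  have h0 : x 0 = y 0 := h' 0 (Nat.zero_le _)
  rw [h0]
  refine Finset.sum_congr rfl fun p _ => ?_
  congr 1
  funext m
  exact h' _ (p.partSize_le m)

theorem iteratedDeriv_taylorCurve_nat (x : Fin (n + 1) → E) (i : ℕ) :
    iteratedDeriv i (taylorCurve x) 0 = coord i x := by
  unfold taylorCurve
  rw [iteratedDeriv_fun_sum (fun j _ => by fun_prop)]
  have key : ∀ j : Fin (n + 1), iteratedDeriv i
      (fun t : ℝ => (t ^ (j : ℕ) / ((j : ℕ).factorial : ℝ)) • x j) 0 =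
      if i = j then x j else 0 := by
    intro j
    rw [iteratedDeriv_smul_const (by fun_prop)]
    have : (fun t : ℝ => t ^ (j : ℕ) / ((j : ℕ).factorial : ℝ)) =
        fun t : ℝ => ((j : ℕ).factorial : ℝ)⁻¹ * t ^ (j : ℕ) := by
      funext t; rw [div_eq_inv_mul]
    rw [this, iteratedDeriv_const_mul _ (by fun_prop), iteratedDeriv_fun_pow_zero]
    by_cases h : i = j
    · simp [h, Nat.factorial_ne_zero]
    · simp [h]
  simp only [key]
  by_cases h : i < n + 1
  · rw [coord_of_lt h, Finset.sum_eq_single ⟨i, h⟩]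
    · simp
    · intro j _ hj
      rw [if_neg]
      rintro rfl
      exact hj rfl
    · simp
  · rw [coord_of_gt (by omega)]
    refine Finset.sum_eq_zero fun j _ => if_neg ?_
    have := j.2
    omega

theorem hasDerivAt_iteratedDeriv {f : ℝ → E} {t : ℝ} (hf : ContDiffAt ℝ ∞ f t) (i : ℕ) :
    HasDerivAt (iteratedDeriv i f) (iteratedDeriv (i + 1) f t) t := by
  rw [iteratedDeriv_succ]
  have h : ContDiffAt ℝ 1 (iteratedDeriv i f) t := by
    have := hf.of_le (m := ((1 + i : ℕ) : ℕ∞ω)) (by exact_mod_cast le_top)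
    rw [iteratedDeriv_eq_equiv_comp]
    exact (LinearIsometryEquiv.contDiff _).contDiffAt.comp t
      (this.iteratedFDeriv_right (i := i) (m := 1) (by norm_cast))
  exact (h.differentiableAt (by simp)).hasDerivAt

/-- Prolongations to jets of smooth maps satisfy the identities of `IsProlongation`. -/
theorem isProlongation_jetMap {τ : E → E} {U : Set E} (hU : IsOpen U) (hτ : ContDiffOn ℝ ∞ τ U) :
    IsProlongation {q : Fin (n + 1) → E | q 0 ∈ U} (jetMap τ) where
  isOpen := hU.preimage (continuous_apply 0)
  smooth := contDiffOn_jetMap hU hτ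
  fderiv_shift x hx j hj := by
    have hO : IsOpen {q : Fin (n + 1) → E | q 0 ∈ U} := hU.preimage (continuous_apply 0)
    -- J is the jet curve of the Taylor polynomial of x. The polynomial has degree at most n, so its
    -- derivative of order n+1 is zero and J'(0) is exactly the truncated shift. Differentiating the
    -- jets of τ ∘ `taylorCurve x` along J gives d_T T_j = T_{j+1}.
    set J : ℝ → Fin (n + 1) → E := fun t i => iteratedDeriv i (taylorCurve x) t with hJdef
    have hJ0 : J 0 = x := funext fun i => iteratedDeriv_taylorCurve x i
    have hJ : HasDerivAt J (shift x) 0 := by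
      rw [hasDerivAt_pi]
      intro i
      have := hasDerivAt_iteratedDeriv (contDiff_taylorCurve x).contDiffAt (t := 0) i
      rwa [iteratedDeriv_taylorCurve_nat] at this
    have hT := (differentiableAt_of_contDiffOn hO (contDiffOn_jetMap hU hτ)
      hx).hasFDerivAt
    have h1 : HasDerivAt (fun t => coord j (jetMap τ (J t) : Fin (n + 1) → E))
        (coord j (fderiv ℝ (jetMap τ) x (shift x))) 0 := by
      have : HasFDerivAt (jetMap τ : (Fin (n + 1) → E) → _) (fderiv ℝ (jetMap τ) x) (J 0) := by
        rwa [hJ0]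
      exact (coord j).hasFDerivAt.comp_hasDerivAt 0 (this.comp_hasDerivAt 0 hJ)
    have hc : Continuous (taylorCurve x) := (contDiff_taylorCurve x).continuous
    have hmem : ∀ᶠ t in 𝓝 (0 : ℝ), taylorCurve x t ∈ U :=
      hc.continuousAt.eventually (by rw [taylorCurve_zero]; exact hU.mem_nhds hx)
    have hev : ∀ᶠ t in 𝓝 (0 : ℝ), ∀ i : Fin (n + 1),
        iteratedDeriv i (τ ∘ taylorCurve x) t = jetMap τ (J t) i := by
      filter_upwards [hmem] with t ht i
      exact iteratedDeriv_comp_eq_jetMap (contDiff_taylorCurve x).contDiffAt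
        (hτ.contDiffAt (hU.mem_nhds ht)) i
    have h2 : HasDerivAt (iteratedDeriv j (τ ∘ taylorCurve x))
        (iteratedDeriv (j + 1) (τ ∘ taylorCurve x) 0) 0 := by
      refine hasDerivAt_iteratedDeriv (ContDiffAt.comp 0 ?_ (contDiff_taylorCurve x).contDiffAt) j
      rw [taylorCurve_zero]
      exact hτ.contDiffAt (hU.mem_nhds hx)
    have h3 := h1.unique (h2.congr_of_eventuallyEq (by
      filter_upwards [hev] with t ht
      rw [coord_of_lt (by omega), ← ht]))
    have h4 := hev.self_of_nhds ⟨j + 1, by omega⟩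
    rw [hJ0] at h4
    rw [h3, coord_of_lt (by omega)]
    exact h4
  fderiv_incl x hx j r hjr e := by
    have hO : IsOpen {q : Fin (n + 1) → E | q 0 ∈ U} := hU.preimage (continuous_apply 0)
    by_cases hj : j < n + 1
    swap
    · exact coord_of_gt (by omega) _
    have hT := (differentiableAt_of_contDiffOn hO (contDiffOn_jetMap hU hτ) hx).hasFDerivAt
    have h1 : HasDerivAt (fun t : ℝ => coord j (jetMap τ (x + t • incl r e) : Fin (n + 1) → E))
        (coord j (fderiv ℝ (jetMap τ) x (incl r e))) 0 :=
      (hasFDerivAt_clm_comp (coord j) hT).hasLineDerivAt (incl r e)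
    have h2 : (fun t : ℝ => coord j (jetMap τ (x + t • incl r e) : Fin (n + 1) → E)) =
        fun _ => coord j (jetMap τ x : Fin (n + 1) → E) := by
      funext t
      rw [coord_of_lt hj, coord_of_lt hj]
      refine jetMap_congr rfl fun i hi => ?_
      have hi' : i ≤ j := hi
      rw [map_add, map_smul, coord_incl_ne (by omega), smul_zero, add_zero]
    rw [h2] at h1
    exact h1.unique (hasDerivAt_const _ _)

end Prolongation

/-! ### Comparison of d_T on jet spaces of varying order with the derivative along the shift. -/

section Truncation

/-- The truncation `(q_0, …, q_n) ↦ (q_0, …, q_m)`. -/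
noncomputable def trunc (m : ℕ) : (Fin (n + 1) → E) →L[ℝ] (Fin (m + 1) → E) :=
  ContinuousLinearMap.pi fun i => coord i

theorem coord_trunc {j m : ℕ} (hj : j ≤ m) (x : Fin (n + 1) → E) :
    coord j (trunc m x) = coord j x := coord_of_lt (n := m) (by omega) _

theorem trunc_zero_apply {m : ℕ} (x : Fin (n + 1) → E) : trunc m x 0 = x 0 := coord_fin 0 x

theorem trunc_incl {j m : ℕ} (hj : j < m + 1) (hjn : j ≤ n) (e : E) :
    trunc m (incl j e : Fin (n + 1) → E) =
      ContinuousLinearMap.single ℝ (fun _ : Fin (m + 1) => E) ⟨j, hj⟩ e := by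
  have : ContinuousLinearMap.single ℝ (fun _ : Fin (m + 1) => E) ⟨j, hj⟩ e = incl j e := by
    simp [incl, hj]
  rw [this]
  refine ext_coord fun i hi => ?_
  rw [coord_trunc hi, coord_incl hjn, coord_incl (by omega)]

theorem jetMap_trunc {F : Type*} [NormedAddCommGroup F] [NormedSpace ℝ F] (τ : E → F) {m : ℕ}
    (hm : m ≤ n) (x : Fin (n + 1) → E) : jetMap τ (trunc m x) = trunc m (jetMap τ x) := by
  funext i
  change _ = coord i (jetMap τ x)
  rw [coord_of_lt (by omega)]
  refine jetMap_congr rfl fun j hj => ?_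
  exact coord_trunc (by omega) _

theorem totalDeriv_eq_fderiv {m : ℕ} (f : (Fin (m + 1) → E) → V) (q : Fin (m + 1 + 1) → E) :
    totalDeriv f q = fderiv ℝ f (fun j => q j.castSucc) fun j => q j.succ := by
  unfold totalDeriv partialDeriv
  simp only [ContinuousLinearMap.comp_apply]
  rw [← map_sum]
  congr 1
  exact Finset.univ_sum_single (fun j : Fin (m + 1) => q j.succ)

variable {U : Set E}

theorem contDiffOn_comp_trunc {m : ℕ} {f : (Fin (m + 1) → E) → V}
    (hf : ContDiffOn ℝ ∞ f {q | q 0 ∈ U}) :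
    ContDiffOn ℝ ∞ (fun x : Fin (n + 1) → E => f (trunc m x)) {q | q 0 ∈ U} :=
  hf.comp (trunc (E := E) (n := n) m).contDiff.contDiffOn fun x hx => by
    change trunc m x 0 ∈ U
    rwa [trunc_zero_apply]

theorem fderiv_comp_trunc (hU : IsOpen U) {m : ℕ} {f : (Fin (m + 1) → E) → V}
    (hf : ContDiffOn ℝ ∞ f {q | q 0 ∈ U}) {x : Fin (n + 1) → E} (hx : x 0 ∈ U) :
    fderiv ℝ (fun x : Fin (n + 1) → E => f (trunc m x)) x =
      (fderiv ℝ f (trunc m x)).comp (trunc m) := by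
  have h : DifferentiableAt ℝ f (trunc m x) :=
    differentiableAt_of_contDiffOn (hU.preimage (continuous_apply 0)) hf (by
      change trunc m x 0 ∈ U
      rwa [trunc_zero_apply])
  exact (h.hasFDerivAt.comp x (trunc (E := E) (n := n) m).hasFDerivAt).fderiv

theorem dependsUpTo_comp_trunc (hU : IsOpen U) {m : ℕ} {f : (Fin (m + 1) → E) → V}
    (hf : ContDiffOn ℝ ∞ f {q | q 0 ∈ U}) :
    DependsUpTo {q : Fin (n + 1) → E | q 0 ∈ U} (fun x => f (trunc m x)) m := by
  intro x hx w hw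
  have h0 : trunc m w = 0 := ext_coord fun j hj => by rw [coord_trunc hj, hw j hj, map_zero]
  rw [fderiv_comp_trunc hU hf hx, ContinuousLinearMap.comp_apply, h0, map_zero]

theorem contDiffOn_totalDerivIter (hU : IsOpen U) {m : ℕ} {f : (Fin (m + 1) → E) → V}
    (hf : ContDiffOn ℝ ∞ f {q | q 0 ∈ U}) (i : ℕ) :
    ContDiffOn ℝ ∞ (totalDerivIter f i) {q | q 0 ∈ U} := by
  induction i with
  | zero => exact hf
  | succ i ih =>
    have he : totalDerivIter f (i + 1) = fun q : Fin (m + i + 1 + 1) → E =>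
        fderiv ℝ (totalDerivIter f i) (fun j => q j.castSucc) fun j => q j.succ :=
      funext fun q => totalDeriv_eq_fderiv _ q
    rw [he]
    refine ContDiffOn.clm_apply ((contDiffOn_fderiv (hU.preimage (continuous_apply 0))
      ih).comp (s := {q : Fin (m + i + 1 + 1) → E | q 0 ∈ U})
      (g := fderiv ℝ (totalDerivIter f i)) (f := fun q j => q j.castSucc) ?_ ?_) ?_
    · fun_prop
    · intro q hq
      exact hq
    · fun_prop

/-- The truncated shift loses only q_{n+1}, which d_T would produce from a function of q_n; the
bound m + i ≤ n keeps the order below that. -/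
theorem totalDerivIter_trunc (hU : IsOpen U) {m : ℕ} {f : (Fin (m + 1) → E) → V}
    (hf : ContDiffOn ℝ ∞ f {q | q 0 ∈ U}) (i : ℕ) (hi : m + i ≤ n) :
    EqOn (fun x : Fin (n + 1) → E => totalDerivIter f i (trunc (m + i) x))
      (shiftDeriv^[i] fun x => f (trunc m x)) {q | q 0 ∈ U} := by
  induction i with
  | zero => intro x _; rfl
  | succ i ih =>
    intro x hx
    have hO : IsOpen {q : Fin (n + 1) → E | q 0 ∈ U} := hU.preimage (continuous_apply 0)
    rw [Function.iterate_succ_apply', shiftDeriv, ← fderiv_congr_of_eqOn hO (ih (by omega)) hx,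
      fderiv_comp_trunc hU (contDiffOn_totalDerivIter hU hf i) hx]
    change totalDeriv (totalDerivIter f i) _ = _
    rw [totalDeriv_eq_fderiv]
    have h1 : (fun j : Fin (m + i + 1) => trunc (m + i + 1) x j.castSucc) = trunc (m + i) x := rfl
    have h2 : (fun j : Fin (m + i + 1) => trunc (m + i + 1) x j.succ) =
        trunc (m + i) (shift x) := by
      funext j
      change coord (j + 1) x = coord j (shift x)
      rw [coord_shift]
    rw [ContinuousLinearMap.comp_apply]
    exact congrArg₂ (fun a b => fderiv ℝ (totalDerivIter f i) a b) h1 h2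

theorem contDiffOn_partialDeriv (hU : IsOpen U) {m : ℕ} {f : (Fin (m + 1) → E) → V}
    (hf : ContDiffOn ℝ ∞ f {q | q 0 ∈ U}) (j : Fin (m + 1)) :
    ContDiffOn ℝ ∞ (partialDeriv f j) {q | q 0 ∈ U} :=
  (contDiffOn_fderiv (hU.preimage (continuous_apply 0)) hf).clm_comp contDiffOn_const

theorem partialDeriv_trunc (hU : IsOpen U) {ℓ : (Fin (k + 1) → E) → ℝ}
    (hℓ : ContDiffOn ℝ ∞ ℓ {q | q 0 ∈ U}) {j : ℕ} (hj : j < k + 1) (hkn : k ≤ n) :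
    EqOn (fun x : Fin (n + 1) → E => partialDeriv ℓ ⟨j, hj⟩ (trunc k x))
      (slotDeriv (fun x => ℓ (trunc k x)) j) {q | q 0 ∈ U} := by
  intro x hx
  ext e
  rw [slotDeriv, fderiv_comp_trunc hU hℓ hx]
  simp only [partialDeriv, ContinuousLinearMap.comp_apply]
  rw [trunc_incl hj (by omega)]

theorem iterate_shiftDeriv_congr {O : Set (Fin (n + 1) → E)} (hO : IsOpen O)
    {f g : (Fin (n + 1) → E) → V} (h : EqOn f g O) (i : ℕ) :
    EqOn (shiftDeriv^[i] f) (shiftDeriv^[i] g) O := by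
  induction i with
  | zero => exact h
  | succ i ih =>
    intro x hx
    rw [Function.iterate_succ_apply', Function.iterate_succ_apply', shiftDeriv, shiftDeriv,
      fderiv_congr_of_eqOn hO ih hx]

theorem hess_trunc (hU : IsOpen U) {ℓ : (Fin (k + 1) → E) → ℝ}
    (hℓ : ContDiffOn ℝ ∞ ℓ {q | q 0 ∈ U}) (hkn : k ≤ n) {x : Fin (n + 1) → E} (hx : x 0 ∈ U)
    (u : E) : hess (fun x : Fin (n + 1) → E => ℓ (trunc k x)) k x u =
      partialDeriv (partialDeriv ℓ (Fin.last k)) (Fin.last k) (trunc k x) u := by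
  have hO : IsOpen {q : Fin (n + 1) → E | q 0 ∈ U} := hU.preimage (continuous_apply 0)
  rw [hess, ← fderiv_congr_of_eqOn hO (partialDeriv_trunc hU hℓ (Nat.lt_succ_self k) hkn) hx,
    fderiv_comp_trunc hU (contDiffOn_partialDeriv hU hℓ _) hx]
  simp only [partialDeriv, ContinuousLinearMap.comp_apply]
  rw [trunc_incl (Nat.lt_succ_self k) hkn]
  rfl

end Truncation

end JetSpace

/-! ### Natural charts of T^r Q, its projections and its Hausdorff property. -/

namespace HigherTangent

open JetSpace

theorem isOpen_target {E : Type*} [NormedAddCommGroup E] {Q : Type*} [TopologicalSpace Q] {r : ℕ}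
    (c : OpenPartialHomeomorph Q E) : IsOpen {q : Fin (r + 1) → E | q 0 ∈ c.target} :=
  c.open_target.preimage (continuous_apply 0)

variable {E : Type*} [NormedAddCommGroup E] [NormedSpace ℝ E]
variable {Q : Type*} [TopologicalSpace Q] [ChartedSpace E Q]

theorem base_proj {r s : ℕ} (h : s ≤ r) (p : HigherTangent E r Q) :
    base (proj h p) = base p := by
  obtain ⟨φ, rfl⟩ := exists_rep p
  rfl

variable [IsManifold 𝓘(ℝ, E) ∞ Q]
variable {r k : ℕ} {c c' : OpenPartialHomeomorph Q E}

/-- The natural chart of `T^r Q` induced by `c`, as an open partial homeomorphism. -/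
noncomputable def natChart (r : ℕ) (hc : c ∈ atlas E Q) :
    OpenPartialHomeomorph (HigherTangent E r Q) (Fin (r + 1) → E) :=
  (chartedSpaceCore E Q r).openPartialHomeomorph (naturalChart r c hc) ⟨c, hc, rfl⟩

theorem natChart_mem_atlas (hc : c ∈ atlas E Q) :
    natChart r hc ∈ atlas (Fin (r + 1) → E) (HigherTangent E r Q) := by
  simp only [atlas, ChartedSpace.atlas]
  exact mem_iUnion₂.2 ⟨naturalChart r c hc, ⟨c, hc, rfl⟩, rfl⟩

theorem natChart_mdifferentiable (hc : c ∈ atlas E Q) :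
    (natChart r hc).MDifferentiable 𝓘(ℝ, Fin (r + 1) → E) 𝓘(ℝ, Fin (r + 1) → E) := by
  have : IsManifold 𝓘(ℝ, Fin (r + 1) → E) 1 (HigherTangent E r Q) :=
    IsManifold.of_le (n := ∞) ENat.LEInfty.out
  exact mdifferentiable_of_mem_atlas (natChart_mem_atlas hc)

theorem isOpen_source (hc : c ∈ atlas E Q) :
    IsOpen {p : HigherTangent E r Q | base p ∈ c.source} := (natChart r hc).open_source

theorem coords_mem_target (hc : c ∈ atlas E Q) {p : HigherTangent E r Q}
    (hp : base p ∈ c.source) : coords c p 0 ∈ c.target := (natChart r hc).map_source hp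

theorem ofCoords_mem_source (hc : c ∈ atlas E Q) {q : Fin (r + 1) → E}
    (hq : q 0 ∈ c.target) : base (ofCoords c q : HigherTangent E r Q) ∈ c.source :=
  (natChart r hc).map_target hq

theorem contMDiffAt_coords (hc : c ∈ atlas E Q) {p : HigherTangent E r Q}
    (hp : base p ∈ c.source) :
    ContMDiffAt 𝓘(ℝ, Fin (r + 1) → E) 𝓘(ℝ, Fin (r + 1) → E) ∞ (coords c) p :=
  contMDiffAt_of_mem_maximalAtlas
    (IsManifold.subset_maximalAtlas (natChart_mem_atlas (r := r) hc)) hp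

theorem contMDiffAt_ofCoords (hc : c ∈ atlas E Q) {q : Fin (r + 1) → E}
    (hq : q 0 ∈ c.target) :
    ContMDiffAt 𝓘(ℝ, Fin (r + 1) → E) 𝓘(ℝ, Fin (r + 1) → E) ∞
      (ofCoords c : (Fin (r + 1) → E) → HigherTangent E r Q) q :=
  contMDiffAt_symm_of_mem_maximalAtlas
    (IsManifold.subset_maximalAtlas (natChart_mem_atlas (r := r) hc)) hq

/-- The differential of the natural coordinates. -/
noncomputable def dcoords (c : OpenPartialHomeomorph Q E) (p : HigherTangent E r Q) :
    TangentSpace 𝓘(ℝ, Fin (r + 1) → E) p →L[ℝ] (Fin (r + 1) → E) :=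
  mfderiv 𝓘(ℝ, Fin (r + 1) → E) 𝓘(ℝ, Fin (r + 1) → E) (coords c) p

theorem hasMFDerivAt_coords (hc : c ∈ atlas E Q) {p : HigherTangent E r Q}
    (hp : base p ∈ c.source) :
    HasMFDerivAt 𝓘(ℝ, Fin (r + 1) → E) 𝓘(ℝ, Fin (r + 1) → E) (coords c) p (dcoords c p) :=
  ((natChart_mdifferentiable hc).mdifferentiableAt hp).hasMFDerivAt

theorem dcoords_bijective (hc : c ∈ atlas E Q) {p : HigherTangent E r Q}
    (hp : base p ∈ c.source) : Function.Bijective (dcoords c p) :=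
  (natChart_mdifferentiable hc).mfderiv_bijective hp

theorem coords_eq_jetMap (hc : c ∈ atlas E Q) (hc' : c' ∈ atlas E Q) {p : HigherTangent E r Q}
    (hp : base p ∈ c.source) (hp' : base p ∈ c'.source) :
    coords c' p = jetMap (c' ∘ c.symm) (coords c p) := by
  have h0 := coords_zero hc p hp
  have := naturalChart_trans_eqOn r hc hc' (x := coords c p) (by
    simp only [mem_ofPred_eq, h0]
    simp [c.map_source hp, c.left_inv hp, hp'])
  rw [← this]
  change coords c' p = coords c' (ofCoords c (coords c p))
  rw [ofCoords_coords hc p hp]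

theorem coords_mem_transition (hc : c ∈ atlas E Q) {p : HigherTangent E r Q}
    (hp : base p ∈ c.source) (hp' : base p ∈ c'.source) :
    coords c p 0 ∈ (c.symm.trans c').source := by
  rw [coords_zero hc p hp]
  simp [c.map_source hp, c.left_inv hp, hp']

theorem dcoords_eq (hc : c ∈ atlas E Q) (hc' : c' ∈ atlas E Q) {p : HigherTangent E r Q}
    (hp : base p ∈ c.source) (hp' : base p ∈ c'.source)
    (w : TangentSpace 𝓘(ℝ, Fin (r + 1) → E) p) :
    dcoords c' p w = fderiv ℝ (jetMap (c' ∘ c.symm)) (coords c p) (dcoords c p w) := by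
  have hT := isProlongation_jetMap (n := r) (c.symm.trans c').open_source
    (contDiffOn_transition hc hc')
  have h1 := (hT.differentiableAt (coords_mem_transition hc hp hp')).hasFDerivAt.hasMFDerivAt
  have h2 := HasMFDerivAt.comp p h1 (hasMFDerivAt_coords hc hp)
  have h3 : coords c' =ᶠ[𝓝 p] jetMap (c' ∘ c.symm) ∘ coords c := by
    filter_upwards [(isOpen_source hc).mem_nhds hp, (isOpen_source hc').mem_nhds hp'] with y hy hy'
    exact coords_eq_jetMap hc hc' hy hy'
  have h4 := hasMFDerivAt_unique (hasMFDerivAt_coords hc' hp') (h2.congr_of_eventuallyEq h3)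
  rw [h4]
  rfl

theorem coords_proj {s : ℕ} (h : s ≤ r) (hc : c ∈ atlas E Q) (p : HigherTangent E r Q)
    (hp : base p ∈ c.source) : coords c (proj h p) = trunc s (coords c p) := by
  obtain ⟨φ, rfl⟩ := exists_rep p
  funext i
  change coords c (jet s φ) i = coord i (coords c (jet r φ))
  rw [coord_of_lt (by omega), coords_jet hc φ hp, coords_jet hc φ hp]

theorem contMDiff_proj {s : ℕ} (h : s ≤ r) :
    ContMDiff 𝓘(ℝ, Fin (r + 1) → E) 𝓘(ℝ, Fin (s + 1) → E) ∞
      (proj h : HigherTangent E r Q → HigherTangent E s Q) := by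
  intro p
  have hc := chart_mem_atlas E (base p)
  have hp := mem_chart_source E (base p)
  have h1 : ContMDiffAt 𝓘(ℝ, Fin (r + 1) → E) 𝓘(ℝ, Fin (s + 1) → E) ∞
      (fun p' => ofCoords (chartAt E (base p)) (trunc s (coords (chartAt E (base p)) p')) :
        HigherTangent E r Q → HigherTangent E s Q) p := by
    refine ContMDiffAt.comp p (contMDiffAt_ofCoords hc (q := trunc s (coords _ p)) ?_)
      ((trunc (E := E) (n := r) s).contDiff.contDiffAt.contMDiffAt.comp p
        (contMDiffAt_coords hc hp))
    rw [trunc_zero_apply]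
    exact coords_mem_target hc hp
  refine h1.congr_of_eventuallyEq ?_
  filter_upwards [(isOpen_source hc).mem_nhds hp] with y hy
  rw [← coords_proj h hc y hy, ofCoords_coords hc]
  rwa [base_proj]

theorem continuous_base : Continuous (base : HigherTangent E r Q → Q) := by
  rw [continuous_iff_continuousAt]
  intro p
  set c := chartAt E (base p)
  have hc : c ∈ atlas E Q := chart_mem_atlas E (base p)
  have hp : base p ∈ c.source := mem_chart_source E (base p)
  have h1 : ContinuousAt (fun p' : HigherTangent E r Q => c.symm (coords c p' 0)) p := by
    refine ContinuousAt.comp (f := fun p' : HigherTangent E r Q => coords c p' 0)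
      (c.symm.continuousAt (coords_mem_target hc hp)) ?_
    exact (continuous_apply 0).continuousAt.comp (f := coords c)
      (contMDiffAt_coords hc hp).continuousAt
  refine h1.congr ?_
  filter_upwards [(isOpen_source hc).mem_nhds hp] with y hy
  rw [coords_zero hc y hy, c.left_inv hy]

/-- Jets over distinct points are separated by `base`, jets over the same point by a common natural
chart. The Hausdorff property makes the coincidence set in `IsRelated.eqOn_section` closed. -/
instance instT2Space [T2Space Q] : T2Space (HigherTangent E r Q) := by
  refine ⟨fun p p' hne => ?_⟩
  by_cases hb : base p = base p'
  · let e : OpenPartialHomeomorph (HigherTangent E r Q) (Fin (r + 1) → E) :=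
      natChart r (chart_mem_atlas E (base p))
    have hp : p ∈ e.source := mem_chart_source E (base p)
    have hp' : p' ∈ e.source := by
      change base p' ∈ (chartAt E (base p)).source
      rw [hb]
      exact mem_chart_source E (base p')
    obtain ⟨u, v, hu, hv, hpu, hpv, huv⟩ := t2_separation fun h => hne (e.injOn hp hp' h)
    exact ⟨e.source ∩ e ⁻¹' u, e.source ∩ e ⁻¹' v, e.isOpen_inter_preimage hu,
      e.isOpen_inter_preimage hv, ⟨hp, hpu⟩, ⟨hp', hpv⟩,
      (huv.preimage e).mono inter_subset_right inter_subset_right⟩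
  · obtain ⟨u, v, hu, hv, hpu, hpv, huv⟩ := t2_separation hb
    exact ⟨base ⁻¹' u, base ⁻¹' v, hu.preimage continuous_base, hv.preimage continuous_base, hpu,
      hpv, huv.preimage base⟩

end HigherTangent

/-! ### The Poincaré–Cartan forms and the energy in arbitrary natural charts. -/

namespace HamiltonJacobi

open HigherTangent JetSpace

variable {E : Type*} [NormedAddCommGroup E] [NormedSpace ℝ E]
variable {Q : Type*} [TopologicalSpace Q] [ChartedSpace E Q]
variable {k : ℕ} {c c' : OpenPartialHomeomorph Q E} {L : HigherTangent E k Q → ℝ}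

/-- The Lagrangian in natural coordinates, as a function on the coordinates of `T^{2k-1} Q`. -/
noncomputable def chartLagrangian (L : HigherTangent E k Q → ℝ) (c : OpenPartialHomeomorph Q E)
    (x : Fin (2 * k - 1 + 1) → E) : ℝ := localLagrangian L c (trunc k x)

variable [IsManifold 𝓘(ℝ, E) ∞ Q]

theorem contDiffOn_localLagrangian (hL : ContMDiff 𝓘(ℝ, Fin (k + 1) → E) 𝓘(ℝ, ℝ) ∞ L)
    (hc : c ∈ atlas E Q) : ContDiffOn ℝ ∞ (localLagrangian L c) {q | q 0 ∈ c.target} := by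
  intro q hq
  exact ((hL _).comp q (contMDiffAt_ofCoords hc hq)).contDiffAt.contDiffWithinAt

theorem contDiffOn_chartLagrangian (hL : ContMDiff 𝓘(ℝ, Fin (k + 1) → E) 𝓘(ℝ, ℝ) ∞ L)
    (hc : c ∈ atlas E Q) : ContDiffOn ℝ ∞ (chartLagrangian L c) {q | q 0 ∈ c.target} :=
  contDiffOn_comp_trunc (contDiffOn_localLagrangian hL hc)

theorem dependsUpTo_chartLagrangian (hL : ContMDiff 𝓘(ℝ, Fin (k + 1) → E) 𝓘(ℝ, ℝ) ∞ L)
    (hc : c ∈ atlas E Q) : DependsUpTo {q | q 0 ∈ c.target} (chartLagrangian L c) k :=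
  dependsUpTo_comp_trunc c.open_target (contDiffOn_localLagrangian hL hc)

theorem momentum_eq_mom (hL : ContMDiff 𝓘(ℝ, Fin (k + 1) → E) 𝓘(ℝ, ℝ) ∞ L) (hc : c ∈ atlas E Q)
    (r : Fin k) {x : Fin (2 * k - 1 + 1) → E} (hx : x 0 ∈ c.target) :
    momentum L c r x = mom (chartLagrangian L c) k r x := by
  have hℓ := contDiffOn_localLagrangian hL hc
  have hO : IsOpen {q : Fin (2 * k - 1 + 1) → E | q 0 ∈ c.target} := isOpen_target c
  rw [momentum, mom, Finset.sum_range]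
  refine Finset.sum_congr rfl fun i _ => ?_
  congr 1
  have h1 : (fun j : Fin (k + i + 1) => x (Fin.castLE (by omega) j)) = trunc (k + i) x := by
    funext j
    exact (coord_of_lt (by omega) x).symm
  rw [h1]
  have h2 := totalDerivIter_trunc c.open_target (n := 2 * k - 1)
    (contDiffOn_partialDeriv c.open_target hℓ ⟨r + 1 + i, by omega⟩) i (by omega) hx
  exact h2.trans <| iterate_shiftDeriv_congr hO (partialDeriv_trunc c.open_target hℓ _ (by omega)) i hx

/-- Both sides evaluate L at the same k-jet, because the change of jet coordinates commutes with
truncation. -/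
theorem chartLagrangian_eq (hc : c ∈ atlas E Q) (hc' : c' ∈ atlas E Q) (hk : 1 ≤ k) :
    EqOn (chartLagrangian L c) (chartLagrangian L c' ∘ jetMap (c' ∘ c.symm))
      {q | q 0 ∈ (c.symm.trans c').source} := by
  intro x hx
  have hx' : x 0 ∈ c.target ∧ c.symm (x 0) ∈ c'.source := by simpa using hx
  have hy : trunc k x 0 ∈ c.target := by rw [trunc_zero_apply]; exact hx'.1
  have hb : base (ofCoords c (trunc k x) : HigherTangent E k Q) ∈ c'.source := by
    rw [base_ofCoords hc hy, trunc_zero_apply]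
    exact hx'.2
  rw [Function.comp_apply, chartLagrangian, chartLagrangian, localLagrangian, localLagrangian,
    ← jetMap_trunc _ (by omega)]
  have h := coords_eq_jetMap hc hc' (ofCoords_mem_source hc hy) hb
  rw [coords_ofCoords hc hy] at h
  rw [← h, ofCoords_coords hc' _ hb]

theorem mapsTo_transition (hc : c ∈ atlas E Q) (hc' : c' ∈ atlas E Q) {r : ℕ} :
    MapsTo (jetMap (c' ∘ c.symm) : (Fin (r + 1) → E) → Fin (r + 1) → E)
      {q | q 0 ∈ (c.symm.trans c').source} {q | q 0 ∈ c'.target} := by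
  intro x hx
  have hx' : x 0 ∈ c.target ∧ c.symm (x 0) ∈ c'.source := by simpa using hx
  have hb : base (ofCoords c x : HigherTangent E r Q) ∈ c'.source := by
    rw [base_ofCoords hc hx'.1]
    exact hx'.2
  have h := coords_eq_jetMap hc hc' (ofCoords_mem_source hc hx'.1) hb
  rw [coords_ofCoords hc hx'.1] at h
  rw [← h]
  exact coords_mem_target hc' hb

/-- The Poincaré–Cartan `1`-form in arbitrary natural coordinates. -/
theorem poincareCartanOneForm_apply (hk : 1 ≤ k)
    (hL : ContMDiff 𝓘(ℝ, Fin (k + 1) → E) 𝓘(ℝ, ℝ) ∞ L) (hc : c ∈ atlas E Q)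
    {p : HigherTangent E (2 * k - 1) Q} (hp : base p ∈ c.source)
    (w : TangentSpace 𝓘(ℝ, Fin (2 * k - 1 + 1) → E) p) :
    poincareCartanOneForm L p w = oneForm (chartLagrangian L c) k (coords c p) (dcoords c p w) := by
  have hc' : chartAt E (base p) ∈ atlas E Q := chart_mem_atlas E (base p)
  have hp' : base p ∈ (chartAt E (base p)).source := mem_chart_source E (base p)
  -- The preferred chart moves with p. Replacing it by a second chart c' reduces the claim to
  -- invariance under the transition from c to c'.
  generalize hgen : chartAt E (base p) = c' at hc' hp'
  have hT := isProlongation_jetMap (n := 2 * k - 1) (c.symm.trans c').open_source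
    (contDiffOn_transition hc hc')
  rw [hT.oneForm_eq (isOpen_target c') (mapsTo_transition hc hc') (by omega)
    (contDiffOn_chartLagrangian hL hc') (dependsUpTo_chartLagrangian hL hc')
    (chartLagrangian_eq hc hc' hk) (coords_mem_transition hc hp hp'), ← dcoords_eq hc hc' hp hp',
    ← coords_eq_jetMap hc hc' hp hp', oneForm_apply]
  simp only [poincareCartanOneForm, hgen]
  rw [sum_apply, Finset.sum_range]
  refine Finset.sum_congr rfl fun r _ => ?_
  rw [ContinuousLinearMap.comp_apply, momentum_eq_mom hL hc' r (coords_mem_target hc' hp')]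
  congr 1
  have h1 := HasMFDerivAt.comp p ((coord (E := E) (n := 2 * k - 1) r).hasFDerivAt
    (x := coords c' p)).hasMFDerivAt (hasMFDerivAt_coords hc' hp')
  have h2 : (coord (E := E) (n := 2 * k - 1) (r : ℕ)) ∘ coords c' =
      fun p' : HigherTangent E (2 * k - 1) Q => coords c' p' (Fin.castLE (by omega) r) :=
    funext fun p' => coord_of_lt (by omega) _
  rw [h2] at h1
  have h3 : dq c' (Fin.castLE (by omega) r) p = _ := h1.mfderiv
  rw [h3]
  rfl

/-- The energy in arbitrary natural coordinates. -/
theorem energy_eq (hk : 1 ≤ k)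
    (hL : ContMDiff 𝓘(ℝ, Fin (k + 1) → E) 𝓘(ℝ, ℝ) ∞ L) (hc : c ∈ atlas E Q)
    {p : HigherTangent E (2 * k - 1) Q} (hp : base p ∈ c.source) :
    energy hk L p = en (chartLagrangian L c) k (coords c p) := by
  have hc' : chartAt E (base p) ∈ atlas E Q := chart_mem_atlas E (base p)
  have hp' : base p ∈ (chartAt E (base p)).source := mem_chart_source E (base p)
  generalize hgen : chartAt E (base p) = c' at hc' hp'
  have hT := isProlongation_jetMap (n := 2 * k - 1) (c.symm.trans c').open_source
    (contDiffOn_transition hc hc')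
  rw [hT.en_eq (isOpen_target c') (mapsTo_transition hc hc') (by omega)
    (contDiffOn_chartLagrangian hL hc') (dependsUpTo_chartLagrangian hL hc')
    (chartLagrangian_eq hc hc' hk) (coords_mem_transition hc hp hp'),
    ← coords_eq_jetMap hc hc' hp hp', en, oneForm_apply]
  simp only [energy, hgen]
  congr 1
  · rw [Finset.sum_range]
    refine Finset.sum_congr rfl fun r _ => ?_
    rw [momentum_eq_mom hL hc' r (coords_mem_target hc' hp'), coord_shift, coord_of_lt (by omega)]
  · rw [chartLagrangian, localLagrangian, ← coords_proj (by omega) hc' p hp', ofCoords_coords hc']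
    rwa [base_proj]

/-- The energy is defined through a chart that varies with the point; `energy_eq` gives an
expression in the fixed chart c on a neighbourhood, which can be differentiated. -/
theorem hasMFDerivAt_energy (hk : 1 ≤ k)
    (hL : ContMDiff 𝓘(ℝ, Fin (k + 1) → E) 𝓘(ℝ, ℝ) ∞ L) (hc : c ∈ atlas E Q)
    {p : HigherTangent E (2 * k - 1) Q} (hp : base p ∈ c.source) :
    HasMFDerivAt 𝓘(ℝ, Fin (2 * k - 1 + 1) → E) 𝓘(ℝ, ℝ) (energy hk L) p
      ((fderiv ℝ (en (chartLagrangian L c) k) (coords c p)).comp (dcoords c p)) := by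
  have h1 := differentiableAt_of_contDiffOn (isOpen_target c)
    (contDiffOn_en (k := k) (isOpen_target c) (contDiffOn_chartLagrangian hL hc))
    (coords_mem_target hc hp)
  have h2 := HasMFDerivAt.comp p h1.hasFDerivAt.hasMFDerivAt (hasMFDerivAt_coords hc hp)
  refine h2.congr_of_eventuallyEq ?_
  filter_upwards [(isOpen_source hc).mem_nhds hp] with y hy
  exact energy_eq hk hL hc hy

/-- The Poincaré–Cartan `2`-form in arbitrary natural coordinates. -/
theorem poincareCartanTwoForm_apply (hk : 1 ≤ k)
    (hL : ContMDiff 𝓘(ℝ, Fin (k + 1) → E) 𝓘(ℝ, ℝ) ∞ L) (hc : c ∈ atlas E Q)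
    {p : HigherTangent E (2 * k - 1) Q} (hp : base p ∈ c.source)
    (v w : TangentSpace 𝓘(ℝ, Fin (2 * k - 1 + 1) → E) p) :
    poincareCartanTwoForm L p v w =
      twoForm (chartLagrangian L c) k (coords c p) (dcoords c p v) (dcoords c p w) := by
  have hc' : chartAt E (base p) ∈ atlas E Q := chart_mem_atlas E (base p)
  have hp' : base p ∈ (chartAt E (base p)).source := mem_chart_source E (base p)
  have hext : (extChartAt 𝓘(ℝ, Fin (2 * k - 1 + 1) → E) p : _ → _) =
      coords (chartAt E (base p)) := rfl
  have hexts : ((extChartAt 𝓘(ℝ, Fin (2 * k - 1 + 1) → E) p).symm : _ → _) =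
      ofCoords (chartAt E (base p)) := rfl
  generalize hgen : chartAt E (base p) = c' at hc' hp' hext hexts
  have hT := isProlongation_jetMap (n := 2 * k - 1) (c.symm.trans c').open_source
    (contDiffOn_transition hc hc')
  rw [hT.twoForm_eq (isOpen_target c') (mapsTo_transition hc hc') (by omega)
    (contDiffOn_chartLagrangian hL hc') (dependsUpTo_chartLagrangian hL hc')
    (chartLagrangian_eq hc hc' hk) (coords_mem_transition hc hp hp'), ← dcoords_eq hc hc' hp hp',
    ← dcoords_eq hc hc' hp hp', ← coords_eq_jetMap hc hc' hp hp']
  -- At nearby points θ is built from other preferred charts; its chart independence gives a single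
  -- formula around p.
  have h1 : readInChart (poincareCartanOneForm L) p =ᶠ[𝓝 (coords c' p)]
      oneForm (chartLagrangian L c') k := by
    filter_upwards [(isOpen_target c').mem_nhds (coords_mem_target hc' hp')] with x hx
    ext u
    rw [readInChart, hexts]
    refine (poincareCartanOneForm_apply hk hL hc' (ofCoords_mem_source hc' hx) _).trans ?_
    rw [coords_ofCoords hc' hx]
    have := (natChart_mdifferentiable (r := 2 * k - 1) hc').comp_symm_deriv hx
    exact congrArg _ (DFunLike.congr_fun this u)
  have h2 : poincareCartanTwoForm L p v w =
      -(fderiv ℝ (readInChart (poincareCartanOneForm L) p) (coords c' p) (dcoords c' p v)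
          (dcoords c' p w) -
        fderiv ℝ (readInChart (poincareCartanOneForm L) p) (coords c' p) (dcoords c' p w)
          (dcoords c' p v)) := by
    subst hgen
    rfl
  rw [h2, h1.fderiv_eq, twoForm_apply']
  ring

end HamiltonJacobi

/-! ### The Lagrangian vector field: existence, semispray property and smoothness. -/

namespace HamiltonJacobi

open HigherTangent JetSpace

variable {E : Type*} [NormedAddCommGroup E] [NormedSpace ℝ E]
variable {Q : Type*} [TopologicalSpace Q] [ChartedSpace E Q] [IsManifold 𝓘(ℝ, E) ∞ Q]
variable {k : ℕ} {c c' : OpenPartialHomeomorph Q E} {L : HigherTangent E k Q → ℝ}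

/-- The Poincaré–Cartan `2`-form of a regular Lagrangian is nondegenerate. -/
theorem poincareCartanTwoForm_nondegenerate (hk : 1 ≤ k)
    (hL : ContMDiff 𝓘(ℝ, Fin (k + 1) → E) 𝓘(ℝ, ℝ) ∞ L) (hreg : IsRegular L)
    {p : HigherTangent E (2 * k - 1) Q} {v : TangentSpace 𝓘(ℝ, Fin (2 * k - 1 + 1) → E) p}
    (hv : ∀ w, poincareCartanTwoForm L p v w = 0) : v = 0 := by
  have hc : chartAt E (base p) ∈ atlas E Q := chart_mem_atlas E (base p)
  have hp : base p ∈ (chartAt E (base p)).source := mem_chart_source E (base p)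
  refine (dcoords_bijective hc hp).1 ?_
  rw [map_zero]
  refine twoForm_nondegenerate (n := 2 * k - 1) (by omega) (isOpen_target (chartAt E (base p)))
    (contDiffOn_chartLagrangian hL hc) (dependsUpTo_chartLagrangian hL hc)
    (coords_mem_target hc hp) (fun u hu => ?_) fun w => ?_
  · refine hreg (proj (by omega) p) u fun e => ?_
    rw [base_proj, coords_proj (by omega) hc p hp, ← hess_trunc (n := 2 * k - 1)
      (chartAt E (base p)).open_target (contDiffOn_localLagrangian hL hc) (by omega)
      (coords_mem_target hc hp)]
    exact hu e
  · obtain ⟨w, rfl⟩ := (dcoords_bijective hc hp).2 w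
    rw [← poincareCartanTwoForm_apply hk hL hc hp]
    exact hv w

/-- `IsRegular` tests the Hessian only in preferred charts; passing through the intrinsic form ω
transfers nondegeneracy to any chart c. -/
theorem twoForm_chartLagrangian_nondegenerate (hk : 1 ≤ k)
    (hL : ContMDiff 𝓘(ℝ, Fin (k + 1) → E) 𝓘(ℝ, ℝ) ∞ L) (hreg : IsRegular L)
    (hc : c ∈ atlas E Q) {p : HigherTangent E (2 * k - 1) Q} (hp : base p ∈ c.source)
    (v : Fin (2 * k - 1 + 1) → E)
    (hv : ∀ w, twoForm (chartLagrangian L c) k (coords c p) v w = 0) : v = 0 := by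
  obtain ⟨v, rfl⟩ := (dcoords_bijective hc hp).2 v
  rw [poincareCartanTwoForm_nondegenerate hk hL hreg (v := v) fun w => ?_, map_zero]
  rw [poincareCartanTwoForm_apply hk hL hc hp]
  exact hv _

variable [FiniteDimensional ℝ E]

/-- `i(X_L) ω_L = dE_L`. -/
theorem lagrangianVectorField_spec (hk : 1 ≤ k)
    (hL : ContMDiff 𝓘(ℝ, Fin (k + 1) → E) 𝓘(ℝ, ℝ) ∞ L) (hreg : IsRegular L)
    (p : HigherTangent E (2 * k - 1) Q) (w : TangentSpace 𝓘(ℝ, Fin (2 * k - 1 + 1) → E) p) :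
    poincareCartanTwoForm L p (lagrangianVectorField hk L p) w =
      differential _ (energy hk L) p w := by
  have hc : chartAt E (base p) ∈ atlas E Q := chart_mem_atlas E (base p)
  have hp : base p ∈ (chartAt E (base p)).source := mem_chart_source E (base p)
  have hex : ∃ v, ∀ w, poincareCartanTwoForm L p v w = differential _ (energy hk L) p w := by
    obtain ⟨u, hu⟩ := (bijective_of_injective_dual
      (twoForm_chartLagrangian_nondegenerate hk hL hreg hc hp)).2
        (fderiv ℝ (en (chartLagrangian L (chartAt E (base p))) k) (coords (chartAt E (base p)) p))
    obtain ⟨v, rfl⟩ := (dcoords_bijective hc hp).2 u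
    refine ⟨v, fun w => ?_⟩
    rw [poincareCartanTwoForm_apply hk hL hc hp, hu, differential,
      (hasMFDerivAt_energy hk hL hc hp).mfderiv]
    rfl
  exact Classical.epsilon_spec hex w

theorem twoForm_dcoords_lagrangianVectorField (hk : 1 ≤ k)
    (hL : ContMDiff 𝓘(ℝ, Fin (k + 1) → E) 𝓘(ℝ, ℝ) ∞ L) (hreg : IsRegular L)
    (hc : c ∈ atlas E Q) {p : HigherTangent E (2 * k - 1) Q} (hp : base p ∈ c.source) :
    twoForm (chartLagrangian L c) k (coords c p) (dcoords c p (lagrangianVectorField hk L p)) =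
      fderiv ℝ (en (chartLagrangian L c) k) (coords c p) := by
  ext w
  obtain ⟨w, rfl⟩ := (dcoords_bijective hc hp).2 w
  rw [← poincareCartanTwoForm_apply hk hL hc hp, lagrangianVectorField_spec hk hL hreg,
    differential, (hasMFDerivAt_energy hk hL hc hp).mfderiv]
  rfl

/-- `X_L` is a semispray of type `1`. -/
theorem coord_dcoords_lagrangianVectorField (hk : 1 ≤ k)
    (hL : ContMDiff 𝓘(ℝ, Fin (k + 1) → E) 𝓘(ℝ, ℝ) ∞ L) (hreg : IsRegular L)
    (hc : c ∈ atlas E Q) {p : HigherTangent E (2 * k - 1) Q} (hp : base p ∈ c.source) {j : ℕ}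
    (hj : j < 2 * k - 1) :
    coord j (dcoords c p (lagrangianVectorField hk L p)) = coord (j + 1) (coords c p) :=
  coord_of_twoForm_eq (by omega) (isOpen_target c) (contDiffOn_chartLagrangian hL hc)
    (dependsUpTo_chartLagrangian hL hc) (coords_mem_target hc hp)
    (twoForm_chartLagrangian_nondegenerate hk hL hreg hc hp)
    (fun w => by rw [twoForm_dcoords_lagrangianVectorField hk hL hreg hc hp]) hj

/-- The vector field `X_L` in natural coordinates. -/
noncomputable def chartVectorField (L : HigherTangent E k Q → ℝ) (c : OpenPartialHomeomorph Q E)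
    (x : Fin (2 * k - 1 + 1) → E) : Fin (2 * k - 1 + 1) → E :=
  (twoForm (chartLagrangian L c) k x).inverse (fderiv ℝ (en (chartLagrangian L c) k) x)

theorem isInvertible_of_bijective {X Y : Type*} [NormedAddCommGroup X] [NormedSpace ℝ X]
    [NormedAddCommGroup Y] [NormedSpace ℝ Y] [FiniteDimensional ℝ X] {B : X →L[ℝ] Y}
    (hB : Function.Bijective B) : B.IsInvertible :=
  ⟨{ LinearEquiv.ofBijective B.toLinearMap hB with
      continuous_toFun := B.continuous
      continuous_invFun := by
        have : FiniteDimensional ℝ Y :=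
          (LinearEquiv.ofBijective B.toLinearMap hB).finiteDimensional
        exact LinearMap.continuous_of_finiteDimensional
          (LinearEquiv.ofBijective B.toLinearMap hB).symm.toLinearMap }, by ext; rfl⟩

theorem isInvertible_twoForm (hk : 1 ≤ k)
    (hL : ContMDiff 𝓘(ℝ, Fin (k + 1) → E) 𝓘(ℝ, ℝ) ∞ L) (hreg : IsRegular L)
    (hc : c ∈ atlas E Q) {p : HigherTangent E (2 * k - 1) Q} (hp : base p ∈ c.source) :
    (twoForm (chartLagrangian L c) k (coords c p)).IsInvertible :=
  isInvertible_of_bijective (bijective_of_injective_dual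
    (twoForm_chartLagrangian_nondegenerate hk hL hreg hc hp))

theorem dcoords_lagrangianVectorField (hk : 1 ≤ k)
    (hL : ContMDiff 𝓘(ℝ, Fin (k + 1) → E) 𝓘(ℝ, ℝ) ∞ L) (hreg : IsRegular L)
    (hc : c ∈ atlas E Q) {p : HigherTangent E (2 * k - 1) Q} (hp : base p ∈ c.source) :
    dcoords c p (lagrangianVectorField hk L p) = chartVectorField L c (coords c p) := by
  rw [chartVectorField, ← twoForm_dcoords_lagrangianVectorField hk hL hreg hc hp]
  exact ((isInvertible_twoForm hk hL hreg hc hp).inverse_apply_eq.2 rfl).symm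

/-- Inversion of operators is smooth at invertible ones, and ω and dE vary smoothly in the chart. -/
theorem contDiffAt_chartVectorField (hk : 1 ≤ k)
    (hL : ContMDiff 𝓘(ℝ, Fin (k + 1) → E) 𝓘(ℝ, ℝ) ∞ L) (hreg : IsRegular L)
    (hc : c ∈ atlas E Q) {p : HigherTangent E (2 * k - 1) Q} (hp : base p ∈ c.source) :
    ContDiffAt ℝ ∞ (chartVectorField L c) (coords c p) := by
  have hO : IsOpen {q : Fin (2 * k - 1 + 1) → E | q 0 ∈ c.target} := isOpen_target c
  have hx := hO.mem_nhds (coords_mem_target hc hp)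
  have hΛ := contDiffOn_chartLagrangian hL hc
  have : CompleteSpace (Fin (2 * k - 1 + 1) → E) := FiniteDimensional.complete ℝ _
  refine ContDiffAt.clm_apply ?_ ((contDiffOn_fderiv hO (contDiffOn_en hO hΛ)).contDiffAt hx)
  exact (isInvertible_twoForm hk hL hreg hc hp).contDiffAt_map_inverse.comp (coords c p)
    ((contDiffOn_twoForm hO hΛ).contDiffAt hx)

/-- `X_L` is smooth. -/
theorem contMDiff_lagrangianVectorField (hk : 1 ≤ k)
    (hL : ContMDiff 𝓘(ℝ, Fin (k + 1) → E) 𝓘(ℝ, ℝ) ∞ L) (hreg : IsRegular L) :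
    ContMDiff 𝓘(ℝ, Fin (2 * k - 1 + 1) → E) 𝓘(ℝ, Fin (2 * k - 1 + 1) → E).tangent 1
      (fun p : HigherTangent E (2 * k - 1) Q => (⟨p, lagrangianVectorField hk L p⟩ :
        TangentBundle 𝓘(ℝ, Fin (2 * k - 1 + 1) → E) (HigherTangent E (2 * k - 1) Q))) := by
  intro p
  have hc : chartAt E (base p) ∈ atlas E Q := chart_mem_atlas E (base p)
  have hp : base p ∈ (chartAt E (base p)).source := mem_chart_source E (base p)
  generalize chartAt E (base p) = c at hc hp
  have : CompleteSpace (Fin (2 * k - 1 + 1) → E) := FiniteDimensional.complete ℝ _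
  have hinv : ∀ p' : HigherTangent E (2 * k - 1) Q, base p' ∈ c.source →
      (mfderiv 𝓘(ℝ, Fin (2 * k - 1 + 1) → E) 𝓘(ℝ, Fin (2 * k - 1 + 1) → E)
        (coords c) p').IsInvertible := fun p' hp' =>
    ⟨(natChart_mdifferentiable hc).mfderiv hp', rfl⟩
  have h1 : ContMDiffAt 𝓘(ℝ, Fin (2 * k - 1 + 1) → E) 𝓘(ℝ, Fin (2 * k - 1 + 1) → E).tangent 1
      (fun x : Fin (2 * k - 1 + 1) → E => (⟨x, chartVectorField L c x⟩ :
        TangentBundle 𝓘(ℝ, Fin (2 * k - 1 + 1) → E) (Fin (2 * k - 1 + 1) → E))) (coords c p) :=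
    contMDiffAt_vectorSpace_iff_contDiffAt.2
      ((contDiffAt_chartVectorField hk hL hreg hc hp).of_le ENat.LEInfty.out)
  have : IsManifold 𝓘(ℝ, Fin (2 * k - 1 + 1) → E) (1 + 1) (HigherTangent E (2 * k - 1) Q) :=
    IsManifold.of_le (n := ∞) (by norm_num; exact ENat.LEInfty.out)
  -- Pulling the chart expression back along the coordinates yields a C^1 field, which coincides
  -- with X_L near p.
  have h2 := ContMDiffAt.mpullback_vectorField_preimage (n := 1 + 1) h1
    ((contMDiffAt_coords hc hp).of_le (by norm_num; exact ENat.LEInfty.out)) (hinv p hp) le_rfl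
  refine h2.congr_of_eventuallyEq ?_
  filter_upwards [(isOpen_source hc).mem_nhds hp] with y hy
  congr 1
  refine ((hinv y hy).inverse_apply_eq.2 ?_).symm
  exact (dcoords_lagrangianVectorField hk hL hreg hc hy).symm

end HamiltonJacobi

/-! ### Relatedness compared with assertions 1, 2 and 3. -/

namespace HamiltonJacobi

open HigherTangent JetSpace

section IntegralCurve

variable {F G : Type*} [NormedAddCommGroup F] [NormedSpace ℝ F] [NormedAddCommGroup G]
  [NormedSpace ℝ G]
variable {M N : Type*} [TopologicalSpace M] [ChartedSpace F M] [TopologicalSpace N]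
  [ChartedSpace G N]

theorem IsIntegralCurve.isMIntegralCurveAt {Z : ∀ p : M, TangentSpace 𝓘(ℝ, F) p} {γ : ℝ → M}
    {I : Set ℝ} (h : IsIntegralCurve Z γ I) {t : ℝ} (ht : t ∈ I) :
    IsMIntegralCurveAt (I := 𝓘(ℝ, F)) γ Z t :=
  h.2.2.isMIntegralCurveAt (h.1.mem_nhds ht)

theorem isIntegralCurve_iff {Z : ∀ p : M, TangentSpace 𝓘(ℝ, F) p} {γ : ℝ → M} {I : Set ℝ} :
    IsIntegralCurve Z γ I ↔ IsOpen I ∧ I.OrdConnected ∧ ∀ t ∈ I,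
      HasMFDerivAt 𝓘(ℝ, ℝ) 𝓘(ℝ, F) γ t ((1 : ℝ →L[ℝ] ℝ).smulRight (Z (γ t))) := by
  refine and_congr_right fun hI => and_congr_right fun _ => forall₂_congr fun t ht => ?_
  exact ⟨fun h => h.hasMFDerivAt (hI.mem_nhds ht), fun h => h.hasMFDerivWithinAt⟩

theorem exists_isIntegralCurve {Z : ∀ p : M, TangentSpace 𝓘(ℝ, F) p} {γ : ℝ → M} {t : ℝ}
    (h : IsMIntegralCurveAt (I := 𝓘(ℝ, F)) γ Z t) : ∃ I : Set ℝ, t ∈ I ∧ IsIntegralCurve Z γ I := by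
  obtain ⟨ε, hε, hγ⟩ := isMIntegralCurveAt_iff'.1 h
  exact ⟨Metric.ball t ε, Metric.mem_ball_self hε, Metric.isOpen_ball,
    (convex_ball t ε).ordConnected, hγ⟩

/-- The image of an integral curve under a map, at a point where the vector fields are related. -/
theorem hasMFDerivAt_comp_curve {Z : ∀ p : N, TangentSpace 𝓘(ℝ, G) p} {γ : ℝ → N} {t : ℝ}
    {f : N → M} (hf : MDifferentiableAt 𝓘(ℝ, G) 𝓘(ℝ, F) f (γ t))
    (h : HasMFDerivAt 𝓘(ℝ, ℝ) 𝓘(ℝ, G) γ t ((1 : ℝ →L[ℝ] ℝ).smulRight (Z (γ t)))) :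
    HasMFDerivAt 𝓘(ℝ, ℝ) 𝓘(ℝ, F) (f ∘ γ) t ((1 : ℝ →L[ℝ] ℝ).smulRight
      (mfderiv 𝓘(ℝ, G) 𝓘(ℝ, F) f (γ t) (Z (γ t)))) := by
  refine (HasMFDerivAt.comp t hf.hasMFDerivAt h).congr_mfderiv ?_
  ext
  exact map_smul (mfderiv 𝓘(ℝ, G) 𝓘(ℝ, F) f (γ t)) ((1 : ℝ →L[ℝ] ℝ) 1) (Z (γ t))

end IntegralCurve

variable {E : Type*} [NormedAddCommGroup E] [NormedSpace ℝ E]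
variable {Q : Type*} [TopologicalSpace Q] [ChartedSpace E Q] {k : ℕ}

theorem base_rho (p : HigherTangent E (2 * k - 1) Q) :
    base (rho p : HigherTangent E (k - 1) Q) = base p :=
  base_proj _ p

variable [IsManifold 𝓘(ℝ, E) ∞ Q]
variable {c : OpenPartialHomeomorph Q E} {L : HigherTangent E k Q → ℝ}
variable {s : HigherTangent E (k - 1) Q → HigherTangent E (2 * k - 1) Q}

theorem contMDiff_rho : ContMDiff 𝓘(ℝ, Fin (2 * k - 1 + 1) → E) 𝓘(ℝ, Fin (k - 1 + 1) → E) ∞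
    (rho : HigherTangent E (2 * k - 1) Q → HigherTangent E (k - 1) Q) :=
  contMDiff_proj (by omega)

theorem mdifferentiableAt_rho (p : HigherTangent E (2 * k - 1) Q) :
    MDifferentiableAt 𝓘(ℝ, Fin (2 * k - 1 + 1) → E) 𝓘(ℝ, Fin (k - 1 + 1) → E)
      (rho : HigherTangent E (2 * k - 1) Q → HigherTangent E (k - 1) Q) p :=
  (contMDiff_rho p).mdifferentiableAt (by simp)

theorem IsSmoothSection.mdifferentiableAt (hs : IsSmoothSection s) (y : HigherTangent E (k - 1) Q) :
    MDifferentiableAt 𝓘(ℝ, Fin (k - 1 + 1) → E) 𝓘(ℝ, Fin (2 * k - 1 + 1) → E) s y :=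
  (hs.smooth y).mdifferentiableAt (by simp)

theorem IsSmoothSection.base_eq (hs : IsSmoothSection s) (y : HigherTangent E (k - 1) Q) :
    base (s y) = base y := by
  rw [← base_rho, hs.rho_comp]

theorem IsSmoothSection.mfderiv_rho_mfderiv (hs : IsSmoothSection s)
    (y : HigherTangent E (k - 1) Q) (w : TangentSpace 𝓘(ℝ, Fin (k - 1 + 1) → E) y) :
    mfderiv 𝓘(ℝ, Fin (2 * k - 1 + 1) → E) 𝓘(ℝ, Fin (k - 1 + 1) → E)
      (rho : HigherTangent E (2 * k - 1) Q → HigherTangent E (k - 1) Q) (s y)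
      (mfderiv 𝓘(ℝ, Fin (k - 1 + 1) → E) 𝓘(ℝ, Fin (2 * k - 1 + 1) → E) s y w) = w := by
  have h1 := HasMFDerivAt.comp y (mdifferentiableAt_rho (s y)).hasMFDerivAt
    (hs.mdifferentiableAt y).hasMFDerivAt
  have h2 := hasMFDerivAt_unique (hasMFDerivAt_id (I := 𝓘(ℝ, Fin (k - 1 + 1) → E)) y)
    (h1.congr_of_eventuallyEq (Eventually.of_forall fun y' => (hs.rho_comp y').symm))
  exact (DFunLike.congr_fun h2 w).symm

theorem IsSmoothSection.mfderiv_injective (hs : IsSmoothSection s)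
    (y : HigherTangent E (k - 1) Q) : Function.Injective
      (mfderiv 𝓘(ℝ, Fin (k - 1 + 1) → E) 𝓘(ℝ, Fin (2 * k - 1 + 1) → E) s y) := by
  intro v w h
  rw [← hs.mfderiv_rho_mfderiv y v, h]
  exact hs.mfderiv_rho_mfderiv y w

theorem poincareCartanTwoForm_swap (p : HigherTangent E (2 * k - 1) Q)
    (v w : TangentSpace 𝓘(ℝ, Fin (2 * k - 1 + 1) → E) p) :
    poincareCartanTwoForm L p v w = -poincareCartanTwoForm L p w v := by
  simp [poincareCartanTwoForm, exteriorDeriv]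

/-- `X_L` and the vector field associated to `s` are `s`-related. -/
def IsRelated (hk : 1 ≤ k) (L : HigherTangent E k Q → ℝ)
    (s : HigherTangent E (k - 1) Q → HigherTangent E (2 * k - 1) Q) : Prop :=
  ∀ y, mfderiv 𝓘(ℝ, Fin (k - 1 + 1) → E) 𝓘(ℝ, Fin (2 * k - 1 + 1) → E) s y
    (associatedVectorField hk L s y) = lagrangianVectorField hk L (s y)

/-- Invariance of the image of a section is relatedness. -/
theorem hasInvariantImage_iff (hk : 1 ≤ k) (hs : IsSmoothSection s) :
    HasInvariantImage (Fin (2 * k - 1 + 1) → E) (Fin (k - 1 + 1) → E) s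
      (lagrangianVectorField hk L) ↔ IsRelated hk L s := by
  refine forall_congr' fun y => ⟨?_, fun h => ⟨_, h⟩⟩
  rintro ⟨u, hu⟩
  have hu' : mfderiv 𝓘(ℝ, Fin (k - 1 + 1) → E) 𝓘(ℝ, Fin (2 * k - 1 + 1) → E) s y u =
    lagrangianVectorField hk L (s y) := hu
  have h : associatedVectorField hk L s y = u := by
    rw [associatedVectorField, ← hu']
    exact hs.mfderiv_rho_mfderiv y u
  rw [h, hu']

theorem IsRelated.solvesGeneralizedHJ {hk : 1 ≤ k} (h : IsRelated hk L s)
    (hs : IsSmoothSection s) : SolvesGeneralizedHJ hk L s := by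
  intro γ I hγ
  rw [isIntegralCurve_iff] at hγ ⊢
  refine ⟨hγ.1, hγ.2.1, fun t ht => ?_⟩
  have := hasMFDerivAt_comp_curve (hs.mdifferentiableAt (γ t)) (hγ.2.2 t ht)
  rwa [h (γ t)] at this

theorem IsRelated.curvesLift {hk : 1 ≤ k} (h : IsRelated hk L s)
    (hs : IsSmoothSection s) : CurvesLift hk L s :=
  fun γ I _ hγ => ⟨s ∘ γ, ⟨γ 0, rfl⟩, h.solvesGeneralizedHJ hs γ I hγ, fun t _ =>
    hs.rho_comp (γ t)⟩

variable [FiniteDimensional ℝ E]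

/-- The image of a section with `s^* ω_L = 0` is Lagrangian. -/
theorem hasLagrangianImage (hk : 1 ≤ k) (hL : ContMDiff 𝓘(ℝ, Fin (k + 1) → E) 𝓘(ℝ, ℝ) ∞ L)
    (hreg : IsRegular L) (hs : IsSmoothSection s) (hω : PullbackVanishes L s) :
    HasLagrangianImage (Fin (2 * k - 1 + 1) → E) (Fin (k - 1 + 1) → E) s
      (poincareCartanTwoForm L) where
  smooth := hs.smooth
  isEmbedding := Function.LeftInverse.isEmbedding hs.rho_comp contMDiff_rho.continuous
    hs.smooth.continuous
  immersion := hs.mfderiv_injective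
  lagrangian y := by
    have : FiniteDimensional ℝ (TangentSpace 𝓘(ℝ, Fin (2 * k - 1 + 1) → E) (s y)) :=
      inferInstanceAs (FiniteDimensional ℝ (Fin (2 * k - 1 + 1) → E))
    have hle : imageTangentSpace (Fin (2 * k - 1 + 1) → E) (Fin (k - 1 + 1) → E) s y ≤
        (poincareCartanTwoForm L (s y)).orthogonal
          (imageTangentSpace (Fin (2 * k - 1 + 1) → E) (Fin (k - 1 + 1) → E) s y) := by
      rintro _ ⟨w, rfl⟩
      rw [LinearMap.BilinForm.mem_orthogonal_iff]
      rintro _ ⟨v, rfl⟩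
      exact LinearMap.congr_fun₂ (hω y) v w
    have hrefl : (poincareCartanTwoForm L (s y)).IsRefl := fun v w h => by
      rw [poincareCartanTwoForm_swap, h, neg_zero]
    have hnd : (poincareCartanTwoForm L (s y)).Nondegenerate :=
      hrefl.nondegenerate_iff_separatingLeft.2 fun v hv =>
        poincareCartanTwoForm_nondegenerate hk hL hreg hv
    -- Isotropy is `hω`. The image has dimension k · dim E and its orthogonal 2k · dim E - k · dim
    -- E, so the inclusion is an equality.
    refine (Submodule.eq_of_le_of_finrank_eq hle ?_).symm
    have h1 : Module.finrank ℝ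
        (imageTangentSpace (Fin (2 * k - 1 + 1) → E) (Fin (k - 1 + 1) → E) s y) =
        Module.finrank ℝ (Fin (k - 1 + 1) → E) :=
      LinearMap.finrank_range_of_inj (hs.mfderiv_injective y)
    have h2 := LinearMap.BilinForm.finrank_orthogonal hnd
      (imageTangentSpace (Fin (2 * k - 1 + 1) → E) (Fin (k - 1 + 1) → E) s y)
    have h3 : Module.finrank ℝ (TangentSpace 𝓘(ℝ, Fin (2 * k - 1 + 1) → E) (s y)) =
        Module.finrank ℝ (Fin (2 * k - 1 + 1) → E) := rfl
    rw [h2, h1, h3]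
    simp only [Module.finrank_pi_fintype, Finset.sum_const, Finset.card_univ, Fintype.card_fin,
      smul_eq_mul]
    rw [← Nat.sub_mul]
    congr 1
    omega

/-- The chain rule followed by i(X_L)ω = dE. This turns assertion 2 into orthogonality of X_L to the
tangent spaces of Im(s). -/
theorem differential_comp_apply (hk : 1 ≤ k)
    (hL : ContMDiff 𝓘(ℝ, Fin (k + 1) → E) 𝓘(ℝ, ℝ) ∞ L)
    (hreg : IsRegular L) (hs : IsSmoothSection s) (y : HigherTangent E (k - 1) Q)
    (w : TangentSpace 𝓘(ℝ, Fin (k - 1 + 1) → E) y) :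
    differential (Fin (k - 1 + 1) → E) (energy hk L ∘ s) y w =
      poincareCartanTwoForm L (s y) (lagrangianVectorField hk L (s y))
        (mfderiv 𝓘(ℝ, Fin (k - 1 + 1) → E) 𝓘(ℝ, Fin (2 * k - 1 + 1) → E) s y w) := by
  have h := hasMFDerivAt_energy hk hL (chart_mem_atlas E (base (s y)))
    (mem_chart_source E (base (s y)))
  rw [lagrangianVectorField_spec hk hL hreg, differential, differential, h.mfderiv,
    (HasMFDerivAt.comp y h (hs.mdifferentiableAt y).hasMFDerivAt).mfderiv]
  rfl

/-- For a section with `s^* ω_L = 0`, relatedness is closedness of `s^* E_L`. -/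
theorem differential_eq_zero_iff (hk : 1 ≤ k)
    (hL : ContMDiff 𝓘(ℝ, Fin (k + 1) → E) 𝓘(ℝ, ℝ) ∞ L)
    (hreg : IsRegular L) (hs : IsSmoothSection s) (hω : PullbackVanishes L s) :
    (∀ y, differential (Fin (k - 1 + 1) → E) (energy hk L ∘ s) y = 0) ↔ IsRelated hk L s := by
  rw [← hasInvariantImage_iff hk hs]
  refine forall_congr' fun y => ?_
  rw [← (hasLagrangianImage hk hL hreg hs hω).lagrangian y, LinearMap.BilinForm.mem_orthogonal_iff,
    ContinuousLinearMap.ext_iff]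
  constructor
  · rintro h _ ⟨w, rfl⟩
    have := h w
    rw [differential_comp_apply hk hL hreg hs] at this
    exact (poincareCartanTwoForm_swap _ _ _).trans (neg_eq_zero.2 this)
  · intro h w
    rw [differential_comp_apply hk hL hreg hs, poincareCartanTwoForm_swap, neg_eq_zero.2]
    · rfl
    · exact h _ ⟨w, rfl⟩

/-- All tangent spaces are the model F by definition, so a vector can be carried between equal base
points. It is needed because Tρ(X_L(s y)) sits over ρ(s y), which equals y only propositionally. -/
theorem totalSpace_mk_eq {F : Type*} [NormedAddCommGroup F] [NormedSpace ℝ F]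
    {M : Type*} [TopologicalSpace M] [ChartedSpace F M] {p q : M} (h : p = q) (v : F) :
    (⟨p, v⟩ : TangentBundle 𝓘(ℝ, F) M) = ⟨q, v⟩ := by
  subst h
  rfl

/-- The vector field associated to a section is smooth. -/
theorem contMDiff_associatedVectorField (hk : 1 ≤ k)
    (hL : ContMDiff 𝓘(ℝ, Fin (k + 1) → E) 𝓘(ℝ, ℝ) ∞ L) (hreg : IsRegular L)
    (hs : IsSmoothSection s) :
    ContMDiff 𝓘(ℝ, Fin (k - 1 + 1) → E) 𝓘(ℝ, Fin (k - 1 + 1) → E).tangent 1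
      (fun y : HigherTangent E (k - 1) Q => (⟨y, associatedVectorField hk L s y⟩ :
        TangentBundle 𝓘(ℝ, Fin (k - 1 + 1) → E) (HigherTangent E (k - 1) Q))) := by
  have : IsManifold 𝓘(ℝ, Fin (k - 1 + 1) → E) 1 (HigherTangent E (k - 1) Q) :=
    IsManifold.of_le (n := ∞) ENat.LEInfty.out
  have : IsManifold 𝓘(ℝ, Fin (2 * k - 1 + 1) → E) 1 (HigherTangent E (2 * k - 1) Q) :=
    IsManifold.of_le (n := ∞) ENat.LEInfty.out
  have h1 := ((contMDiff_rho (E := E) (Q := Q) (k := k)).contMDiff_tangentMap (m := 1)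
    (by norm_num; exact ENat.LEInfty.out)).comp
    ((contMDiff_lagrangianVectorField hk hL hreg).comp (hs.smooth.of_le ENat.LEInfty.out))
  convert h1 using 1
  funext y
  exact totalSpace_mk_eq (hs.rho_comp y).symm _

theorem exists_isMIntegralCurveAt_associated (hk : 1 ≤ k)
    (hL : ContMDiff 𝓘(ℝ, Fin (k + 1) → E) 𝓘(ℝ, ℝ) ∞ L) (hreg : IsRegular L)
    (hs : IsSmoothSection s) (y : HigherTangent E (k - 1) Q) (t : ℝ) :
    ∃ γ : ℝ → HigherTangent E (k - 1) Q, γ t = y ∧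
      IsMIntegralCurveAt (I := 𝓘(ℝ, Fin (k - 1 + 1) → E)) γ (associatedVectorField hk L s) t := by
  have : CompleteSpace (Fin (k - 1 + 1) → E) := FiniteDimensional.complete ℝ _
  have : IsManifold 𝓘(ℝ, Fin (k - 1 + 1) → E) 1 (HigherTangent E (k - 1) Q) :=
    IsManifold.of_le (n := ∞) ENat.LEInfty.out
  exact exists_isMIntegralCurveAt_of_contMDiffAt_boundaryless t
    (contMDiff_associatedVectorField hk hL hreg hs y)

theorem exists_isMIntegralCurveAt_lagrangian (hk : 1 ≤ k)
    (hL : ContMDiff 𝓘(ℝ, Fin (k + 1) → E) 𝓘(ℝ, ℝ) ∞ L) (hreg : IsRegular L)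
    (p : HigherTangent E (2 * k - 1) Q) (t : ℝ) :
    ∃ ψ : ℝ → HigherTangent E (2 * k - 1) Q, ψ t = p ∧
      IsMIntegralCurveAt (I := 𝓘(ℝ, Fin (2 * k - 1 + 1) → E)) ψ (lagrangianVectorField hk L) t := by
  have : CompleteSpace (Fin (2 * k - 1 + 1) → E) := FiniteDimensional.complete ℝ _
  have : IsManifold 𝓘(ℝ, Fin (2 * k - 1 + 1) → E) 1 (HigherTangent E (2 * k - 1) Q) :=
    IsManifold.of_le (n := ∞) ENat.LEInfty.out
  exact exists_isMIntegralCurveAt_of_contMDiffAt_boundaryless t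
    (contMDiff_lagrangianVectorField hk hL hreg p)

theorem smulRight_one_injective {V : Type*} [AddCommGroup V] [Module ℝ V] [TopologicalSpace V]
    [ContinuousSMul ℝ V] {v w : V}
    (h : (1 : ℝ →L[ℝ] ℝ).smulRight v = (1 : ℝ →L[ℝ] ℝ).smulRight w) : v = w := by
  simpa using DFunLike.congr_fun h 1

/-- Take an integral curve γ of X through y. The velocity of s ∘ γ there is Ts(X(y)) by the chain
rule and X_L(s y) by hypothesis. -/
theorem SolvesGeneralizedHJ.isRelated {hk : 1 ≤ k} (h : SolvesGeneralizedHJ hk L s)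
    (hL : ContMDiff 𝓘(ℝ, Fin (k + 1) → E) 𝓘(ℝ, ℝ) ∞ L) (hreg : IsRegular L)
    (hs : IsSmoothSection s) : IsRelated hk L s := by
  intro y
  obtain ⟨γ, rfl, hγ⟩ := exists_isMIntegralCurveAt_associated hk hL hreg hs y 0
  obtain ⟨I, h0, hI⟩ := exists_isIntegralCurve hγ
  have h1 := (isIntegralCurve_iff.1 (h γ I hI)).2.2 0 h0
  have h2 := hasMFDerivAt_comp_curve (hs.mdifferentiableAt (γ 0))
    ((isIntegralCurve_iff.1 hI).2.2 0 h0)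
  exact smulRight_one_injective (hasMFDerivAt_unique (f := s ∘ γ) h2 h1)

end HamiltonJacobi

/-! ### Relatedness compared with projection of integral curves. -/

namespace HamiltonJacobi

open HigherTangent JetSpace

variable {E : Type*} [NormedAddCommGroup E] [NormedSpace ℝ E] [FiniteDimensional ℝ E]
variable {Q : Type*} [TopologicalSpace Q] [ChartedSpace E Q] [IsManifold 𝓘(ℝ, E) ∞ Q]
variable {k : ℕ} {c : OpenPartialHomeomorph Q E} {L : HigherTangent E k Q → ℝ}
variable {s : HigherTangent E (k - 1) Q → HigherTangent E (2 * k - 1) Q} {hk : 1 ≤ k}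

/-- If `X_L` is tangent to `Im(s)`, integral curves of `X_L` meeting `Im(s)` stay in `Im(s)`. -/
theorem IsRelated.eqOn_section [T2Space Q] (h : IsRelated hk L s)
    (hL : ContMDiff 𝓘(ℝ, Fin (k + 1) → E) 𝓘(ℝ, ℝ) ∞ L) (hreg : IsRegular L)
    (hs : IsSmoothSection s) {ψ : ℝ → HigherTangent E (2 * k - 1) Q} {I : Set ℝ}
    (hψ : IsIntegralCurve (lagrangianVectorField hk L) ψ I) (h0 : 0 ∈ I) (hψ0 : ψ 0 ∈ range s) :
    EqOn ψ (fun t => s (rho (ψ t))) I := by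
  have : IsManifold 𝓘(ℝ, Fin (2 * k - 1 + 1) → E) 1 (HigherTangent E (2 * k - 1) Q) :=
    IsManifold.of_le (n := ∞) ENat.LEInfty.out
  have hsub : I ⊆ {t | t ∈ I ∧ ψ t = s (rho (ψ t))} := by
    -- The set of times at which ψ lies on Im(s) is open, meets the interval at 0 and is relatively
    -- closed, so it is the whole interval.
    refine hψ.2.1.isPreconnected.subset_of_closure_inter_subset ?_ ?_ ?_
    · rw [isOpen_iff_mem_nhds]
      rintro t ⟨ht, he⟩
      -- Openness: by relatedness s ∘ γ is an integral curve of X_L with the value ψ t at time t, so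
      -- local uniqueness identifies it with ψ.
      obtain ⟨γ, hγt, hγ⟩ := exists_isMIntegralCurveAt_associated hk hL hreg hs (rho (ψ t)) t
      have h1 : IsMIntegralCurveAt (I := 𝓘(ℝ, Fin (2 * k - 1 + 1) → E)) (s ∘ γ)
          (lagrangianVectorField hk L) t := by
        filter_upwards [hγ] with t' ht'
        have := hasMFDerivAt_comp_curve (hs.mdifferentiableAt (γ t')) ht'
        rwa [h (γ t')] at this
      have h2 := isMIntegralCurveAt_eventuallyEq_of_contMDiffAt_boundaryless
        (contMDiff_lagrangianVectorField hk hL hreg (ψ t)) (hψ.isMIntegralCurveAt ht) h1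
        (by rw [Function.comp_apply, hγt]; exact he)
      filter_upwards [h2, hψ.1.mem_nhds ht] with t' ht' htI
      refine ⟨htI, ?_⟩
      rw [ht', Function.comp_apply, hs.rho_comp]
    · obtain ⟨y, hy⟩ := hψ0
      exact ⟨0, h0, h0, by rw [← hy, hs.rho_comp]⟩
    · rintro t ⟨htc, ht⟩
      have hc : ContinuousAt ψ t := (hψ.isMIntegralCurveAt ht).continuousAt
      have hc' : ContinuousAt (fun t => s (rho (ψ t))) t :=
        (hs.smooth.continuous.comp contMDiff_rho.continuous).continuousAt.comp hc
      refine ⟨ht, tendsto_nhds_unique_of_frequently_eq hc hc' ?_⟩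
      exact (mem_closure_iff_frequently.1 htc).mono fun t' ht' => ht'.2
  exact fun t ht => (hsub ht).2

theorem IsRelated.curvesProject [T2Space Q] (h : IsRelated hk L s)
    (hL : ContMDiff 𝓘(ℝ, Fin (k + 1) → E) 𝓘(ℝ, ℝ) ∞ L) (hreg : IsRegular L)
    (hs : IsSmoothSection s) : CurvesProject hk L s := by
  intro ψ I h0 hψ0 hψ
  have he := h.eqOn_section hL hreg hs hψ h0 hψ0
  have hψ' := isIntegralCurve_iff.1 hψ
  refine isIntegralCurve_iff.2 ⟨hψ.1, hψ.2.1, fun t ht => ?_⟩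
  have h1 := hasMFDerivAt_comp_curve (mdifferentiableAt_rho (ψ t)) (hψ'.2.2 t ht)
  -- The two values of Tρ ∘ X_L lie in formally different tangent spaces; they are compared in the
  -- common model space, where p = q can be substituted.
  have key : ∀ p q : HigherTangent E (2 * k - 1) Q, p = q →
      (mfderiv 𝓘(ℝ, Fin (2 * k - 1 + 1) → E) 𝓘(ℝ, Fin (k - 1 + 1) → E)
        (rho : HigherTangent E (2 * k - 1) Q → HigherTangent E (k - 1) Q) p
        (lagrangianVectorField hk L p) : Fin (k - 1 + 1) → E) =
      mfderiv 𝓘(ℝ, Fin (2 * k - 1 + 1) → E) 𝓘(ℝ, Fin (k - 1 + 1) → E)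
        (rho : HigherTangent E (2 * k - 1) Q → HigherTangent E (k - 1) Q) q
        (lagrangianVectorField hk L q) := by
    rintro p _ rfl
    rfl
  refine h1.congr_mfderiv ?_
  exact congrArg (fun v : Fin (k - 1 + 1) → E => (1 : ℝ →L[ℝ] ℝ).smulRight v) (key _ _ (he ht))

theorem CurvesProject.exists_curve (h : CurvesProject hk L s)
    (hL : ContMDiff 𝓘(ℝ, Fin (k + 1) → E) 𝓘(ℝ, ℝ) ∞ L) (hreg : IsRegular L)
    (y : HigherTangent E (k - 1) Q) : ∃ ψ : ℝ → HigherTangent E (2 * k - 1) Q, ψ 0 = s y ∧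
      IsMIntegralCurveAt (I := 𝓘(ℝ, Fin (2 * k - 1 + 1) → E)) ψ (lagrangianVectorField hk L) 0 ∧
      IsMIntegralCurveAt (I := 𝓘(ℝ, Fin (k - 1 + 1) → E)) (fun t => rho (ψ t))
        (associatedVectorField hk L s) 0 := by
  obtain ⟨ψ, hψ0, hψ⟩ := exists_isMIntegralCurveAt_lagrangian hk hL hreg (s y) 0
  obtain ⟨I, h0, hI⟩ := exists_isIntegralCurve hψ
  exact ⟨ψ, hψ0, hψ, (h ψ I h0 ⟨y, hψ0.symm⟩ hI).isMIntegralCurveAt h0⟩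

/-- Along integral curves of `X_L`, the coordinate `q_{j+1}` is the derivative of `q_j`. -/
theorem hasDerivAt_coord (hL : ContMDiff 𝓘(ℝ, Fin (k + 1) → E) 𝓘(ℝ, ℝ) ∞ L)
    (hreg : IsRegular L) (hc : c ∈ atlas E Q) {ψ : ℝ → HigherTangent E (2 * k - 1) Q} {t : ℝ}
    (hψ : HasMFDerivAt 𝓘(ℝ, ℝ) 𝓘(ℝ, Fin (2 * k - 1 + 1) → E) ψ t
      ((1 : ℝ →L[ℝ] ℝ).smulRight (lagrangianVectorField hk L (ψ t))))
    (hp : base (ψ t) ∈ c.source) {j : ℕ} (hj : j < 2 * k - 1) :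
    HasDerivAt (fun t => coord j (coords c (ψ t))) (coord (j + 1) (coords c (ψ t))) t := by
  have h1 := hasMFDerivAt_comp_curve (hasMFDerivAt_coords hc hp).mdifferentiableAt hψ
  have h2 := hasMFDerivAt_iff_hasFDerivAt.1 h1
  have h3 : HasDerivAt (coords c ∘ ψ) (dcoords c (ψ t) (lagrangianVectorField hk L (ψ t))) t := h2
  have h4 := (coord (E := E) (n := 2 * k - 1) j).hasFDerivAt.comp_hasDerivAt t h3
  rwa [coord_dcoords_lagrangianVectorField hk hL hreg hc hp hj] at h4

/-- Put f = q_j ∘ s. If q_j(ψ) = f(ρ ∘ ψ) near 0, differentiation gives q_{j+1}(ψ) = df(X)(ρ ∘ ψ):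
on the left X_L is a semispray, on the right ρ ∘ ψ is an integral curve of X. At time 0 of a curve
starting from s y this reads q_{j+1}(s y) = df(X)(y), for every y over the chart; inserting y = ρ(ψ
t) completes the induction. -/
theorem CurvesProject.eventually_coord_eq (h : CurvesProject hk L s)
    (hL : ContMDiff 𝓘(ℝ, Fin (k + 1) → E) 𝓘(ℝ, ℝ) ∞ L) (hreg : IsRegular L)
    (hs : IsSmoothSection s) (hc : c ∈ atlas E Q) {j : ℕ} (hj : j ≤ 2 * k - 1)
    {ψ : ℝ → HigherTangent E (2 * k - 1) Q} (hψ0 : ψ 0 ∈ range s) (hb : base (ψ 0) ∈ c.source)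
    (hψ : IsMIntegralCurveAt (I := 𝓘(ℝ, Fin (2 * k - 1 + 1) → E)) ψ
      (lagrangianVectorField hk L) 0)
    (hρψ : IsMIntegralCurveAt (I := 𝓘(ℝ, Fin (k - 1 + 1) → E)) (fun t => rho (ψ t))
      (associatedVectorField hk L s) 0) :
    ∀ᶠ t in 𝓝 (0 : ℝ), coord j (coords c (ψ t)) = coord j (coords c (s (rho (ψ t)))) := by
  have hsrc : ∀ {ψ : ℝ → HigherTangent E (2 * k - 1) Q}, base (ψ 0) ∈ c.source →
      IsMIntegralCurveAt (I := 𝓘(ℝ, Fin (2 * k - 1 + 1) → E)) ψ (lagrangianVectorField hk L) 0 →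
      ∀ᶠ t in 𝓝 (0 : ℝ), base (ψ t) ∈ c.source := fun hb hψ =>
    hψ.continuousAt.eventually ((isOpen_source hc).mem_nhds hb)
  -- The curve is generalized because the inductive step also uses curves starting from other points
  -- of Im(s).
  induction j generalizing ψ with
  | zero =>
    filter_upwards [hsrc hb hψ] with t ht
    have ht' : base (s (rho (ψ t))) ∈ c.source := by rwa [hs.base_eq, base_rho]
    rw [coord_of_lt (by omega), coord_of_lt (by omega)]
    change coords c (ψ t) 0 = coords c (s (rho (ψ t))) 0
    rw [coords_zero hc _ ht, coords_zero hc _ ht', hs.base_eq, base_rho]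
  | succ j ih =>
    set f : HigherTangent E (k - 1) Q → E := fun y => coord j (coords c (s y)) with hf
    have hfd : ∀ y, base y ∈ c.source →
        MDifferentiableAt 𝓘(ℝ, Fin (k - 1 + 1) → E) 𝓘(ℝ, E) f y := by
      intro y hy
      have h1 := HasMFDerivAt.comp y (hasMFDerivAt_coords hc (by rwa [hs.base_eq]))
        (hs.mdifferentiableAt y).hasMFDerivAt
      exact (HasMFDerivAt.comp y ((coord (E := E) (n := 2 * k - 1) j).hasFDerivAt
        (x := coords c (s y))).hasMFDerivAt h1).mdifferentiableAt
    have key : ∀ {ψ : ℝ → HigherTangent E (2 * k - 1) Q} (_ : ψ 0 ∈ range s)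
        (_ : base (ψ 0) ∈ c.source) (_ : IsMIntegralCurveAt (I := 𝓘(ℝ, Fin (2 * k - 1 + 1) → E)) ψ
          (lagrangianVectorField hk L) 0)
        (_ : IsMIntegralCurveAt (I := 𝓘(ℝ, Fin (k - 1 + 1) → E)) (fun t => rho (ψ t))
          (associatedVectorField hk L s) 0),
        ∀ᶠ t in 𝓝 (0 : ℝ), coord (j + 1) (coords c (ψ t)) =
          mfderiv 𝓘(ℝ, Fin (k - 1 + 1) → E) 𝓘(ℝ, E) f (rho (ψ t))
            (associatedVectorField hk L s (rho (ψ t))) := by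
      intro ψ hψ0 hb hψ hρψ
      -- `eventually_nhds` makes the equality hold around each nearby t, so that it may be
      -- differentiated there and not only at 0.
      filter_upwards [(ih (by omega) hψ0 hb hψ hρψ).eventually_nhds, hψ, hρψ, hsrc hb hψ]
        with t ht1 ht2 ht3 ht4
      have h1 := hasDerivAt_coord hL hreg hc ht2 ht4 (j := j) (by omega)
      have h2 := hasMFDerivAt_comp_curve (hfd _ (by rwa [base_rho])) ht3
      have h3 : HasDerivAt (fun t => f (rho (ψ t)))
          (mfderiv 𝓘(ℝ, Fin (k - 1 + 1) → E) 𝓘(ℝ, E) f (rho (ψ t))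
            (associatedVectorField hk L s (rho (ψ t)))) t := hasMFDerivAt_iff_hasFDerivAt.1 h2
      exact h1.unique (h3.congr_of_eventuallyEq ht1)
    have hpt : ∀ y, base y ∈ c.source → coord (j + 1) (coords c (s y)) =
        mfderiv 𝓘(ℝ, Fin (k - 1 + 1) → E) 𝓘(ℝ, E) f y (associatedVectorField hk L s y) := by
      intro y hy
      obtain ⟨ψ', hψ'0, hψ', hρψ'⟩ := h.exists_curve hL hreg y
      have h1 := (key ⟨y, hψ'0.symm⟩ (by rwa [hψ'0, hs.base_eq]) hψ' hρψ').self_of_nhds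
      rwa [hψ'0, hs.rho_comp] at h1
    filter_upwards [key hψ0 hb hψ hρψ, hsrc hb hψ] with t ht1 ht2
    rw [ht1, hpt _ (by rwa [base_rho])]

/-- All coordinates up to q_{2k-1} agree, so ψ = s ∘ ρ ∘ ψ near 0. Comparing velocities at 0, where
ψ 0 = s y, gives relatedness at y. -/
theorem CurvesProject.isRelated (h : CurvesProject hk L s)
    (hL : ContMDiff 𝓘(ℝ, Fin (k + 1) → E) 𝓘(ℝ, ℝ) ∞ L) (hreg : IsRegular L)
    (hs : IsSmoothSection s) : IsRelated hk L s := by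
  intro y
  obtain ⟨ψ, hψ0, hψ, hρψ⟩ := h.exists_curve hL hreg y
  have hc : chartAt E (base (ψ 0)) ∈ atlas E Q := chart_mem_atlas E _
  have hb : base (ψ 0) ∈ (chartAt E (base (ψ 0))).source := mem_chart_source E _
  generalize chartAt E (base (ψ 0)) = c at hc hb
  have h1 : ∀ᶠ t in 𝓝 (0 : ℝ), ∀ j ∈ Finset.range (2 * k - 1 + 1),
      coord j (coords c (ψ t)) = coord j (coords c (s (rho (ψ t)))) :=
    (eventually_all_finset _).2 fun j hj => h.eventually_coord_eq hL hreg hs hc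
      (Nat.le_of_lt_succ (Finset.mem_range.1 hj)) ⟨y, hψ0.symm⟩ hb hψ hρψ
  have h2 : ψ =ᶠ[𝓝 0] s ∘ fun t => rho (ψ t) := by
    filter_upwards [h1, hψ.continuousAt.eventually ((isOpen_source hc).mem_nhds hb)] with t ht ht'
    refine (natChart (2 * k - 1) hc).injOn ht' ?_ ?_
    · change base (s (rho (ψ t))) ∈ c.source
      rwa [hs.base_eq, base_rho]
    · exact ext_coord fun j hj => ht j (Finset.mem_range.2 (by omega))
  have h3 := hasMFDerivAt_comp_curve (hs.mdifferentiableAt (rho (ψ 0))) hρψ.self_of_nhds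
  have h4 := smulRight_one_injective (V := Fin (2 * k - 1 + 1) → E)
    (hasMFDerivAt_unique (f := ψ) (h3.congr_of_eventuallyEq h2) hψ.self_of_nhds)
  -- The identity is known at ρ(ψ 0) and ψ 0; this transports it to y and s y across the dependent
  -- tangent spaces.
  have key : ∀ (y' : HigherTangent E (k - 1) Q) (p : HigherTangent E (2 * k - 1) Q),
      y' = y → p = s y →
      (mfderiv 𝓘(ℝ, Fin (k - 1 + 1) → E) 𝓘(ℝ, Fin (2 * k - 1 + 1) → E) s y'
        (associatedVectorField hk L s y') : Fin (2 * k - 1 + 1) → E) =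
        lagrangianVectorField hk L p →
      mfderiv 𝓘(ℝ, Fin (k - 1 + 1) → E) 𝓘(ℝ, Fin (2 * k - 1 + 1) → E) s y
        (associatedVectorField hk L s y) = lagrangianVectorField hk L (s y) := by
    rintro _ _ rfl rfl h
    exact h
  exact key (rho (ψ 0)) (ψ 0) (by rw [hψ0, hs.rho_comp]) hψ0 h4

end HamiltonJacobi

/-! ### The equivalence of the five assertions. -/

theorem mainTheorem3
    {E : Type*} [NormedAddCommGroup E] [NormedSpace ℝ E] [FiniteDimensional ℝ E]
    {Q : Type*} [TopologicalSpace Q] [ChartedSpace E Q] [IsManifold 𝓘(ℝ, E) ∞ Q]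
    [T2Space Q] [SecondCountableTopology Q]
    (k : ℕ) (hk : 1 ≤ k)
    (L : HigherTangent E k Q → ℝ) (hL : ContMDiff 𝓘(ℝ, Fin (k + 1) → E) 𝓘(ℝ, ℝ) ∞ L)
    (hreg : HamiltonJacobi.IsRegular L)
    (s : HigherTangent E (k - 1) Q → HigherTangent E (2 * k - 1) Q)
    (hs : HamiltonJacobi.IsSmoothSection s)
    (hω : HamiltonJacobi.PullbackVanishes L s) :
    [HamiltonJacobi.SolvesHJ hk L s,
      ∀ y, HamiltonJacobi.differential (Fin (k - 1 + 1) → E) (HamiltonJacobi.energy hk L ∘ s) y = 0,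
      HamiltonJacobi.HasLagrangianImage (Fin (2 * k - 1 + 1) → E) (Fin (k - 1 + 1) → E) s
          (HamiltonJacobi.poincareCartanTwoForm L) ∧
        HamiltonJacobi.HasInvariantImage (Fin (2 * k - 1 + 1) → E) (Fin (k - 1 + 1) → E) s
          (HamiltonJacobi.lagrangianVectorField hk L),
      HamiltonJacobi.CurvesProject hk L s,
      HamiltonJacobi.CurvesProject hk L s ∧ HamiltonJacobi.CurvesLift hk L s].TFAE := by
  -- Relatedness is not among the listed assertions; it is the hub through which they are compared.
  have h1 : HamiltonJacobi.SolvesHJ hk L s ↔ HamiltonJacobi.IsRelated hk L s :=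
    ⟨fun h => h.1.isRelated hL hreg hs, fun h => ⟨h.solvesGeneralizedHJ hs, hω⟩⟩
  have h4 : HamiltonJacobi.CurvesProject hk L s ↔ HamiltonJacobi.IsRelated hk L s :=
    ⟨fun h => h.isRelated hL hreg hs, fun h => h.curvesProject hL hreg hs⟩
  tfae_have 1 ↔ 2 := h1.trans (HamiltonJacobi.differential_eq_zero_iff hk hL hreg hs hω).symm
  tfae_have 1 ↔ 3 := by
    rw [h1, HamiltonJacobi.hasInvariantImage_iff hk hs]
    exact ⟨fun h => ⟨HamiltonJacobi.hasLagrangianImage hk hL hreg hs hω, h⟩, fun h => h.2⟩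
  tfae_have 1 ↔ 4 := h1.trans h4.symm
  tfae_have 4 → 5 := fun h => ⟨h, (h4.1 h).curvesLift hs⟩
  tfae_have 5 → 4 := fun h => h.1
  tfae_finish
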